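/- A turn sequence is a finite word $\sigma=\sigma_1\cdots\sigma_n$ in the letters $\mathtt L$ (left turn) and $\mathtt R$ (right turn). A chain realizes $\sigma$ if it is a simple (non-self-intersecting) rectilinear chain that starts at the origin $o$, first heads in direction $+x$, consists of $n+1$ segments of positive integer length, and makes the turns $\sigma_1,\dots,\sigma_n$ in this order; its endpoint $p\in\mathbb Z^2$ is then called reachable by $\sigma$. If $\sigma$ can reach a point $(a,0)$ with $a>0$, let $x^+_\sigma$ be the smallest such $a$. Let $\sigma$ have $l$ letters $\mathtt L$ and $r$ letters $\mathtt R$. The prefix number $\delta_i$ ($0\le i\le n$) is the number of $\mathtt L$'s minus the number of $\mathtt R$'s among $\sigma_1,\dots,\sigma_i$; number the segments of a chain realizing $\sigma$ by $0,\dots,n$; segment $i$ is called a $t$-segment if $\delta_i=t$. The direction of each segment is determined by $\sigma$ alone. A subchain is $z$-monotone ($z\in\{\pm x,\pm y\}$) if it has no segment of direction $-z$; $\sigma$ is $+x$-monotone if the whole chain is. Let $m^o_{+x}$ and $m^p_{+x}$ be the number of $+x$-segments in the maximal $+x$-monotone subchain containing $o$ and containing $p$, respectively. For $z\in\{+y,-y\}$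 let ${}_{+x}m^{o}_{z}$ and ${}_{+x}m^{p}_{z}$ be the number of $z$-segments in the maximal subchain containing $o$, respectively $p$, that is both $+x$-monotone and $z$-monotone (a staircase). Theorem. Let $l-r\ge 0$. If $l-r\ge 5$, then $\sigma$ reaches a point of the positive $x$-axis. Whenever $\sigma$ reaches a point of the positive $x$-axis, the following hold. 1. If $l-r=0$ and $\sigma$ is $+x$-monotone, then $x^+_\sigma\le m^o_{+x}$. If $l-r=0$ and $\sigma$ is not $+x$-monotone, then $$x^+_\sigma\le \min\{m^o_{+x}+\max\{{}_{+x}m^p_{+y},{}_{+x}m^p_{-y}\},\ m^p_{+x}+{}_{+x}m^o_{+y}\}+2\quad\text{if }\sigma_1=\mathtt L,$$ $$x^+_\sigma\le \min\{m^o_{+x}+\max\{{}_{+x}m^p_{+y},{}_{+x}m^p_{-y}\},\ m^p_{+x}+{}_{+x}m^o_{-y}\}+2\quad\text{if }\sigma_1=\mathtt R.$$ 2. If $l-r=1$ and $\sigma$ is $+x$-monotone, then $x^+_\sigma\le m^o_{+x}$. If $l-r=1$ and $\sigma$ is not $+x$-monotone, then $$x^+_\sigma\le \min\{m^o_{+x}+{}_{+x}m^p_{+y}+1,\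 m^p_{+x}+{}_{+x}m^o_{+y}+2\}\quad\text{if }\sigma_1=\mathtt L,$$ $$x^+_\sigma\le \min\{m^o_{+x}+{}_{+x}m^p_{+y}+1,\ m^p_{+x}+{}_{+x}m^o_{-y}+2\}\quad\text{if }\sigma_1=\mathtt R.$$ 3. If $l-r=2$, then $x^+_\sigma\le {}_{+x}m^o_{+y}+2$ if $\sigma_1=\mathtt L$, and $x^+_\sigma\le 2$ if $\sigma_1=\mathtt R$. 4. If $l-r=3$ and $\sigma_1=\mathtt L$, then there is a $(-1)$-segment or a $5$-segment, and $x^+_\sigma\le {}_{+x}m^o_{+y}+2$ if there are only $(-1)$-segments of these two kinds, $x^+_\sigma\le {}_{+x}m^p_{-y}+2$ if there are only $5$-segments, and $x^+_\sigma\le\min\{{}_{+x}m^o_{+y},{}_{+x}m^p_{-y}\}+2$ if there are both. If $l-r=3$ and $\sigma_1=\mathtt R$, then $x^+_\sigma\le 2$. 5. If $l-r=4$ and $\sigma_1=\mathtt L$, then there is a $(-1)$-segment or a $5$-segment, and $x^+_\sigma\le {}_{+x}m^o_{+y}+3$ if there are only $(-1)$-segments, $x^+_\sigma\le {}_{+x}m^p_{-y}+3$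 if there are only $5$-segments, and $x^+_\sigma\le\min\{{}_{+x}m^o_{+y},{}_{+x}m^p_{-y}\}+3$ if there are both. If $l-r=4$ and $\sigma_1=\mathtt R$, then $x^+_\sigma\le\min\{{}_{+x}m^o_{-y},{}_{+x}m^p_{+y}\}+3$. 6. If $l-r=5$, then $x^+_\sigma\le 2$ if $\sigma_1=\mathtt L$, and $x^+_\sigma\le\min\{{}_{+x}m^o_{-y},{}_{+x}m^p_{+y}\}+2$ if $\sigma_1=\mathtt R$. 7. If $l-r\ge 6$ and $l-r\equiv 2\pmod 4$, then $x^+_\sigma\le\lfloor\frac{l-r+2}{4}\rfloor$ if $\sigma_1=\mathtt L$, and $x^+_\sigma\le\lfloor\frac{l-r+2}{4}\rfloor+1$ if $\sigma_1=\mathtt R$. 8. If $l-r\ge 6$ and $l-r\not\equiv 2\pmod 4$, then $x^+_\sigma\le\min\{m^o_{+x}+2,\,m^p_{+x}+1\}+\lfloor\frac{l-r+2}{4}\rfloor$ if $\sigma_1=\mathtt L$, and $x^+_\sigma\le\min\{m^o_{+x}+2,\,m^p_{+x}+2\}+\lfloor\frac{l-r+2}{4}\rfloor$ if $\sigma_1=\mathtt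 R$. -/

import Mathlib

/-- A single turn of a rectilinear chain: a left turn `L` or a right turn `R`. -/
inductive Turn where
  | L : Turn
  | R : Turn
  deriving DecidableEq

/-- A turn sequence `σ = σ₁ σ₂ ⋯ σₙ`, where `n = σ.length`. -/
abbrev TurnSeq : Type := List Turn

namespace TurnSeq

/-- The unit vector of the direction `+x`. -/
def east : ℤ × ℤ := (1, 0)

/-- The unit vector of the direction `+y`. -/
def north : ℤ × ℤ := (0, 1)

/-- The unit vector of the direction `-x`. -/
def west : ℤ × ℤ := (-1, 0)

/-- The unit vector of the direction `-y`. -/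
def south : ℤ × ℤ := (0, -1)

/-- The direction after making a turn: a left turn rotates it by 90 degrees counterclockwise, a
right turn by 90 degrees clockwise. -/
def rotate (h : ℤ × ℤ) : Turn → ℤ × ℤ
  | Turn.L => (-h.2, h.1)
  | Turn.R => (h.2, -h.1)

/-- The direction of the `i`-th segment (`0 ≤ i ≤ n`) of a chain with turn sequence `σ` whose
first segment (number `0`) heads east: the direction after the first `i` turns. -/
def heading (σ : TurnSeq) (i : ℕ) : ℤ × ℤ := (σ.take i).foldl rotate east

/-- The directions of all the `n + 1` segments, in the order from `o` to the endpoint. -/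
def headings (σ : TurnSeq) : List (ℤ × ℤ) := (List.range (σ.length + 1)).map (heading σ)

/-- The prefix (excess) number `δᵢ`: left turns minus right turns among the first `i` turns.
It is the number attached to the `i`-th segment. -/
def prefixNumber (σ : TurnSeq) (i : ℕ) : ℤ :=
  ((σ.take i).count Turn.L : ℤ) - ((σ.take i).count Turn.R : ℤ)

/-- Some segment of the chains with turn sequence `σ` has prefix number `t`. -/
def HasSegment (σ : TurnSeq) (t : ℤ) : Prop := ∃ i ≤ σ.length, prefixNumber σ i = t

/-- The vertices of the chain with turn sequence `σ` that starts at the origin and whose `i`-th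
segment has length `len i`. The `i`-th segment goes from vertex `i` to vertex `i + 1`, the `i`-th
turn is made at vertex `i`, and the endpoint is vertex `n + 1`. -/
def vertex (σ : TurnSeq) (len : ℕ → ℕ) : ℕ → ℤ × ℤ
  | 0 => (0, 0)
  | i + 1 => vertex σ len i + (len i : ℤ) • heading σ i

/-- The integer points of the `i`-th segment: since the segment is parallel to an axis, they are
the integer points of the (degenerate) box spanned by its two ends. -/
def segmentPts (σ : TurnSeq) (len : ℕ → ℕ) (i : ℕ) : Set (ℤ × ℤ) :=
  Set.uIcc (vertex σ len i) (vertex σ len (i + 1))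

/-- The chain has no self-intersection: two different segments meet only if they are consecutive,
and then only in their common vertex. (Two axis-parallel segments with integer ends that meet in
the plane meet in an integer point, and two consecutive ones are perpendicular, so it is enough
to look at integer points.) -/
def IsSimple (σ : TurnSeq) (len : ℕ → ℕ) : Prop :=
  ∀ i j : ℕ, i < j → j ≤ σ.length → ∀ q : ℤ × ℤ,
    q ∈ segmentPts σ len i → q ∈ segmentPts σ len j → j = i + 1 ∧ q = vertex σ len j

/-- The reachable set `A(σ)`: the endpoints of the simple rectilinear chains with turn sequence `σ`
that consist of segments of positive integer length, start at the origin and first head east. -/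
def reachableSet (σ : TurnSeq) : Set (ℤ × ℤ) :=
  {p | ∃ len : ℕ → ℕ, (∀ i ≤ σ.length, 0 < len i) ∧ IsSimple σ len ∧
    vertex σ len (σ.length + 1) = p}

/-- The distances from the origin to the reachable points on the `+x`-axis. -/
def plusXDistances (σ : TurnSeq) : Set ℕ := {x | 0 < x ∧ ((x : ℤ), (0 : ℤ)) ∈ reachableSet σ}

/-- Some point of the `+x`-axis is reachable, i.e. `x⁺_σ` exists. -/
def ReachesPlusX (σ : TurnSeq) : Prop := (plusXDistances σ).Nonempty

/-- `x⁺_σ`: the distance from the origin to the closest reachable point on the `+x`-axis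
(meaningful only if there is one). -/
noncomputable def xPlus (σ : TurnSeq) : ℕ := sInf (plusXDistances σ)

/-- The sequence is `+x`-monotone: its chains have no `-x`-segment. -/
def IsPlusXMonotone (σ : TurnSeq) : Prop := west ∉ headings σ

/-- `m^o_z`: the number of `z`-segments in the maximal `z`-monotone subchain containing `o`, where
a subchain is `z`-monotone if it has no `-z`-segment. -/
def monoO (z : ℤ × ℤ) (σ : TurnSeq) : ℕ :=
  ((headings σ).takeWhile (fun h => h ≠ -z)).count z

/-- `m^p_z`: the number of `z`-segments in the maximal `z`-monotone subchain containing the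
endpoint `p`. -/
def monoP (z : ℤ × ℤ) (σ : TurnSeq) : ℕ :=
  ((headings σ).reverse.takeWhile (fun h => h ≠ -z)).count z

/-- The number of `z₂`-segments in the maximal `(z₁, z₂)`-staircase containing `o`, i.e. in the
maximal subchain containing `o` that is both `z₁`-monotone and `z₂`-monotone. (For perpendicular
directions `z₁`, `z₂` the turns of such a subchain alternate.) -/
def stairO (z₁ z₂ : ℤ × ℤ) (σ : TurnSeq) : ℕ :=
  ((headings σ).takeWhile (fun h => h ≠ -z₁ ∧ h ≠ -z₂)).count z₂

/-- The number of `z₂`-segments in the maximal `(z₁, z₂)`-staircase containing the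
endpoint `p`. -/
def stairP (z₁ z₂ : ℤ × ℤ) (σ : TurnSeq) : ℕ :=
  ((headings σ).reverse.takeWhile (fun h => h ≠ -z₁ ∧ h ≠ -z₂)).count z₂

end TurnSeq

/-! Every upper bound comes from an explicit chain. A chain is stored as the list of its coordinates
(`On`, `Simple`, `Dir`), and `ReachLe σ b` says that some drawing of `σ` ends on the positive axis
at distance at most `b`.

The basic operation inserts two opposite turns into a segment. The segment gets a jog, for which one
column and one row are added to the plane, so the distance grows by at most one (`ReachLe.insert`).
If the segment leaves the vertical strip between the two ends (it is `Free`), the jog fits outside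
the strip and the distance does not change; the new segments are free again (`Real.insert`). Words
of excess zero arise from the empty word by such insertions (`balanced_of_net`), so a small drawing
with marked free segments realizes, at the same distance, every word obtained by putting balanced
words behind the marked turns (`Real.reachLe`). A finite list of drawings, with the word split at
suitable levels of the excess, yields the constants.

The remaining terms count operations that cost one unit each. An inward spiral gains four left turns
per unit (`Real.curl`). A prefix `LR` or `RL` is removed by one unit, which gives the staircases at
`o` (`stairO_north_induction`). Behind the last west segment the tail costs one unit for each of its
east segments, which gives the count of `monoP` (`ReachLe.append_of_no_west`). Reversing the chain
turns statements about `p` into statements about `o` and back (`ReachLe.reverse`), and reflection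
exchanges left and right. For odd excess a turn is appended that makes the last segment head east;
that segment is then cut off, which saves one unit (`ReachLe.exists_mem_dropLast`).

For small excess the drawings need a segment of excess -1 or 5 when the first turn is left (1 or -5
when it is right). Reachability forces one: this is `IsLatticePath.exists_step`, a discrete form of
Hopf's proof of the theorem of turning tangents, in which the quadrant of a moving secant is
followed. -/

namespace TurnSeq

/-! ### Words of turns, their excess and their headings -/

/-- The contribution of a turn to the excess number. -/
def turnVal : Turn → ℤ
  | Turn.L => 1
  | Turn.R => -1

/-- Left turns minus right turns. -/
def net : List Turn → ℤ
  | [] => 0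
  | t :: w => turnVal t + net w

@[simp] theorem turnVal_L : turnVal Turn.L = 1 := rfl
@[simp] theorem turnVal_R : turnVal Turn.R = -1 := rfl
@[simp] theorem net_nil : net [] = 0 := rfl
@[simp] theorem net_cons (t : Turn) (w : List Turn) : net (t :: w) = turnVal t + net w := rfl

@[simp] theorem net_append (u v : List Turn) : net (u ++ v) = net u + net v := by
  induction u with
  | nil => simp
  | cons t u ih => simp [ih]; ring

theorem turnVal_cases (t : Turn) :
    (t = Turn.L ∧ turnVal t = 1) ∨ (t = Turn.R ∧ turnVal t = -1) := by
  cases t <;> simp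

theorem net_eq_count (w : List Turn) : net w = (w.count Turn.L : ℤ) - (w.count Turn.R : ℤ) := by
  induction w with
  | nil => simp
  | cons t w ih => cases t <;> simp [ih] <;> ring

theorem prefixNumber_eq_net (σ : TurnSeq) (i : ℕ) : prefixNumber σ i = net (σ.take i) :=
  (net_eq_count _).symm

@[simp] theorem net_reverse (w : List Turn) : net w.reverse = net w := by
  induction w with
  | nil => simp
  | cons t w ih => simp [ih]; ring

/-- The opposite turn. -/
def flipTurn : Turn → Turn
  | Turn.L => Turn.R
  | Turn.R => Turn.L

@[simp] theorem flipTurn_L : flipTurn Turn.L = Turn.R := rfl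
@[simp] theorem flipTurn_R : flipTurn Turn.R = Turn.L := rfl
@[simp] theorem flipTurn_flipTurn (t : Turn) : flipTurn (flipTurn t) = t := by cases t <;> rfl
@[simp] theorem turnVal_flipTurn (t : Turn) : turnVal (flipTurn t) = -turnVal t := by
  cases t <;> rfl

@[simp] theorem net_map_flipTurn (w : List Turn) : net (w.map flipTurn) = -net w := by
  induction w with
  | nil => simp
  | cons t w ih => simp [ih]; ring

@[simp] theorem map_flipTurn_flipTurn (w : List Turn) : (w.map flipTurn).map flipTurn = w := by
  simp [Function.comp_def]

/-- The direction reached from east after an excess of `k` left turns. -/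
def dirOf (k : ℤ) : ℤ × ℤ :=
  if k % 4 = 0 then east else if k % 4 = 1 then north else if k % 4 = 2 then west else south

theorem dirOf_cases (k : ℤ) : (k % 4 = 0 ∧ dirOf k = (1, 0)) ∨ (k % 4 = 1 ∧ dirOf k = (0, 1)) ∨
    (k % 4 = 2 ∧ dirOf k = (-1, 0)) ∨ (k % 4 = 3 ∧ dirOf k = (0, -1)) := by
  unfold dirOf east north west south
  have := Int.emod_nonneg k (show (4 : ℤ) ≠ 0 by norm_num)
  have := Int.emod_lt_of_pos k (show (0 : ℤ) < 4 by norm_num)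
  split_ifs <;> simp <;> omega

theorem dirOf_congr {a b : ℤ} (h : a % 4 = b % 4) : dirOf a = dirOf b := by simp [dirOf, h]

theorem rotate_dirOf (k : ℤ) (t : Turn) : rotate (dirOf k) t = dirOf (k + turnVal t) := by
  rcases dirOf_cases k with ⟨h, e⟩ | ⟨h, e⟩ | ⟨h, e⟩ | ⟨h, e⟩ <;> rw [e] <;> cases t <;>
    simp only [rotate, turnVal] <;> unfold dirOf east north west south <;>
    split_ifs <;> simp <;> omega

theorem foldl_rotate_dirOf (w : List Turn) (k : ℤ) :
    w.foldl rotate (dirOf k) = dirOf (k + net w) := by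
  induction w generalizing k with
  | nil => simp
  | cons t w ih => simp only [List.foldl_cons, rotate_dirOf, ih, net_cons]; congr 1; ring

theorem heading_eq (σ : TurnSeq) (i : ℕ) : heading σ i = dirOf (net (σ.take i)) := by
  have : east = dirOf 0 := by simp [dirOf]
  rw [heading, this, foldl_rotate_dirOf, zero_add]

theorem dirOf_eq_east {k : ℤ} : dirOf k = east ↔ k % 4 = 0 := by
  rcases dirOf_cases k with ⟨h, e⟩ | ⟨h, e⟩ | ⟨h, e⟩ | ⟨h, e⟩ <;> simp [e, h, east]

theorem dirOf_eq_west {k : ℤ} : dirOf k = west ↔ k % 4 = 2 := by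
  rcases dirOf_cases k with ⟨h, e⟩ | ⟨h, e⟩ | ⟨h, e⟩ | ⟨h, e⟩ <;> simp [e, h, west]

/-- The headings of the segments after each turn of a word that is started at excess `k`. -/
def hs (k : ℤ) : List Turn → List (ℤ × ℤ)
  | [] => []
  | t :: w => dirOf (k + turnVal t) :: hs (k + turnVal t) w

@[simp] theorem hs_nil (k : ℤ) : hs k [] = [] := rfl
@[simp] theorem hs_cons (k : ℤ) (t : Turn) (w : List Turn) :
    hs k (t :: w) = dirOf (k + turnVal t) :: hs (k + turnVal t) w := rfl

@[simp] theorem hs_append (k : ℤ) (u v : List Turn) :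
    hs k (u ++ v) = hs k u ++ hs (k + net u) v := by
  induction u generalizing k with
  | nil => simp
  | cons t u ih => simp [ih, add_assoc]

theorem hs_eq_map (k : ℤ) (w : List Turn) :
    dirOf k :: hs k w = (List.range (w.length + 1)).map (fun i => dirOf (k + net (w.take i))) := by
  induction w generalizing k with
  | nil => simp
  | cons t w ih =>
    rw [hs_cons, ih, List.length_cons, List.range_succ_eq_map (n := w.length + 1)]
    simp only [List.map_cons, List.map_map, List.take_zero, net_nil, add_zero]
    congr 1
    apply List.map_congr_left
    intro i _
    simp [add_assoc]

theorem headings_eq (σ : TurnSeq) : headings σ = east :: hs 0 σ := by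
  have h := hs_eq_map 0 σ
  have e : dirOf 0 = east := by simp [dirOf]
  rw [e] at h
  rw [h, headings]
  apply List.map_congr_left
  intro i _
  simp [heading_eq]

/-- The split is at the first step that lifts the excess above `t`; hence no prefix of `u` exceeds
`t`, a fact that `exists_split_LL` uses. -/
theorem exists_split_up (w : List Turn) (t : ℤ) (ht : 0 ≤ t) (hw : t + 1 ≤ net w) :
    ∃ u v, w = u ++ Turn.L :: v ∧ net u = t ∧ ∀ u₁ u₂, u = u₁ ++ u₂ → net u₁ ≤ t := by
  induction w generalizing t with
  | nil => simp at hw; omega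
  | cons x w ih =>
    cases x with
    | L =>
      by_cases h0 : t = 0
      · refine ⟨[], w, rfl, by simp [h0], ?_⟩
        intro u₁ u₂ h
        have : u₁ = [] := by simp_all
        simp [this, ht]
      · obtain ⟨u, v, h1, h2, h3⟩ := ih (t - 1) (by omega) (by simp at hw; omega)
        refine ⟨Turn.L :: u, v, by simp [h1], by simp [h2], ?_⟩
        intro u₁ u₂ h
        cases u₁ with
        | nil => simpa using ht
        | cons y u₁ =>
          simp only [List.cons_append, List.cons.injEq] at h
          have := h3 u₁ u₂ h.2
          simp [← h.1]; omega
    | R =>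
      obtain ⟨u, v, h1, h2, h3⟩ := ih (t + 1) (by omega) (by simp at hw; omega)
      refine ⟨Turn.R :: u, v, by simp [h1], by simp [h2], ?_⟩
      intro u₁ u₂ h
      cases u₁ with
      | nil => simpa using ht
      | cons y u₁ =>
        simp only [List.cons_append, List.cons.injEq] at h
        have := h3 u₁ u₂ h.2
        simp [← h.1]; omega

theorem exists_split_down (w : List Turn) (t : ℤ) (ht : t ≤ 0) (hw : net w ≤ t - 1) :
    ∃ u v, w = u ++ Turn.R :: v ∧ net u = t := by
  obtain ⟨u, v, h1, h2, -⟩ := exists_split_up (w.map flipTurn) (-t) (by omega) (by simp; omega)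
  refine ⟨u.map flipTurn, v.map flipTurn, ?_, by simp [h2]⟩
  rw [← map_flipTurn_flipTurn w, h1]; simp

/-- At the first passage from 1 to 2 the preceding letter cannot be `R`, since the excess would have
been 2 before it. So two consecutive left turns lead from 0 to 2. -/
theorem exists_split_LL (w : List Turn) (hw : 2 ≤ net w) :
    ∃ u v, w = u ++ Turn.L :: Turn.L :: v ∧ net u = 0 := by
  obtain ⟨u, v, h1, h2, h3⟩ := exists_split_up w 1 (by omega) (by omega)
  rcases List.eq_nil_or_concat u with rfl | ⟨u', x, rfl⟩
  · simp at h2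
  · have := h3 u' [x] (by simp)
    cases x with
    | L => exact ⟨u', v, by simp [h1], by simp at h2; omega⟩
    | R => simp at h2; omega

/-- `t` is the excess number of some prefix. -/
def HasNet (w : List Turn) (t : ℤ) : Prop := ∃ u v, w = u ++ v ∧ net u = t

theorem hasSegment_iff (σ : TurnSeq) (t : ℤ) : σ.HasSegment t ↔ HasNet σ t := by
  constructor
  · rintro ⟨i, -, h⟩
    exact ⟨σ.take i, σ.drop i, (List.take_append_drop i σ).symm, by rw [← h, prefixNumber_eq_net]⟩
  · rintro ⟨u, v, rfl, h⟩
    exact ⟨u.length, by simp, by rw [prefixNumber_eq_net]; simpa using h⟩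

theorem HasNet.append_right {w : List Turn} {t : ℤ} (h : HasNet w t) (x : List Turn) :
    HasNet (w ++ x) t := by
  obtain ⟨u, v, rfl, h⟩ := h
  exact ⟨u, v ++ x, by simp, h⟩

theorem hasNet_append (w x : List Turn) (t : ℤ) :
    HasNet (w ++ x) t ↔ HasNet w t ∨ HasNet x (t - net w) := by
  constructor
  · rintro ⟨u, v, h, hu⟩
    rcases List.append_eq_append_iff.1 h with ⟨a, h1, h2⟩ | ⟨a, h1, h2⟩
    · right
      exact ⟨a, v, h2, by rw [h1] at hu; simp at hu; omega⟩
    · left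
      exact ⟨u, a, h1, hu⟩
  · rintro (h | ⟨u, v, rfl, hu⟩)
    · exact h.append_right x
    · exact ⟨w ++ u, v, by simp, by simp [hu]⟩

theorem hasNet_nil (t : ℤ) : HasNet [] t ↔ t = 0 := by
  constructor
  · rintro ⟨u, v, h, hu⟩
    have : u = [] := by simp_all
    simp [← hu, this]
  · rintro rfl; exact ⟨[], [], rfl, rfl⟩

theorem hasNet_cons (x : Turn) (w : List Turn) (t : ℤ) :
    HasNet (x :: w) t ↔ t = 0 ∨ HasNet w (t - turnVal x) := by
  constructor
  · rintro ⟨u, v, h, hu⟩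
    cases u with
    | nil => left; simpa using hu.symm
    | cons y u =>
      simp only [List.cons_append, List.cons.injEq] at h
      right
      exact ⟨u, v, h.2, by rw [← hu, h.1]; simp⟩
  · rintro (rfl | ⟨u, v, rfl, hu⟩)
    · exact ⟨[], _, rfl, rfl⟩
    · exact ⟨x :: u, v, rfl, by simp [hu]⟩

theorem hasNet_net (w : List Turn) : HasNet w (net w) := ⟨w, [], by simp, rfl⟩

/-! ### Balanced words, straight words and stretches without west segments -/

/-- The words that arise from the empty word by inserting pairs of opposite turns. -/
inductive Balanced : List Turn → Prop
  | nil : Balanced []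
  | insert (u v : List Turn) (x y : Turn) : x ≠ y → Balanced (u ++ v) → Balanced (u ++ x :: y :: v)

theorem replicate_or_exists_adjacent (w : List Turn) :
    (∃ t n, w = List.replicate n t) ∨ ∃ u x y v, w = u ++ x :: y :: v ∧ x ≠ y := by
  induction w with
  | nil => exact .inl ⟨Turn.L, 0, rfl⟩
  | cons a w ih =>
    rcases ih with ⟨t, n, rfl⟩ | ⟨u, x, y, v, rfl, h⟩
    · cases n with
      | zero => exact .inl ⟨a, 1, rfl⟩
      | succ n =>
        by_cases h : a = t
        · exact .inl ⟨t, n + 2, by simp [h, List.replicate_succ]⟩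
        · exact .inr ⟨[], a, t, List.replicate n t, by simp [List.replicate_succ], h⟩
    · exact .inr ⟨a :: u, x, y, v, by simp, h⟩

theorem net_replicate (n : ℕ) (t : Turn) : net (List.replicate n t) = n * turnVal t := by
  induction n with
  | zero => simp
  | succ n ih => simp [List.replicate_succ, ih]; ring

theorem turnVal_add_of_ne {x y : Turn} (h : x ≠ y) : turnVal x + turnVal y = 0 := by
  cases x <;> cases y <;> simp_all

theorem balanced_of_net (w : List Turn) (h : net w = 0) : Balanced w := by
  induction hn : w.length using Nat.strong_induction_on generalizing w with
  | _ n ih =>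
    rcases replicate_or_exists_adjacent w with ⟨t, m, rfl⟩ | ⟨u, x, y, v, rfl, hxy⟩
    · have : m = 0 := by
        rw [net_replicate] at h
        cases t <;> simp at h <;> exact h
      subst this
      exact Balanced.nil
    · have := turnVal_add_of_ne hxy
      refine Balanced.insert u v x y hxy (ih _ ?_ (u ++ v) ?_ rfl)
      · simp at hn ⊢; omega
      · simp at h ⊢; omega

/-- The constant word of the given excess. -/
def straightWord (k : ℤ) : List Turn :=
  if 0 ≤ k then List.replicate k.toNat Turn.L else List.replicate (-k).toNat Turn.R

theorem straightWord_replicate (n : ℕ) (t : Turn) :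
    straightWord (net (List.replicate n t)) = List.replicate n t := by
  rw [net_replicate]
  cases t
  · simp [straightWord]
  · rcases Nat.eq_zero_or_pos n with rfl | h
    · simp [straightWord]
    · have : ¬ (0 : ℤ) ≤ n * turnVal Turn.R := by simp; omega
      rw [straightWord, if_neg this]; simp

/-- Exactly one of the two headings is horizontal, and it is not west. A pair inserted into a
west-free stretch thus adds one east segment, as much as it costs in `ReachLe.insert`. -/
theorem count_pair_east {k : ℤ} {x : Turn} (h1 : dirOf k ≠ west)
    (h2 : dirOf (k + turnVal x) ≠ west) :
    List.count east [dirOf (k + turnVal x), dirOf k] = 1 := by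
  simp only [ne_eq, dirOf_eq_west] at h1 h2
  rcases turnVal_cases x with ⟨-, e⟩ | ⟨-, e⟩ <;> rw [e] at h2 ⊢ <;>
    simp only [List.count_cons, List.count_nil, beq_iff_eq, dirOf_eq_east] <;>
    split_ifs <;> omega

/-- Headings west occur at the levels congruent to 2 modulo 4. A stretch that starts on such a level
and avoids all of them afterwards stays strictly between two neighbouring ones. -/
theorem net_bounds_of_no_west (k : ℤ) (hk : k % 4 = 2) (v : List Turn) (h : west ∉ hs k v) :
    v = [] ∨ (1 ≤ net v ∧ net v ≤ 3) ∨ (-3 ≤ net v ∧ net v ≤ -1) := by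
  induction v using List.reverseRecOn with
  | nil => simp
  | append_singleton v t ih =>
    right
    simp only [hs_append, hs_cons, hs_nil, List.mem_append, List.mem_cons, List.not_mem_nil,
      or_false, not_or] at h
    have h2 : ¬ dirOf (k + net v + turnVal t) = west := fun e => h.2 e.symm
    rw [dirOf_eq_west] at h2
    have e := turnVal_cases t
    rcases ih h.1 with rfl | h1
    · simp; omega
    · simp; omega

theorem net_bounds_of_no_west_zero (v : List Turn) (h : west ∉ hs 0 v) :
    -1 ≤ net v ∧ net v ≤ 1 := by
  induction v using List.reverseRecOn with
  | nil => simp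
  | append_singleton v t ih =>
    simp only [hs_append, hs_cons, hs_nil, List.mem_append, List.mem_cons, List.not_mem_nil,
      or_false, not_or] at h
    have h2 : ¬ dirOf (0 + net v + turnVal t) = west := fun e => h.2 e.symm
    rw [dirOf_eq_west] at h2
    have e := turnVal_cases t
    have := ih h.1
    simp; omega

theorem exists_last_west (k : ℤ) (w : List Turn) (h : west ∈ hs k w) :
    ∃ u v, w = u ++ v ∧ u ≠ [] ∧ (k + net u) % 4 = 2 ∧ west ∉ hs (k + net u) v := by
  induction w generalizing k with
  | nil => simp at h
  | cons t w ih =>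
    by_cases hw : west ∈ hs (k + turnVal t) w
    · obtain ⟨u, v, rfl, h1, h2, h3⟩ := ih _ hw
      refine ⟨t :: u, v, rfl, by simp, ?_, ?_⟩
      · simpa [add_assoc] using h2
      · simpa [add_assoc] using h3
    · simp only [hs_cons, List.mem_cons, hw, or_false] at h
      refine ⟨[t], w, rfl, by simp, ?_, ?_⟩
      · simpa using dirOf_eq_west.1 h.symm
      · simpa using hw

/-! ### Headings under reflection and reversal -/

/-- Reflection in the `x`-axis. -/
def flipY (v : ℤ × ℤ) : ℤ × ℤ := (v.1, -v.2)

theorem flipY_dirOf (k : ℤ) : flipY (dirOf k) = dirOf (-k) := by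
  rcases dirOf_cases k with ⟨h, e⟩ | ⟨h, e⟩ | ⟨h, e⟩ | ⟨h, e⟩ <;> rw [e] <;>
  rcases dirOf_cases (-k) with ⟨h', e'⟩ | ⟨h', e'⟩ | ⟨h', e'⟩ | ⟨h', e'⟩ <;> rw [e'] <;>
  first | (exfalso; omega) | rfl

theorem hs_map_flipTurn (k : ℤ) (w : List Turn) :
    hs (-k) (w.map flipTurn) = (hs k w).map flipY := by
  induction w generalizing k with
  | nil => rfl
  | cons t w ih =>
    simp only [List.map_cons, hs_cons, turnVal_flipTurn, flipY_dirOf, ← ih, neg_add]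

theorem headings_map_flipTurn (σ : TurnSeq) :
    headings (σ.map flipTurn) = (headings σ).map flipY := by
  rw [headings_eq, headings_eq]
  have := hs_map_flipTurn 0 σ
  simp only [neg_zero] at this
  simp [this, flipY, east]

/-- Running backwards negates the headings and exchanges left and right; a reflection in a vertical
line restores the turns. Together they act on headings as `flipY`. The excess has to be divisible by
4 for the last segment to head east, so that the new chain starts east. -/
theorem headings_reverse (σ : TurnSeq) (h : net σ % 4 = 0) :
    headings σ.reverse = ((headings σ).map flipY).reverse := by
  apply List.ext_getElem
  · simp [headings]
  · intro i h1 h2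
    simp only [headings, List.length_map, List.length_range, List.length_reverse] at h1
    simp only [headings, List.length_reverse, List.getElem_map, List.getElem_range,
      List.getElem_reverse, List.length_map, List.length_range, heading_eq, flipY_dirOf]
    apply dirOf_congr
    have e : σ.reverse.take i = (σ.drop (σ.length - i)).reverse := by
      rw [List.take_reverse]
    have e2 : net σ = net (σ.take (σ.length - i)) + net (σ.drop (σ.length - i)) := by
      rw [← net_append, List.take_append_drop]
    have e3 : σ.length + 1 - 1 - i = σ.length - i := by omega
    rw [e, net_reverse, e3]
    omega

/-! ### Chains as coordinate sequences, and the insertion of a jog -/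

/-- `z` lies between `a` and `b`. -/
def Btw (z a b : ℤ) : Prop := (a ≤ z ∧ z ≤ b) ∨ (b ≤ z ∧ z ≤ a)

/-- A chain is described by the sequence `c` of its coordinates: even terms are abscissae, odd
terms are ordinates, and segment `j` lies on the line with coordinate `c (j + 1)` and spans from
`c j` to `c (j + 2)`. `On c j q` says that the point with abscissa `q 0` and ordinate `q 1` lies on
segment `j`. -/
def On (c : ℕ → ℤ) (j : ℕ) (q : ℕ → ℤ) : Prop :=
  q ((j + 1) % 2) = c (j + 1) ∧ Btw (q (j % 2)) (c j) (c (j + 2))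

/-- The segments `0, …, n` of the chain meet only if they are consecutive. -/
def Simple (n : ℕ) (c : ℕ → ℤ) : Prop :=
  ∀ j k, j + 1 < k → k ≤ n → ∀ q, On c j q → ¬ On c k q

/-- The sign of the heading with excess number `k`. -/
def sgn (k : ℤ) : ℤ := if k % 4 < 2 then 1 else -1

/-- The segments of the chain have the directions that the turn sequence prescribes. -/
def Dir (σ : List Turn) (c : ℕ → ℤ) : Prop :=
  ∀ j ≤ σ.length, 0 < sgn (net (σ.take j)) * (c (j + 2) - c j)

theorem sgn_cases (k : ℤ) : (k % 4 < 2 ∧ sgn k = 1) ∨ (2 ≤ k % 4 ∧ sgn k = -1) := by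
  unfold sgn; split_ifs with h
  · exact .inl ⟨h, rfl⟩
  · exact .inr ⟨by omega, rfl⟩

/-- Make room after the coordinate `g`. -/
def gapAt (g z : ℤ) : ℤ := if z ≤ g then z else z + 1

/-- Make room on the side `s` of the coordinate `l`. -/
def pushOff (s l z : ℤ) : ℤ := if 0 < s * (z - l) then z + s else z

/-- The stretching of the plane used to insert a jog into segment `i`. -/
def stretchAt (i : ℕ) (g s l : ℤ) (p : ℕ) (z : ℤ) : ℤ :=
  if p % 2 = i % 2 then gapAt g z else pushOff s l z

/-- The chain with a jog inserted into segment `i` behind the coordinate `g`; the two halves of the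
segment are put on the lines `α` and `β`. -/
def jog (c : ℕ → ℤ) (i : ℕ) (g s α β : ℤ) (j : ℕ) : ℤ :=
  if j ≤ i then stretchAt i g s (c (i + 1)) j (c j) else if j = i + 1 then α
  else if j = i + 2 then g + 1 else if j = i + 3 then β
  else stretchAt i g s (c (i + 1)) j (c (j - 2))

/-- The inverse of `stretchAt`. -/
def shrinkAt (i : ℕ) (g s l : ℤ) (p : ℕ) (z : ℤ) : ℤ :=
  if p % 2 = i % 2 then (if z ≤ g then z else z - 1) else (if 0 < s * (z - l) then z - s else z)

theorem shrinkAt_mono {i : ℕ} {g s l : ℤ} (hs : s = 1 ∨ s = -1) (p : ℕ) {y z : ℤ} (h : y ≤ z) :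
    shrinkAt i g s l p y ≤ shrinkAt i g s l p z := by
  unfold shrinkAt
  rcases hs with rfl | rfl <;> split_ifs <;> omega

theorem Btw.shrinkAt {i : ℕ} {g s l : ℤ} (hs : s = 1 ∨ s = -1) (p : ℕ) {z a b : ℤ}
    (h : Btw z a b) : Btw (shrinkAt i g s l p z) (shrinkAt i g s l p a) (shrinkAt i g s l p b) := by
  rcases h with ⟨h1, h2⟩ | ⟨h1, h2⟩
  · exact .inl ⟨shrinkAt_mono hs p h1, shrinkAt_mono hs p h2⟩
  · exact .inr ⟨shrinkAt_mono hs p h1, shrinkAt_mono hs p h2⟩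

theorem shrinkAt_stretchAt {i : ℕ} {g s l : ℤ} (hs : s = 1 ∨ s = -1) (p : ℕ) (z : ℤ) :
    shrinkAt i g s l p (stretchAt i g s l p z) = z := by
  unfold shrinkAt stretchAt gapAt pushOff
  rcases hs with rfl | rfl <;> split_ifs <;> omega

theorem shrinkAt_congr {i : ℕ} {g s l : ℤ} {p p' : ℕ} (h : p % 2 = p' % 2) (z : ℤ) :
    shrinkAt i g s l p z = shrinkAt i g s l p' z := by
  unfold shrinkAt; rw [h]

theorem stretchAt_congr {i : ℕ} {g s l : ℤ} {p p' : ℕ} (h : p % 2 = p' % 2) (z : ℤ) :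
    stretchAt i g s l p z = stretchAt i g s l p' z := by
  unfold stretchAt; rw [h]

/-- The index `i + 2` is left out because its line `g + 1` collapses to `g`, which need not be a
coordinate of the old chain. -/
theorem shrinkAt_jog {c : ℕ → ℤ} {i : ℕ} {g s α β : ℤ} (hs : s = 1 ∨ s = -1)
    (hαβ : (α = c (i + 1) ∧ β = c (i + 1) + s) ∨ (α = c (i + 1) + s ∧ β = c (i + 1)))
    (j : ℕ) (hj : j ≠ i + 2) :
    shrinkAt i g s (c (i + 1)) j (jog c i g s α β j) =
      c (if j ≤ i + 1 then j else j - 2) := by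
  unfold jog
  by_cases h1 : j ≤ i
  · simp only [h1, if_true, shrinkAt_stretchAt hs, show j ≤ i + 1 by omega]
  have key : ∀ z, (z = c (i + 1) ∨ z = c (i + 1) + s) →
      shrinkAt i g s (c (i + 1)) (i + 1) z = c (i + 1) := by
    intro z hz
    unfold shrinkAt
    rw [if_neg (by omega)]
    rcases hs with rfl | rfl <;> rcases hz with rfl | rfl <;> split_ifs <;> omega
  by_cases h2 : j = i + 1
  · subst h2
    simp only [h1, if_false, if_true, le_refl]
    exact key _ (by tauto)
  by_cases h3 : j = i + 3
  · subst h3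
    simp only [h1, if_false, h2, hj, if_true, show ¬ (i + 3 ≤ i + 1) by omega]
    rw [shrinkAt_congr (p' := i + 1) (by omega)]
    exact key _ (by tauto)
  · simp only [h1, if_false, h2, hj, h3, show ¬ (j ≤ i + 1) by omega, shrinkAt_stretchAt hs]

/-- Collapsing the added row and column is monotone, so it preserves betweenness. It maps the chain
with the jog into the old chain, the segments `i`, `i + 1`, `i + 2` all into segment `i`; a
self-intersection therefore descends to the old chain. -/
theorem on_jog {c : ℕ → ℤ} {i : ℕ} {g s α β : ℤ} (hs : s = 1 ∨ s = -1)
    (hαβ : (α = c (i + 1) ∧ β = c (i + 1) + s) ∨ (α = c (i + 1) + s ∧ β = c (i + 1)))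
    (hg : (c i ≤ g ∧ g + 1 ≤ c (i + 2)) ∨ (c (i + 2) ≤ g ∧ g + 1 ≤ c i))
    {j : ℕ} {q : ℕ → ℤ} (h : On (jog c i g s α β) j q) :
    On c (if j ≤ i then j else if j ≤ i + 2 then i else j - 2)
      (fun p => shrinkAt i g s (c (i + 1)) p (q p)) := by
  have e := shrinkAt_jog (g := g) hs hαβ
  obtain ⟨h1, h2⟩ := h
  have h2' := h2.shrinkAt (i := i) (g := g) (l := c (i + 1)) hs (j % 2)
  have m1 : ∀ z, shrinkAt i g s (c (i + 1)) (j % 2) z = shrinkAt i g s (c (i + 1)) j z :=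
    fun z => shrinkAt_congr (by omega) z
  have m2 : ∀ z, shrinkAt i g s (c (i + 1)) ((j + 1) % 2) z
      = shrinkAt i g s (c (i + 1)) (j + 1) z := fun z => shrinkAt_congr (by omega) z
  have m3 : ∀ z, shrinkAt i g s (c (i + 1)) j z
      = shrinkAt i g s (c (i + 1)) (j + 2) z := fun z => shrinkAt_congr (by omega) z
  have gm : shrinkAt i g s (c (i + 1)) i (g + 1) = g := by
    unfold shrinkAt; rw [if_pos rfl, if_neg (by omega)]; ring
  by_cases hj : j < i ∨ i + 2 < j
  · refine ⟨?_, ?_⟩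
    · have a1 := e (j + 1) (by omega)
      have r : ((if j ≤ i then j else if j ≤ i + 2 then i else j - 2) + 1) % 2 = (j + 1) % 2 := by
        split_ifs <;> omega
      simp only [r, h1, m2, a1]
      congr 1
      split_ifs <;> omega
    · have a1 := e j (by omega)
      have a2 := e (j + 2) (by omega)
      rw [m1 (jog _ _ _ _ _ _ j), m1 (jog _ _ _ _ _ _ (j + 2)), a1, m3, a2] at h2'
      have r : (if j ≤ i then j else if j ≤ i + 2 then i else j - 2) % 2 = j % 2 := by
        split_ifs <;> omega
      rw [r]
      rw [show (if j ≤ i then j else if j ≤ i + 2 then i else j - 2) + 2 =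
        (if j + 2 ≤ i + 1 then j + 2 else j + 2 - 2) by split_ifs <;> omega]
      rw [show (if j ≤ i then j else if j ≤ i + 2 then i else j - 2) =
        (if j ≤ i + 1 then j else j - 2) by split_ifs <;> omega]
      exact h2'
  · have hold : (if j ≤ i then j else if j ≤ i + 2 then i else j - 2) = i := by
      split_ifs <;> omega
    rw [hold]
    obtain rfl | rfl | rfl : j = i ∨ j = i + 1 ∨ j = i + 2 := by omega
    · have a0 := e j (by omega)
      have a1 := e (j + 1) (by omega)
      simp only [show j ≤ j + 1 by omega, le_refl, if_true] at a0 a1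
      refine ⟨by simp only [m2, h1, a1], ?_⟩
      rw [m1, m1, m1, a0] at h2'
      have : jog c j g s α β (j + 2) = g + 1 := by simp [jog]
      rw [this, gm] at h2'
      simp only [m1]
      unfold Btw at h2' ⊢
      omega
    · have a1 := e (i + 1) (by omega)
      have a3 := e (i + 3) (by omega)
      simp only [le_refl, if_true, show ¬ (i + 3 ≤ i + 1) by omega, if_false,
        show i + 3 - 2 = i + 1 by omega] at a1 a3
      have h3 : jog c i g s α β (i + 1 + 1) = g + 1 := by simp [jog]
      rw [h3, show (i + 1 + 1) % 2 = i % 2 by omega] at h1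
      rw [m1, m1, m1, a1, m3 (jog _ _ _ _ _ _ _), show i + 1 + 2 = i + 3 from rfl, a3] at h2'
      refine ⟨?_, ?_⟩
      · simp only [m1]
        unfold Btw at h2'
        omega
      · simp only [h1]
        rw [shrinkAt_congr (p' := i) (by omega), gm]
        unfold Btw; omega
    · have a3 := e (i + 3) (by omega)
      have a4 := e (i + 4) (by omega)
      simp only [show ¬ (i + 3 ≤ i + 1) by omega, show ¬ (i + 4 ≤ i + 1) by omega, if_false,
        show i + 3 - 2 = i + 1 by omega, show i + 4 - 2 = i + 2 by omega] at a3 a4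
      have h3 : jog c i g s α β (i + 2) = g + 1 := by simp [jog]
      rw [h3, m1, m1, m1, m3 (jog _ _ _ _ _ _ _), a4,
        shrinkAt_congr (p' := i) (p := i + 2) (z := g + 1) (by omega), gm] at h2'
      refine ⟨?_, ?_⟩
      · rw [show (i + 1) % 2 = (i + 2 + 1) % 2 by omega]
        simp only [h1, m2]
        exact a3
      · rw [show i % 2 = (i + 2) % 2 by omega]
        simp only [m1]
        unfold Btw at h2' ⊢; omega

theorem jog_zero_parity {c : ℕ → ℤ} {i : ℕ} {g s α β : ℤ} {j : ℕ} (h : j ≤ i) (hp : j % 2 = i % 2) :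
    jog c i g s α β j = gapAt g (c j) := by
  unfold jog stretchAt; simp [h, hp]

theorem jog_after {c : ℕ → ℤ} {i : ℕ} {g s α β : ℤ} (j : ℕ) (h : i + 2 ≤ j) :
    jog c i g s α β (j + 2) = stretchAt i g s (c (i + 1)) j (c j) := by
  unfold jog
  rw [if_neg (by omega), if_neg (by omega), if_neg (by omega), if_neg (by omega),
    stretchAt_congr (p' := j) (by omega)]
  simp

theorem simple_jog {n : ℕ} {c : ℕ → ℤ} (hc : Simple n c) {i : ℕ} (hi : i ≤ n) {g s α β : ℤ}
    (hs : s = 1 ∨ s = -1)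
    (hαβ : (α = c (i + 1) ∧ β = c (i + 1) + s) ∨ (α = c (i + 1) + s ∧ β = c (i + 1)))
    (hg : (c i ≤ g ∧ g + 1 ≤ c (i + 2)) ∨ (c (i + 2) ≤ g ∧ g + 1 ≤ c i)) :
    Simple (n + 2) (jog c i g s α β) := by
  intro j k hjk hk q hj hk'
  have pj := on_jog hs hαβ hg hj
  have pk := on_jog hs hαβ hg hk'
  by_cases hn : (if j ≤ i then j else if j ≤ i + 2 then i else j - 2) + 1 <
      (if k ≤ i then k else if k ≤ i + 2 then i else k - 2)
  · exact hc _ _ hn (by split_ifs <;> omega) _ pj pk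
  have c0 : jog c i g s α β i = gapAt g (c i) := jog_zero_parity le_rfl rfl
  have c1 : jog c i g s α β (i + 1) = α := by simp [jog]
  have c2 : jog c i g s α β (i + 2) = g + 1 := by simp [jog]
  have c3 : jog c i g s α β (i + 3) = β := by simp [jog]
  have c4 : jog c i g s α β (i + 4) = gapAt g (c (i + 2)) := by
    rw [jog_after (i + 2) le_rfl]; unfold stretchAt; rw [if_pos (by omega)]
  -- These are the pairs of non-consecutive segments whose images are equal or consecutive, so that
  -- simplicity of the old chain says nothing about them. They are separated by their coordinates.
  have cases : (j = i ∧ k = i + 2) ∨ (j + 1 = i ∧ k = i + 1) ∨ (j + 1 = i ∧ k = i + 2) ∨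
      (j = i ∧ k = i + 3) ∨ (j = i + 1 ∧ k = i + 3) := by
    split_ifs at hn <;> omega
  obtain ⟨j1, j2⟩ := hj
  obtain ⟨k1, k2⟩ := hk'
  unfold Btw at j2 k2
  unfold gapAt at c0 c4
  rcases cases with ⟨rfl, rfl⟩ | ⟨rfl, rfl⟩ | ⟨rfl, rfl⟩ | ⟨rfl, rfl⟩ | ⟨rfl, rfl⟩
  · rw [show (j + 2 + 1) % 2 = (j + 1) % 2 by omega, j1, c1, show j + 2 + 1 = j + 3 from rfl,
      c3] at k1
    omega
  · rw [show (j + 1 + 1 + 1) % 2 = (j + 1) % 2 by omega, j1, c0,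
      show j + 1 + 1 + 1 = j + 1 + 2 from rfl, c2] at k1
    split_ifs at k1 <;> omega
  · rw [show (j + 1 + 2) % 2 = (j + 1) % 2 by omega, j1, c0, c2,
      show j + 1 + 2 + 2 = j + 1 + 4 from rfl, c4] at k2
    split_ifs at k2 <;> omega
  · rw [show (j + 3 + 1) % 2 = j % 2 by omega, show j + 3 + 1 = j + 4 from rfl, c4] at k1
    rw [k1, c0, c2] at j2
    split_ifs at j2 <;> omega
  · rw [show (i + 3 + 1) % 2 = i % 2 by omega, show i + 3 + 1 = i + 4 from rfl, c4] at k1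
    rw [show (i + 1 + 1) % 2 = i % 2 by omega, show i + 1 + 1 = i + 2 from rfl, c2, k1] at j1
    split_ifs at j1 <;> omega

/-- `c` draws `σ` with both ends on the same horizontal line, the endpoint being `a` to the right
of the start. -/
structure Drawn (σ : List Turn) (c : ℕ → ℤ) (a : ℤ) : Prop where
  even : σ.length % 2 = 0
  dir : Dir σ c
  simple : Simple σ.length c
  level : c (σ.length + 1) = c 1
  dist : c (σ.length + 2) = c 0 + a
  pos : 0 < a

theorem stretchAt_strictMono {i : ℕ} {g s l : ℤ} (hs : s = 1 ∨ s = -1) (p : ℕ) {y z : ℤ}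
    (h : y < z) : stretchAt i g s l p y < stretchAt i g s l p z := by
  unfold stretchAt gapAt pushOff
  rcases hs with rfl | rfl <;> split_ifs <;> omega

theorem sgn_mul_pos_iff (k z : ℤ) : 0 < sgn k * z ↔ (sgn k = 1 ∧ 0 < z) ∨ (sgn k = -1 ∧ z < 0) := by
  rcases sgn_cases k with ⟨-, e⟩ | ⟨-, e⟩ <;> rw [e] <;> omega

theorem net_take_append_le (A B : List Turn) {j : ℕ} (h : j ≤ A.length) :
    net ((A ++ B).take j) = net (A.take j) := by
  rw [List.take_append_of_le_length h]

theorem net_take_insert (A B : List Turn) {x y : Turn} (hxy : x ≠ y) {j : ℕ}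
    (h : A.length + 2 ≤ j) :
    net ((A ++ x :: y :: B).take j) = net ((A ++ B).take (j - 2)) := by
  obtain ⟨k, rfl⟩ := Nat.exists_eq_add_of_le h
  have e1 : (A ++ x :: y :: B).take (A.length + 2 + k) = A ++ x :: y :: B.take k := by
    rw [List.take_append, List.take_of_length_le (by omega),
      show A.length + 2 + k - A.length = k + 1 + 1 by omega]
    simp
  have e2 : (A ++ B).take (A.length + 2 + k - 2) = A ++ B.take k := by
    rw [List.take_append, List.take_of_length_le (by omega),
      show A.length + 2 + k - 2 - A.length = k by omega]
  have := turnVal_add_of_ne hxy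
  rw [e1, e2]; simp; omega

theorem dir_jog {A B : List Turn} {c : ℕ → ℤ} (hd : Dir (A ++ B) c) {x y : Turn} (hxy : x ≠ y)
    {g s α β : ℤ} (hs : s = 1 ∨ s = -1)
    (hαβ : (α = c (A.length + 1) ∧ β = c (A.length + 1) + s ∧ sgn (net A + turnVal x) = s) ∨
      (α = c (A.length + 1) + s ∧ β = c (A.length + 1) ∧ sgn (net A + turnVal x) = -s))
    (hg : (c A.length ≤ g ∧ g + 1 ≤ c (A.length + 2)) ∨
      (c (A.length + 2) ≤ g ∧ g + 1 ≤ c A.length)) :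
    Dir (A ++ x :: y :: B) (jog c A.length g s α β) := by
  intro j hj
  have c0 : jog c A.length g s α β A.length = gapAt g (c A.length) := jog_zero_parity le_rfl rfl
  have c1 : jog c A.length g s α β (A.length + 1) = α := by simp [jog]
  have c2 : jog c A.length g s α β (A.length + 2) = g + 1 := by simp [jog]
  have c3 : jog c A.length g s α β (A.length + 3) = β := by simp [jog]
  have c4 : jog c A.length g s α β (A.length + 4) = gapAt g (c (A.length + 2)) := by
    rw [jog_after (A.length + 2) le_rfl]; unfold stretchAt; rw [if_pos (by omega)]
  unfold gapAt at c0 c4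
  set i := A.length with hi
  simp only [List.length_append, List.length_cons] at hj
  rcases lt_trichotomy j i with h | h | h
  · have := hd j (by simp; omega)
    rw [net_take_append_le _ _ (by omega)] at this ⊢
    rw [sgn_mul_pos_iff] at this ⊢
    have cj : jog c i g s α β j = stretchAt i g s (c (i + 1)) j (c j) := by
      unfold jog; rw [if_pos (by omega)]
    by_cases h2 : j + 2 ≤ i
    · have cj2 : jog c i g s α β (j + 2) = stretchAt i g s (c (i + 1)) j (c (j + 2)) := by
        unfold jog; rw [if_pos (by omega), stretchAt_congr (p' := j) (by omega)]
      rw [cj, cj2]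
      refine this.imp (fun ⟨e, h⟩ => ⟨e, ?_⟩) (fun ⟨e, h⟩ => ⟨e, ?_⟩)
      · have := stretchAt_strictMono (i := i) (g := g) (l := c (i + 1)) hs j
          (show c j < c (j + 2) by omega)
        omega
      · have := stretchAt_strictMono (i := i) (g := g) (l := c (i + 1)) hs j
          (show c (j + 2) < c j by omega)
        omega
    · have e1 : j + 2 = i + 1 := by omega
      rw [cj, e1, c1]
      rw [e1] at this
      unfold stretchAt pushOff
      rw [if_neg (by omega)]
      rcases hs with rfl | rfl <;> split_ifs <;> omega
  · have := hd j (by simp; omega)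
    rw [net_take_append_le _ _ (by omega)] at this ⊢
    rw [sgn_mul_pos_iff] at this ⊢
    rw [h] at this ⊢
    rw [c0, c2]
    split_ifs <;> omega
  · by_cases h2 : j = i + 1
    · subst h2
      have e : (A ++ x :: y :: B).take (i + 1) = A ++ [x] := by
        rw [hi, List.take_append]; simp
      rw [e, net_append, c1, show i + 1 + 2 = i + 3 from rfl, c3]
      simp only [net_cons, net_nil, add_zero]
      rcases hs with rfl | rfl <;> rcases hαβ with ⟨rfl, rfl, e⟩ | ⟨rfl, rfl, e⟩ <;> rw [e] <;>
        simp
    · have := hd (j - 2) (by simp; omega)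
      rw [net_take_insert _ _ hxy (by omega)]
      rw [sgn_mul_pos_iff] at this ⊢
      obtain ⟨k, rfl⟩ := Nat.exists_eq_add_of_le (show i + 2 ≤ j by omega)
      rw [show i + 2 + k - 2 = i + k by omega] at this ⊢
      have cj2 : jog c i g s α β (i + 2 + k + 2) =
          stretchAt i g s (c (i + 1)) (i + k) (c (i + k + 2)) := by
        rw [jog_after _ (by omega), stretchAt_congr (p' := i + k) (by omega)]
        congr 2; omega
      rw [cj2]
      obtain rfl | rfl | hk : k = 0 ∨ k = 1 ∨ 2 ≤ k := by omega
      · simp only [add_zero] at this ⊢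
        rw [c2]
        unfold stretchAt gapAt
        rw [if_pos rfl]
        split_ifs <;> omega
      · rw [show i + 2 + 1 = i + 3 from rfl, c3]
        rw [show i + 1 + 2 = i + 3 from rfl] at this ⊢
        unfold stretchAt pushOff
        rw [if_neg (by omega)]
        rcases hs with rfl | rfl <;> split_ifs <;> omega
      · have cj : jog c i g s α β (i + 2 + k) = stretchAt i g s (c (i + 1)) (i + k) (c (i + k)) := by
          rw [show i + 2 + k = i + k + 2 by omega, jog_after _ (by omega)]
        rw [cj]
        refine this.imp (fun ⟨e, h⟩ => ⟨e, ?_⟩) (fun ⟨e, h⟩ => ⟨e, ?_⟩)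
        · have := stretchAt_strictMono (i := i) (g := g) (l := c (i + 1)) hs (i + k)
            (show c (i + k) < c (i + k + 2) by omega)
          omega
        · have := stretchAt_strictMono (i := i) (g := g) (l := c (i + 1)) hs (i + k)
            (show c (i + k + 2) < c (i + k) by omega)
          omega

theorem sgn_eq (k : ℤ) : sgn k = 1 ∨ sgn k = -1 := by
  rcases sgn_cases k with ⟨-, e⟩ | ⟨-, e⟩ <;> simp [e]

/-- A pair of opposite turns can be inserted into any segment, behind any coordinate `g` inside
the segment. -/
theorem Drawn.exists_jog {A B : List Turn} {c : ℕ → ℤ} {a : ℤ} (h : Drawn (A ++ B) c a)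
    (hne : A ++ B ≠ []) {x y : Turn} (hxy : x ≠ y) {g : ℤ}
    (hg : (c A.length ≤ g ∧ g + 1 ≤ c (A.length + 2)) ∨
      (c (A.length + 2) ≤ g ∧ g + 1 ≤ c A.length)) :
    ∃ s α β, (s = 1 ∨ s = -1) ∧
      ((α = c (A.length + 1) ∧ β = c (A.length + 1) + s) ∨
        (α = c (A.length + 1) + s ∧ β = c (A.length + 1))) ∧
      Drawn (A ++ x :: y :: B) (jog c A.length g s α β)
        (stretchAt A.length g s (c (A.length + 1)) 0 (c 0 + a) -
          stretchAt A.length g s (c (A.length + 1)) 0 (c 0)) := by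
  have hlen : 1 ≤ A.length + B.length := by
    rcases A with _ | _ <;> rcases B with _ | _ <;> (simp_all; try omega)
  have ev := h.even
  have hlv := h.level
  have hds := h.dist
  simp only [List.length_append] at ev hlv hds
  have hlen2 : (A ++ x :: y :: B).length = A.length + B.length + 2 := by simp; omega
  have main : ∀ s α β, (s = 1 ∨ s = -1) →
      ((α = c (A.length + 1) ∧ β = c (A.length + 1) + s ∧ sgn (net A + turnVal x) = s ∧
          1 ≤ B.length) ∨
        (α = c (A.length + 1) + s ∧ β = c (A.length + 1) ∧ sgn (net A + turnVal x) = -s ∧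
          B.length = 0)) →
      Drawn (A ++ x :: y :: B) (jog c A.length g s α β)
        (stretchAt A.length g s (c (A.length + 1)) 0 (c 0 + a) -
          stretchAt A.length g s (c (A.length + 1)) 0 (c 0)) := by
    intro s α β hs hαβ
    have j0 : jog c A.length g s α β 0 = stretchAt A.length g s (c (A.length + 1)) 0 (c 0) := by
      simp [jog]
    refine ⟨by rw [hlen2]; omega, dir_jog h.dir hxy hs (by tauto) hg, ?_, ?_, ?_, ?_⟩
    · rw [hlen2]
      have := simple_jog h.simple (i := A.length) (by simp) hs (α := α) (β := β) (by tauto) hg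
      simpa using this
    · rw [hlen2]
      rcases hαβ with ⟨rfl, rfl, -, hB⟩ | ⟨rfl, rfl, -, hB⟩
      · rw [show A.length + B.length + 2 + 1 = A.length + B.length + 1 + 2 by omega,
          jog_after _ (by omega), hlv]
        by_cases hA : A.length = 0
        · simp only [hA]
          simp [jog, stretchAt, pushOff]
          omega
        · unfold jog
          rw [if_pos (by omega)]
          exact stretchAt_congr (by omega) _
      · rw [hB] at hlv ev ⊢
        simp only [add_zero] at hlv ev ⊢
        have e1 : jog c A.length g s (c (A.length + 1) + s) (c (A.length + 1)) (A.length + 2 + 1) =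
          c (A.length + 1) := by simp [jog]
        have e2 : jog c A.length g s (c (A.length + 1) + s) (c (A.length + 1)) 1 =
            c (A.length + 1) := by
          unfold jog stretchAt pushOff
          rw [if_pos (by omega), if_neg (by omega), ← hlv, if_neg (by simp)]
        rw [e1, e2]
    · rw [hlen2, jog_after _ (by omega), hds, j0, stretchAt_congr (p' := 0) (by omega)]
      ring
    · have := stretchAt_strictMono (i := A.length) (g := g) (l := c (A.length + 1)) hs 0
        (show c 0 < c 0 + a by have := h.pos; omega)
      omega
  -- Both ends must stay level. A jog in the last segment has to leave its second half on the old
  -- line, since that half carries the endpoint; any other jog leaves its first half there, which is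
  -- what a jog in the first segment requires.
  by_cases hB : B.length = 0
  · have hs : -sgn (net A + turnVal x) = 1 ∨ -sgn (net A + turnVal x) = -1 := by
      have := sgn_eq (net A + turnVal x); omega
    exact ⟨_, _, _, hs, .inr ⟨rfl, rfl⟩, main _ _ _ hs (.inr ⟨rfl, rfl, by ring, hB⟩)⟩
  · have hs := sgn_eq (net A + turnVal x)
    exact ⟨_, _, _, hs, .inl ⟨rfl, rfl⟩, main _ _ _ hs (.inl ⟨rfl, rfl, rfl, by omega⟩)⟩

/-! ### Reachable distances and insertions into free segments -/

/-- Some simple chain with turn sequence `σ` ends at distance at most `b` on the `+x`-axis. -/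
def ReachLe (σ : List Turn) (b : ℤ) : Prop := ∃ c a, Drawn σ c a ∧ a ≤ b

theorem ReachLe.mono {σ : List Turn} {b b' : ℤ} (h : ReachLe σ b) (hb : b ≤ b') : ReachLe σ b' := by
  obtain ⟨c, a, h1, h2⟩ := h
  exact ⟨c, a, h1, h2.trans hb⟩

theorem Drawn.ne {σ : List Turn} {c : ℕ → ℤ} {a : ℤ} (h : Drawn σ c a) {j : ℕ}
    (hj : j ≤ σ.length) : c j ≠ c (j + 2) := by
  have := h.dir j hj
  intro e
  rw [e] at this
  simp at this

/-- Inserting a pair of opposite turns anywhere costs at most one column. -/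
theorem ReachLe.insert {A B : List Turn} {b : ℤ} (h : ReachLe (A ++ B) b) (hne : A ++ B ≠ [])
    {x y : Turn} (hxy : x ≠ y) : ReachLe (A ++ x :: y :: B) (b + 1) := by
  obtain ⟨c, a, hc, hab⟩ := h
  have hn := hc.ne (j := A.length) (by simp)
  obtain ⟨s, α, β, hs, -, hd⟩ := hc.exists_jog hne hxy (g := min (c A.length) (c (A.length + 2)))
    (by omega)
  refine ⟨_, _, hd, ?_⟩
  unfold stretchAt gapAt pushOff
  have := hc.pos
  rcases hs with rfl | rfl <;> split_ifs <;> omega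

/-- Segment `j` leaves the vertical strip over the interval from the start to the endpoint. -/
def Free (n : ℕ) (c : ℕ → ℤ) (j : ℕ) : Prop :=
  if j % 2 = 0 then c j < c 0 ∨ c (j + 2) < c 0 ∨ c (n + 2) < c j ∨ c (n + 2) < c (j + 2)
  else c (j + 1) < c 0 ∨ c (n + 2) < c (j + 1)

/-- The turn sequence with marked turns is drawn so that the segments after the marked turns are
free. -/
def Real (W : List (Turn × Bool)) (a : ℤ) : Prop :=
  ∃ c, Drawn (W.map Prod.fst) c a ∧ ∀ j t, W[j]? = some (t, true) → Free W.length c (j + 1)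

section JogFree

variable {n i : ℕ} {c : ℕ → ℤ} {a g s α β : ℤ}

theorem jog_start : jog c i g s α β 0 = stretchAt i g s (c (i + 1)) 0 (c 0) := by simp [jog]

theorem jog_end (hin : i ≤ n) (hev : n % 2 = 0) (hds : c (n + 2) = c 0 + a) :
    jog c i g s α β (n + 2 + 2) = stretchAt i g s (c (i + 1)) 0 (c 0 + a) := by
  rw [jog_after _ (by omega), hds, stretchAt_congr (p' := 0) (by omega)]

theorem jog_low (hin : i ≤ n) (hev : n % 2 = 0) (hds : c (n + 2) = c 0 + a)
    (hs : s = 1 ∨ s = -1) {j : ℕ} (hj : j % 2 = 0) (hji : j ≤ i) :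
    (c j < c 0 → jog c i g s α β j < jog c i g s α β 0) ∧
      (c (n + 2) < c j → jog c i g s α β (n + 2 + 2) < jog c i g s α β j) := by
  have : jog c i g s α β j = stretchAt i g s (c (i + 1)) 0 (c j) := by
    rw [jog, if_pos hji, stretchAt_congr (p' := 0) (by omega)]
  rw [this, jog_start, jog_end hin hev hds, hds]
  exact ⟨fun h => stretchAt_strictMono hs _ h, fun h => stretchAt_strictMono hs _ h⟩

theorem jog_high (hin : i ≤ n) (hev : n % 2 = 0) (hds : c (n + 2) = c 0 + a)
    (hs : s = 1 ∨ s = -1) {j : ℕ} (hj : j % 2 = 0) (hji : i + 2 ≤ j) :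
    (c j < c 0 → jog c i g s α β (j + 2) < jog c i g s α β 0) ∧
      (c (n + 2) < c j → jog c i g s α β (n + 2 + 2) < jog c i g s α β (j + 2)) := by
  have : jog c i g s α β (j + 2) = stretchAt i g s (c (i + 1)) 0 (c j) := by
    rw [jog_after _ hji, stretchAt_congr (p' := 0) (by omega)]
  rw [this, jog_start, jog_end hin hev hds, hds]
  exact ⟨fun h => stretchAt_strictMono hs _ h, fun h => stretchAt_strictMono hs _ h⟩

theorem jog_mid (hin : i ≤ n) (hev : n % 2 = 0) (hds : c (n + 2) = c 0 + a)
    (ha : 0 < a) (hs : s = 1 ∨ s = -1)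
    (hαβ : (α = c (i + 1) ∧ β = c (i + 1) + s) ∨ (α = c (i + 1) + s ∧ β = c (i + 1)))
    (hi : i % 2 = 1) :
    (c (i + 1) < c 0 → jog c i g s α β (i + 1) < jog c i g s α β 0 ∧
      jog c i g s α β (i + 3) < jog c i g s α β 0) ∧
    (c (n + 2) < c (i + 1) → jog c i g s α β (n + 2 + 2) < jog c i g s α β (i + 1) ∧
        jog c i g s α β (n + 2 + 2) < jog c i g s α β (i + 3)) := by
  have h1 : jog c i g s α β (i + 1) = α := by simp [jog]
  have h3 : jog c i g s α β (i + 3) = β := by simp [jog]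
  have p : ∀ z, stretchAt i g s (c (i + 1)) 0 z = pushOff s (c (i + 1)) z := by
    intro z; unfold stretchAt; rw [if_neg (by omega)]
  rw [h1, h3, jog_start, jog_end hin hev hds, hds, p, p]
  unfold pushOff
  clear hds h1 h3 p
  generalize c 0 = z at *
  generalize c (i + 1) = l at *
  rcases hs with rfl | rfl <;> rcases hαβ with ⟨rfl, rfl⟩ | ⟨rfl, rfl⟩ <;>
    split_ifs <;> omega

theorem Free.jog_lt (hin : i ≤ n) (hev : n % 2 = 0) (hds : c (n + 2) = c 0 + a)
    (ha : 0 < a) (hs : s = 1 ∨ s = -1)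
    (hαβ : (α = c (i + 1) ∧ β = c (i + 1) + s) ∨ (α = c (i + 1) + s ∧ β = c (i + 1)))
    {j : ℕ} (hj : j < i) (hf : Free n c j) : Free (n + 2) (jog c i g s α β) j := by
  unfold Free at hf ⊢
  by_cases hpar : j % 2 = 0
  · rw [if_pos hpar] at hf ⊢
    have l1 := jog_low (g := g) (α := α) (β := β) hin hev hds hs hpar (by omega)
    by_cases h3 : j + 2 ≤ i
    · have l2 := jog_low (g := g) (α := α) (β := β) hin hev hds hs (j := j + 2) (by omega) h3
      exact hf.imp l1.1 (Or.imp l2.1 (Or.imp l1.2 l2.2))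
    · have l2 := jog_mid (g := g) hin hev hds ha hs hαβ (by omega)
      have e : j + 2 = i + 1 := by omega
      rw [e] at hf ⊢
      exact hf.imp l1.1 (Or.imp (fun h => (l2.1 h).1) (Or.imp l1.2 (fun h => (l2.2 h).1)))
  · rw [if_neg hpar] at hf ⊢
    have l1 := jog_low (g := g) (α := α) (β := β) hin hev hds hs (j := j + 1) (by omega) (by omega)
    exact hf.imp l1.1 l1.2

theorem Free.jog_gt (hin : i ≤ n) (hev : n % 2 = 0) (hds : c (n + 2) = c 0 + a)
    (ha : 0 < a) (hs : s = 1 ∨ s = -1)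
    (hαβ : (α = c (i + 1) ∧ β = c (i + 1) + s) ∨ (α = c (i + 1) + s ∧ β = c (i + 1)))
    {j : ℕ} (hj : i < j) (hf : Free n c j) : Free (n + 2) (jog c i g s α β) (j + 2) := by
  unfold Free at hf ⊢
  by_cases hpar : j % 2 = 0
  · rw [if_pos hpar] at hf
    rw [if_pos (by omega)]
    have l2 := jog_high (g := g) (α := α) (β := β) hin hev hds hs (j := j + 2) (by omega) (by omega)
    by_cases h3 : j = i + 1
    · subst h3
      have l1 := jog_mid (g := g) hin hev hds ha hs hαβ (by omega)
      exact hf.imp (fun h => (l1.1 h).2) (Or.imp l2.1 (Or.imp (fun h => (l1.2 h).2) l2.2))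
    · have l1 := jog_high (g := g) (α := α) (β := β) hin hev hds hs (j := j) (by omega) (by omega)
      exact hf.imp l1.1 (Or.imp l2.1 (Or.imp l1.2 l2.2))
  · rw [if_neg hpar] at hf
    rw [if_neg (by omega)]
    have l1 := jog_high (g := g) (α := α) (β := β) hin hev hds hs (j := j + 1) (by omega) (by omega)
    exact hf.imp l1.1 l1.2

/-- For a horizontal segment the new column lies outside the strip, and for a vertical one the whole
line does. Both ends of the chain are then shifted alike, and the three pieces stay outside. -/
theorem Free.jog_eq (hin : i ≤ n) (hev : n % 2 = 0) (hds : c (n + 2) = c 0 + a) (ha : 0 < a)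
    (hs : s = 1 ∨ s = -1)
    (hαβ : (α = c (i + 1) ∧ β = c (i + 1) + s) ∨ (α = c (i + 1) + s ∧ β = c (i + 1)))
    (hg : (c i ≤ g ∧ g + 1 ≤ c (i + 2)) ∨ (c (i + 2) ≤ g ∧ g + 1 ≤ c i))
    (hgf : i % 2 = 0 → g < c 0 ∨ c 0 + a ≤ g) (hf : Free n c i) :
    (stretchAt i g s (c (i + 1)) 0 (c 0 + a) - stretchAt i g s (c (i + 1)) 0 (c 0) = a) ∧
    ∀ j, i ≤ j → j ≤ i + 2 → Free (n + 2) (jog c i g s α β) j := by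
  unfold Free at hf ⊢
  have h2 : jog c i g s α β (i + 2) = g + 1 := by simp [jog]
  have d0 : jog c i g s α β 0 = _ := jog_start
  have dn : jog c i g s α β (n + 2 + 2) = _ := jog_end hin hev hds
  rw [hds] at hf
  by_cases hpar : i % 2 = 0
  · rw [if_pos hpar] at hf
    have hgf := hgf hpar
    have p : ∀ z, stretchAt i g s (c (i + 1)) 0 z = gapAt g z := by
      intro z; unfold stretchAt; rw [if_pos (by omega)]
    rw [p] at d0 dn
    rw [p, p]
    unfold gapAt at d0 dn ⊢
    refine ⟨by split_ifs <;> omega, ?_⟩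
    have gl : g + 1 < jog c i g s α β 0 ∨ jog c i g s α β (n + 2 + 2) < g + 1 := by
      rw [d0, dn]; split_ifs <;> omega
    intro j hj1 hj2
    obtain rfl | rfl | rfl : j = i ∨ j = i + 1 ∨ j = i + 2 := by omega
    · rw [if_pos hpar, h2]
      exact gl.elim (fun h => .inr (.inl h)) (fun h => .inr (.inr (.inr h)))
    · rw [if_neg (by omega), show i + 1 + 1 = i + 2 by omega, h2]
      exact gl
    · rw [if_pos (by omega), h2]
      exact gl.elim .inl (fun h => .inr (.inr (.inl h)))
  · rw [if_neg hpar, ← hds] at hf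
    have l := jog_mid (g := g) hin hev hds ha hs hαβ (by omega)
    refine ⟨?_, ?_⟩
    · have p : ∀ z, stretchAt i g s (c (i + 1)) 0 z = pushOff s (c (i + 1)) z := by
        intro z; unfold stretchAt; rw [if_neg (by omega)]
      rw [p, p]
      rw [hds] at hf
      unfold pushOff
      generalize c 0 = z at *
      generalize c (i + 1) = l at *
      rcases hs with rfl | rfl <;> split_ifs <;> omega
    intro j hj1 hj2
    obtain rfl | rfl | rfl : j = i ∨ j = i + 1 ∨ j = i + 2 := by omega
    · rw [if_neg hpar]
      exact hf.imp (fun h => (l.1 h).1) (fun h => (l.2 h).1)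
    · rw [if_pos (by omega), show i + 1 + 2 = i + 3 by omega]
      exact hf.elim (fun h => .inl (l.1 h).1) (fun h => .inr (.inr (.inl (l.2 h).1)))
    · rw [if_neg (by omega), show i + 2 + 1 = i + 3 by omega]
      exact hf.imp (fun h => (l.1 h).2) (fun h => (l.2 h).2)

end JogFree

theorem Real.insert {A B : List (Turn × Bool)} {t x y : Turn} (hxy : x ≠ y) {a : ℤ}
    (h : Real (A ++ (t, true) :: B) a) :
    Real (A ++ (t, true) :: (x, true) :: (y, true) :: B) a := by
  obtain ⟨c, hc, hf⟩ := h
  have e1 : (A ++ (t, true) :: B).map Prod.fst =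
      (A.map Prod.fst ++ [t]) ++ B.map Prod.fst := by simp
  rw [e1] at hc
  obtain ⟨i, hi⟩ : ∃ i, i = (A.map Prod.fst ++ [t]).length := ⟨_, rfl⟩
  have hlA : i = A.length + 1 := by simp [hi]
  have hlen : (A ++ (t, true) :: B).length = i + B.length := by simp; omega
  have hlenB : ((A.map Prod.fst ++ [t]) ++ B.map Prod.fst).length = i + B.length := by
    simp; omega
  rw [hlen] at hf
  have hn := hc.ne (j := i) (by omega)
  have hfi : Free (i + B.length) c i := by
    have := hf A.length t (by simp)
    rwa [← hlA] at this
  have hp := hc.pos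
  have hds := hc.dist
  have hev := hc.even
  rw [hlenB] at hds hev
  -- A free horizontal segment sticks out of the strip on the left or on the right; the unit
  -- interval at its extreme point on that side is taken.
  obtain ⟨g, hg, hgf⟩ : ∃ g, ((c i ≤ g ∧ g + 1 ≤ c (i + 2)) ∨ (c (i + 2) ≤ g ∧ g + 1 ≤ c i)) ∧
      (i % 2 = 0 → g < c 0 ∨ c 0 + a ≤ g) := by
    unfold Free at hfi
    rw [hds] at hfi
    by_cases hpar : i % 2 = 0
    · rw [if_pos hpar] at hfi
      by_cases hlow : min (c i) (c (i + 2)) < c 0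
      · exact ⟨min (c i) (c (i + 2)), by omega, by omega⟩
      · exact ⟨max (c i) (c (i + 2)) - 1, by omega, by omega⟩
    · exact ⟨min (c i) (c (i + 2)), by omega, by omega⟩
  rw [hi] at hg
  obtain ⟨s, α, β, hs, hαβ, hd⟩ := hc.exists_jog (by simp) hxy hg
  rw [← hi] at hg hαβ hd
  obtain ⟨hsame, hmid⟩ := Free.jog_eq (by omega) hev hds hp hs hαβ hg hgf hfi
  rw [hsame] at hd
  refine ⟨_, by simpa using hd, ?_⟩
  have hlen2 : (A ++ (t, true) :: (x, true) :: (y, true) :: B).length = i + B.length + 2 := by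
    simp; omega
  rw [hlen2]
  intro j u hu
  rcases lt_or_ge j A.length with hj | hj
  · refine Free.jog_lt (by omega) hev hds hp hs hαβ (by omega) (hf j u ?_)
    rw [List.getElem?_append_left hj] at hu ⊢; exact hu
  · rcases lt_or_ge j (A.length + 3) with hj3 | hj3
    · exact hmid _ (by omega) (by omega)
    · obtain ⟨k, rfl⟩ := Nat.exists_eq_add_of_le hj3
      have hfj := hf (A.length + 1 + k) u (by
        rw [List.getElem?_append_right (by omega)] at hu ⊢
        rw [show A.length + 3 + k - A.length = k + 1 + 1 + 1 by omega] at hu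
        rw [show A.length + 1 + k - A.length = k + 1 by omega]
        simpa using hu)
      rw [show A.length + 3 + k + 1 = A.length + 1 + k + 1 + 2 by omega]
      exact Free.jog_gt (by omega) hev hds hp hs hαβ (by omega) hfj

theorem Real.weaken {W W' : List (Turn × Bool)} {a : ℤ} (h : Real W a)
    (h1 : W'.map Prod.fst = W.map Prod.fst)
    (h2 : ∀ (j : ℕ) (t : Turn), W'[j]? = some (t, true) → ∃ t' : Turn, W[j]? = some (t', true)) :
    Real W' a := by
  obtain ⟨c, hc, hf⟩ := h
  have hl : W'.length = W.length := by simpa using congrArg List.length h1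
  refine ⟨c, h1 ▸ hc, fun j t ht => ?_⟩
  obtain ⟨t', ht'⟩ := h2 j t ht
  rw [hl]
  exact hf j t' ht'

/-- Each pair goes behind a marked turn, either `t` or a letter inserted before, and is marked
itself, so the whole balanced word is free of charge. -/
theorem Real.insert_balanced {b : List Turn} (hb : Balanced b) {A B : List (Turn × Bool)} {t : Turn}
    {a : ℤ} (h : Real (A ++ (t, true) :: B) a) :
    Real (A ++ (t, true) :: (b.map (·, true) ++ B)) a := by
  induction hb with
  | nil => simpa using h
  | insert u v x y hxy _ ih =>
    rcases List.eq_nil_or_concat u with rfl | ⟨u', z, rfl⟩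
    · simpa using Real.insert hxy ih
    · have ih' : Real ((A ++ (t, true) :: u'.map (·, true)) ++ (z, true) ::
          (v.map (·, true) ++ B)) a := by simpa using ih
      simpa using Real.insert hxy ih'

theorem ReachLe.of_real {W : List (Turn × Bool)} {a : ℤ} (h : Real W a) :
    ReachLe (W.map Prod.fst) a := by
  obtain ⟨c, hc, -⟩ := h
  exact ⟨c, a, hc, le_rfl⟩

/-! ### Expansion of marked turn sequences -/

/-- `Exp W w` says that `w` arises from the turn sequence `W` by inserting balanced words after
the marked turns. -/
inductive Exp : List (Turn × Bool) → List Turn → Prop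
  | nil : Exp [] []
  | rigid (t : Turn) (W : List (Turn × Bool)) (w : List Turn) : Exp W w →
      Exp ((t, false) :: W) (t :: w)
  | free (t : Turn) (b : List Turn) (W : List (Turn × Bool)) (w : List Turn) : Balanced b →
      Exp W w → Exp ((t, true) :: W) (t :: (b ++ w))

/-- The list `A` holds what has already been expanded; its length shifts the positions of the marks,
hence the generalization. -/
theorem Real.expand {W : List (Turn × Bool)} {w : List Turn} (he : Exp W w)
    {A : List (Turn × Bool)} {a : ℤ} (h : Real (A ++ W) a) : Real (A ++ w.map (·, false)) a := by
  induction he generalizing A with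
  | nil => simpa using h
  | rigid t W w _ ih =>
    have := ih (A := A ++ [(t, false)]) (by simpa using h)
    simpa using this
  | free t b W w hb _ ih =>
    have h1 := Real.insert_balanced hb h
    -- The part already treated receives no further insertions, so its marks are dropped to match
    -- the form of the claim.
    have h2 : Real ((A ++ (t, false) :: b.map (·, false)) ++ W) a := by
      refine h1.weaken (by simp [Function.comp_def]) ?_
      intro j u hu
      rcases lt_or_ge j A.length with hj | hj
      · rw [List.append_assoc, List.getElem?_append_left hj] at hu
        exact ⟨u, by rw [List.getElem?_append_left hj]; exact hu⟩
      · rw [List.append_assoc, List.getElem?_append_right hj] at hu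
        rw [List.getElem?_append_right hj]
        obtain ⟨k, hk⟩ : ∃ k, k = j - A.length := ⟨_, rfl⟩
        rw [← hk] at hu ⊢
        rcases lt_or_ge k (b.length + 1) with hkb | hkb
        · rw [List.getElem?_append_left (by simpa using hkb)] at hu
          cases k with
          | zero => simp at hu
          | succ k => simp at hu
        · rw [List.getElem?_append_right (by simpa using hkb)] at hu
          rw [← List.cons_append, List.getElem?_append_right (by simpa using hkb)]
          exact ⟨u, by simpa using hu⟩
    have := ih h2
    simpa using this

theorem Real.reachLe {W : List (Turn × Bool)} {w : List Turn} {a : ℤ} (h : Real W a)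
    (he : Exp W w) : ReachLe w a := by
  have := ReachLe.of_real (Real.expand (A := []) he h)
  simpa [Function.comp_def] using this

/-- After a marked turn, the turn sequence `P` expands to every word of excess `m`. -/
def Cov (P : List (Turn × Bool)) (m : ℤ) : Prop :=
  ∀ w, net w = m → ∀ t W w', Exp W w' → Exp ((t, true) :: (P ++ W)) (t :: (w ++ w'))

theorem cov_nil : Cov [] 0 := fun w hw t W w' h => Exp.free t w W w' (balanced_of_net w hw) h

/-- As the excess of `w` is positive, `w` splits where it first leaves level 0 upwards; the part
before that is balanced and is absorbed by the turn `t`. -/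
theorem Cov.L {P : List (Turn × Bool)} {m : ℤ} (h : Cov P m) (hm : 0 ≤ m) :
    Cov ((Turn.L, true) :: P) (m + 1) := by
  intro w hw t W w' hW
  obtain ⟨u, v, rfl, h1, -⟩ := exists_split_up w 0 le_rfl (by omega)
  have := Exp.free t u _ _ (balanced_of_net u h1) (h v (by simp at hw; omega) Turn.L W w' hW)
  simpa using this

theorem Cov.R {P : List (Turn × Bool)} {m : ℤ} (h : Cov P m) (hm : m ≤ 0) :
    Cov ((Turn.R, true) :: P) (m - 1) := by
  intro w hw t W w' hW
  obtain ⟨u, v, rfl, h1⟩ := exists_split_down w 0 le_rfl (by omega)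
  have := Exp.free t u _ _ (balanced_of_net u h1) (h v (by simp at hw; omega) Turn.R W w' hW)
  simpa using this

/-- Nothing may be inserted behind the unmarked `L`, so two adjacent left turns are needed;
`exists_split_LL` supplies them. -/
theorem Cov.LL {P : List (Turn × Bool)} {m : ℤ} (h : Cov P m) (hm : 0 ≤ m) :
    Cov ((Turn.L, false) :: (Turn.L, true) :: P) (m + 2) := by
  intro w hw t W w' hW
  obtain ⟨u, v, rfl, h1⟩ := exists_split_LL w (by omega)
  have := Exp.free t u _ _ (balanced_of_net u h1)
    (Exp.rigid Turn.L ((Turn.L, true) :: (P ++ W)) (Turn.L :: (v ++ w'))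
      (h v (by simp at hw; omega) Turn.L W w' hW))
  simpa using this

theorem cov_replicate_L (k : ℕ) : Cov (List.replicate k (Turn.L, true)) k := by
  induction k with
  | zero => exact cov_nil
  | succ k ih => simpa [List.replicate_succ] using ih.L (by omega)

theorem cov_replicate_R (k : ℕ) : Cov (List.replicate k (Turn.R, true)) (-k) := by
  induction k with
  | zero => exact cov_nil
  | succ k ih =>
    have := ih.R (by omega)
    rw [show -(k : ℤ) - 1 = -((k + 1 : ℕ) : ℤ) by push_cast; ring] at this
    simpa [List.replicate_succ] using this

/-! ### Replacing the end of a chain that arrives from the right -/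

/-- Make room for a new end of a chain whose last segment comes from the right. -/
def makeRoom (a y : ℤ) (p : ℕ) (z : ℤ) : ℤ :=
  if p % 2 = 0 then (if z ≤ a then z else z + 2)
  else (if y < z then z + 1 else if z < y then z - 1 else z)

/-- The chain whose last segment is replaced by the chain with coordinates `T`. -/
def newEnd (n : ℕ) (c T : ℕ → ℤ) (j : ℕ) : ℤ :=
  if j ≤ n then makeRoom (c (n + 2)) (c (n + 1)) j (c j) else T (j - (n + 1))

/-- The inverse of `makeRoom`. -/
def dropRoom (a y : ℤ) (p : ℕ) (z : ℤ) : ℤ :=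
  if p % 2 = 0 then (if z ≤ a then z else if z ≤ a + 3 then a + 1 else z - 2)
  else (if y < z then z - 1 else if z < y then z + 1 else z)

theorem dropRoom_mono {a y : ℤ} (p : ℕ) {z z' : ℤ} (h : z ≤ z') :
    dropRoom a y p z ≤ dropRoom a y p z' := by
  unfold dropRoom; split_ifs <;> omega

theorem Btw.dropRoom {a y : ℤ} (p : ℕ) {z u v : ℤ}
    (h : Btw z u v) : Btw (dropRoom a y p z) (dropRoom a y p u) (dropRoom a y p v) := by
  rcases h with ⟨h1, h2⟩ | ⟨h1, h2⟩
  · exact .inl ⟨dropRoom_mono p h1, dropRoom_mono p h2⟩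
  · exact .inr ⟨dropRoom_mono p h1, dropRoom_mono p h2⟩

theorem dropRoom_makeRoom {a y : ℤ} (p : ℕ) (z : ℤ) :
    dropRoom a y p (makeRoom a y p z) = z := by
  unfold dropRoom makeRoom; split_ifs <;> omega

theorem dropRoom_congr {a y : ℤ} {p p' : ℕ} (h : p % 2 = p' % 2) (z : ℤ) :
    dropRoom a y p z = dropRoom a y p' z := by
  unfold dropRoom; rw [h]

theorem makeRoom_strictMono {a y : ℤ} (p : ℕ) {z z' : ℤ} (h : z < z') :
    makeRoom a y p z < makeRoom a y p z' := by
  unfold makeRoom; split_ifs <;> omega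

section NewEnd

variable {n r : ℕ} {c T : ℕ → ℤ}

theorem newEnd_le {j : ℕ} (h : j ≤ n) :
    newEnd n c T j = makeRoom (c (n + 2)) (c (n + 1)) j (c j) := if_pos h

theorem newEnd_gt (t : ℕ) : newEnd n c T (n + 1 + t) = T t := by
  unfold newEnd; rw [if_neg (by omega)]; congr 1; omega

/-- `makeRoom` empties the two columns right of the endpoint and the rows just above and below it.
The new end stays in this room, apart from its first segment, which comes from the right. `dropRoom`
collapses all of it into the old last segment, so a meeting with an older segment would already have
been one in the old chain. -/
theorem simple_newEnd (hc : Simple n c) (hn : n % 2 = 0) (hw : c (n + 2) < c n)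
    (hTx : ∀ t ≤ r + 1, t % 2 = 1 → c (n + 2) ≤ T t ∧ T t ≤ c (n + 2) + 2)
    (hTy : ∀ t ≤ r + 1, t % 2 = 0 → c (n + 1) - 1 ≤ T t ∧ T t ≤ c (n + 1) + 1)
    (hT : ∀ X, c (n + 2) + 3 ≤ X → Simple r (fun j => if j = 0 then X else T (j - 1))) :
    Simple (n + r) (newEnd n c T) := by
  have hX : newEnd n c T n = c n + 2 := by
    rw [newEnd_le le_rfl]; unfold makeRoom; rw [if_pos hn, if_neg (by omega)]
  have old : ∀ j q, j < n → On (newEnd n c T) j q →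
      On c j (fun p => dropRoom (c (n + 2)) (c (n + 1)) p (q p)) := by
    intro j q hj ⟨h1, h2⟩
    have h2' := h2.dropRoom (a := c (n + 2)) (y := c (n + 1)) (j % 2)
    refine ⟨?_, ?_⟩
    · simp only [h1]
      rw [newEnd_le (by omega), dropRoom_congr (p' := j + 1) (by omega), dropRoom_makeRoom]
    · rw [newEnd_le (by omega), dropRoom_congr (p' := j) (p := j % 2) (by omega)
        (makeRoom _ _ _ _), dropRoom_makeRoom] at h2'
      have e : dropRoom (c (n + 2)) (c (n + 1)) (j % 2) (newEnd n c T (j + 2)) = c (j + 2) := by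
        by_cases hj2 : j + 2 ≤ n
        · rw [newEnd_le hj2, dropRoom_congr (p' := j + 2) (by omega), dropRoom_makeRoom]
        · rw [show j + 2 = n + 1 + 0 by omega, newEnd_gt]
          have := hTy 0 (by omega) rfl
          unfold dropRoom
          rw [if_neg (by omega)]
          simp only [add_zero]
          split_ifs <;> omega
      rw [e] at h2'
      exact h2'
  have new : ∀ t q, t ≤ r → On (newEnd n c T) (n + t) q →
      On (fun j => if j = 0 then c n + 2 else T (j - 1)) t q := by
    intro t q _ ⟨h1, h2⟩
    refine ⟨?_, ?_⟩
    · rw [show (t + 1) % 2 = (n + t + 1) % 2 by omega, h1,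
        show n + t + 1 = n + 1 + t by omega, newEnd_gt]
      simp
    · rw [show n + t + 2 = n + 1 + (t + 1) by omega, newEnd_gt,
        show (n + t) % 2 = t % 2 by omega] at h2
      have e : newEnd n c T (n + t) = (if t = 0 then c n + 2 else T (t - 1)) := by
        rcases t with _ | t
        · simpa using hX
        · rw [show n + (t + 1) = n + 1 + t by omega, newEnd_gt]; simp
      rw [e] at h2
      simpa using h2
  have box : ∀ t q, t ≤ r → On (newEnd n c T) (n + t) q →
      (c (n + 1) - 1 ≤ q 1 ∧ q 1 ≤ c (n + 1) + 1) ∧ c (n + 2) ≤ q 0 ∧ q 0 ≤ c n + 2 ∧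
      (1 ≤ t → q 0 ≤ c (n + 2) + 2) := by
    intro t q ht hq
    obtain ⟨h1, h2⟩ := new t q ht hq
    simp only [Nat.add_eq_zero_iff, and_false, if_false, one_ne_zero,
      OfNat.ofNat_ne_zero, Nat.add_sub_cancel, show t + 2 - 1 = t + 1 by omega] at h1 h2
    unfold Btw at h2
    rcases Nat.mod_two_eq_zero_or_one t with hp | hp
    · rw [show (t + 1) % 2 = 1 by omega] at h1
      rw [hp] at h2
      have a1 := hTy t (by omega) hp
      have a2 := hTx (t + 1) (by omega) (by omega)
      by_cases h0 : t = 0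
      · subst h0
        simp only [if_true] at h2
        omega
      · have a3 := hTx (t - 1) (by omega) (by omega)
        rw [if_neg h0] at h2
        omega
    · rw [show (t + 1) % 2 = 0 by omega] at h1
      rw [hp, if_neg (by omega)] at h2
      have a1 := hTx t (by omega) hp
      have a2 := hTy (t + 1) (by omega) (by omega)
      have a3 := hTy (t - 1) (by omega) (by omega)
      omega
  intro j k hjk hk q hj hk'
  rcases lt_or_ge k n with hkn | hkn
  · exact hc j k hjk hkn.le _ (old j q (by omega) hj) (old k q hkn hk')
  obtain ⟨t, rfl⟩ := Nat.exists_eq_add_of_le hkn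
  have bk := box t q (by omega) hk'
  rcases lt_or_ge j n with hjn | hjn
  -- The old last segment does touch segment `n - 1`, so collapsing proves nothing there. But
  -- segment `n - 1` lies on the column `c n + 2`, to the right of the box that contains the later
  -- segments.
  · by_cases h1 : j + 1 = n
    · have := hj.1
      rw [h1, hX, hn] at this
      have := bk.2.2.2 (by omega)
      omega
    · refine hc j n (by omega) le_rfl _ (old j q hjn hj) ⟨?_, ?_⟩
      · show dropRoom _ _ ((n + 1) % 2) (q ((n + 1) % 2)) = _
        rw [show (n + 1) % 2 = 1 by omega]
        unfold dropRoom
        rw [if_neg (by omega)]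
        split_ifs <;> omega
      · show Btw (dropRoom _ _ (n % 2) (q (n % 2))) _ _
        rw [hn]
        unfold dropRoom Btw
        rw [if_pos rfl]
        split_ifs <;> omega
  · obtain ⟨s, rfl⟩ := Nat.exists_eq_add_of_le hjn
    exact hT _ (by omega) s t (by omega) (by omega) q (new s q (by omega) hj)
      (new t q (by omega) hk')

/-- The start lies to the left of the endpoint and on its level, so `makeRoom` does not move it and
the distance grows by exactly one. The summand 2 in the signs is the excess of `σ` modulo 4. -/
theorem drawn_newEnd {σ τ : List Turn} {a : ℤ} (h : Drawn σ c a) (hw : net σ % 4 = 2)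
    (hτ : τ.length % 2 = 0) (hτ0 : 0 < τ.length)
    (hTx : ∀ t ≤ τ.length + 1, t % 2 = 1 → c (σ.length + 2) ≤ T t ∧ T t ≤ c (σ.length + 2) + 2)
    (hTy : ∀ t ≤ τ.length + 1, t % 2 = 0 → c (σ.length + 1) - 1 ≤ T t ∧ T t ≤ c (σ.length + 1) + 1)
    (hT : ∀ X, c (σ.length + 2) + 3 ≤ X →
      Simple τ.length (fun j => if j = 0 then X else T (j - 1)))
    (hd : ∀ t < τ.length, 0 < sgn (2 + net (τ.take (t + 1))) * (T (t + 2) - T t))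
    (hl : T τ.length = c (σ.length + 1)) (he : T (τ.length + 1) = c (σ.length + 2) + 1) :
    Drawn (σ ++ τ) (newEnd σ.length c T) (a + 1) := by
  have hev := h.even
  have hds := h.dist
  have hlv := h.level
  have hpos := h.pos
  have hσ : σ.length ≠ 0 := by
    intro h0
    rw [List.length_eq_zero_iff] at h0
    simp [h0] at hw
  have hwest : c (σ.length + 2) < c σ.length := by
    have := h.dir σ.length le_rfl
    rw [sgn_mul_pos_iff] at this
    have e := sgn_cases (net (σ.take σ.length))
    rw [List.take_length] at this e
    omega
  refine ⟨by simp; omega, ?_, ?_, ?_, ?_, by omega⟩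
  · intro j hj
    rcases lt_trichotomy j σ.length with hlt | heq | hgt
    · have hj' := h.dir j hlt.le
      rw [net_take_append_le _ _ hlt.le]
      rw [sgn_mul_pos_iff] at hj' ⊢
      rw [newEnd_le hlt.le]
      by_cases h2 : j + 2 ≤ σ.length
      · rw [newEnd_le h2]
        have e : ∀ z, makeRoom (c (σ.length + 2)) (c (σ.length + 1)) (j + 2) z =
          makeRoom (c (σ.length + 2)) (c (σ.length + 1)) j z := by
          intro z; unfold makeRoom; rw [show (j + 2) % 2 = j % 2 by omega]
        rw [e]
        refine hj'.imp (fun ⟨e, h⟩ => ⟨e, ?_⟩) (fun ⟨e, h⟩ => ⟨e, ?_⟩)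
        · have := makeRoom_strictMono (a := c (σ.length + 2)) (y := c (σ.length + 1)) j
            (show c j < c (j + 2) by omega)
          omega
        · have := makeRoom_strictMono (a := c (σ.length + 2)) (y := c (σ.length + 1)) j
            (show c (j + 2) < c j by omega)
          omega
      · have e : j + 2 = σ.length + 1 := by omega
        rw [e] at hj' ⊢
        rw [show newEnd σ.length c T (σ.length + 1) = T 0 from newEnd_gt 0]
        have := hTy 0 (by omega) rfl
        unfold makeRoom
        rw [if_neg (by omega)]
        split_ifs <;> omega
    · rw [heq, net_take_append_le _ _ le_rfl, List.take_length, newEnd_le le_rfl,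
        show newEnd σ.length c T (σ.length + 2) = T 1 from newEnd_gt 1]
      have e := sgn_cases (net σ)
      rw [sgn_mul_pos_iff]
      have := hTx 1 (by omega) rfl
      unfold makeRoom
      rw [if_pos (by omega), if_neg (by omega)]
      omega
    · obtain ⟨t, rfl⟩ := Nat.exists_eq_add_of_le hgt
      have hd' := hd t (by simp at hj; omega)
      rw [show σ.length.succ + t = σ.length + 1 + t by omega, newEnd_gt,
        show σ.length + 1 + t + 2 = σ.length + 1 + (t + 2) by omega, newEnd_gt]
      have e : (σ ++ τ).take (σ.length + 1 + t) = σ ++ τ.take (t + 1) := by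
        rw [List.take_append, List.take_of_length_le (by omega),
          show σ.length + 1 + t - σ.length = t + 1 by omega]
      rw [e, net_append]
      have e2 : sgn (net σ + net (τ.take (t + 1))) = sgn (2 + net (τ.take (t + 1))) := by
        unfold sgn; congr 1; simp; omega
      rw [e2]
      exact hd'
  · rw [List.length_append]
    exact simple_newEnd h.simple hev hwest hTx hTy hT
  · rw [List.length_append, show σ.length + τ.length + 1 = σ.length + 1 + τ.length by omega,
      newEnd_gt, hl, newEnd_le (by omega), ← hlv]
    simp [makeRoom]
  · rw [List.length_append, show σ.length + τ.length + 2 = σ.length + 1 + (τ.length + 1) by omega,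
      newEnd_gt, he, newEnd_le (by omega), hds]
    unfold makeRoom
    rw [if_pos rfl, if_pos (by omega)]
    ring

end NewEnd

/-- The last segment is lifted by one row and still ends in the old column; from there the chain
descends to the old level and moves one unit east. The version with `R` uses the row below. -/
theorem ReachLe.append_LL {σ : List Turn} {b : ℤ} (h : ReachLe σ b) (hw : net σ % 4 = 2) :
    ReachLe (σ ++ [Turn.L, Turn.L]) (b + 1) := by
  obtain ⟨c, a, hc, hab⟩ := h
  refine ⟨_, _, drawn_newEnd
    (T := fun t => [c (σ.length + 1) + 1, c (σ.length + 2), c (σ.length + 1),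
      c (σ.length + 2) + 1].getD t 0) hc hw rfl (by simp) ?_ ?_ ?_ ?_ rfl rfl, by omega⟩
  · intro t ht hp
    simp only [List.length_cons, List.length_nil] at ht
    interval_cases t <;> simp_all
  · intro t ht hp
    simp only [List.length_cons, List.length_nil] at ht
    interval_cases t <;> simp_all <;> omega
  · intro X hX j k hjk hk q hj hk'
    simp only [List.length_cons, List.length_nil] at hk
    obtain ⟨rfl, rfl⟩ : j = 0 ∧ k = 2 := by omega
    simp [On, Btw] at hj hk'
    omega
  · intro t ht
    simp only [List.length_cons, List.length_nil] at ht
    interval_cases t <;> simp [sgn]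

theorem ReachLe.append_RR {σ : List Turn} {b : ℤ} (h : ReachLe σ b) (hw : net σ % 4 = 2) :
    ReachLe (σ ++ [Turn.R, Turn.R]) (b + 1) := by
  obtain ⟨c, a, hc, hab⟩ := h
  refine ⟨_, _, drawn_newEnd
    (T := fun t => [c (σ.length + 1) - 1, c (σ.length + 2), c (σ.length + 1),
      c (σ.length + 2) + 1].getD t 0) hc hw rfl (by simp) ?_ ?_ ?_ ?_ rfl rfl, by omega⟩
  · intro t ht hp
    simp only [List.length_cons, List.length_nil] at ht
    interval_cases t <;> simp_all
  · intro t ht hp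
    simp only [List.length_cons, List.length_nil] at ht
    interval_cases t <;> simp_all <;> omega
  · intro X hX j k hjk hk q hj hk'
    simp only [List.length_cons, List.length_nil] at hk
    obtain ⟨rfl, rfl⟩ : j = 0 ∧ k = 2 := by omega
    simp [On, Btw] at hj hk'
    omega
  · intro t ht
    simp only [List.length_cons, List.length_nil] at ht
    interval_cases t <;> simp [sgn]

/-- A chain that ends coming from the right can be continued by one more turn of an inward
spiral. -/
theorem Real.curl {W : List (Turn × Bool)} {a : ℤ} (h : Real W a)
    (hw : net (W.map Prod.fst) % 4 = 2) :
    Real (W ++ [(Turn.L, false), (Turn.L, true), (Turn.L, true), (Turn.L, true)]) (a + 1) := by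
  obtain ⟨c, hc, hf⟩ := h
  have hev := hc.even
  have hds := hc.dist
  have hpos := hc.pos
  have hwest : c (W.length + 2) < c W.length := by
    have := hc.dir (W.map Prod.fst).length le_rfl
    rw [sgn_mul_pos_iff] at this
    have e := sgn_cases (net ((W.map Prod.fst).take (W.map Prod.fst).length))
    rw [List.take_length] at this e
    simp only [List.length_map] at this
    omega
  have hσ : W ≠ [] := by
    rintro rfl
    simp at hw
  simp only [List.length_map] at hev hds
  -- One winding around the new endpoint: west in the upper row, down the old column, east in the
  -- lower row to the second new column, up to the level, and west by one. Only the descent in the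
  -- old column lies in the strip, hence the unmarked first turn.
  set T : ℕ → ℤ := fun t => [c (W.length + 1) + 1, c (W.length + 2), c (W.length + 1) - 1,
      c (W.length + 2) + 2, c (W.length + 1), c (W.length + 2) + 1].getD t 0 with hT
  have hd := drawn_newEnd (τ := [Turn.L, Turn.L, Turn.L, Turn.L]) (T := T) hc hw rfl (by simp)
    (by
      intro t ht hp
      simp only [List.length_cons, List.length_nil] at ht
      interval_cases t <;> simp_all)
    (by
      intro t ht hp
      simp only [List.length_cons, List.length_nil] at ht
      interval_cases t <;> simp_all <;> omega)
    (by
      intro X hX j k hjk hk q hj hk'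
      simp only [List.length_cons, List.length_nil, List.length_map] at hk hX
      have : (j = 0 ∧ (k = 2 ∨ k = 3 ∨ k = 4)) ∨ (j = 1 ∧ (k = 3 ∨ k = 4)) ∨ (j = 2 ∧ k = 4) := by
        omega
      rcases this with ⟨rfl, rfl | rfl | rfl⟩ | ⟨rfl, rfl | rfl⟩ | ⟨rfl, rfl⟩ <;>
        simp [On, Btw, hT] at hj hk' <;> omega)
    (by
      intro t ht
      simp only [List.length_cons, List.length_nil] at ht
      interval_cases t <;> simp [sgn, hT])
    (by simp [hT]) (by simp [hT])
  refine ⟨_, by simpa using hd, ?_⟩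
  intro j u hu
  have hl : (W ++ [(Turn.L, false), (Turn.L, true), (Turn.L, true), (Turn.L, true)]).length =
    W.length + 4 := by simp
  rw [hl]
  have d0 : newEnd W.length c T 0 = c 0 := by
    rw [newEnd_le (by omega)]; unfold makeRoom; rw [if_pos rfl, if_pos (by omega)]
  have dn : newEnd W.length c T (W.length + 4 + 2) = c 0 + a + 1 := by
    rw [show W.length + 4 + 2 = W.length + 1 + 5 by omega, newEnd_gt]
    simp [hT, hds]
  have old : ∀ i ≤ W.length, i % 2 = 0 → (c i < c 0 → newEnd W.length c T i < c 0) ∧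
      (c (W.length + 2) < c i → c 0 + a + 1 < newEnd W.length c T i) := by
    intro i hi hp
    rw [newEnd_le hi]; unfold makeRoom; rw [if_pos hp]
    split_ifs <;> omega
  rcases lt_or_ge j W.length with hj | hj
  · rw [List.getElem?_append_left hj] at hu
    have hfj := hf j u hu
    unfold Free at hfj ⊢
    rw [d0, dn]
    by_cases hp : (j + 1) % 2 = 0
    · rw [if_pos hp] at hfj ⊢
      have o1 := old (j + 1) (by omega) hp
      by_cases h2 : j + 1 + 2 ≤ W.length
      · have o2 := old (j + 1 + 2) h2 (by omega)
        exact hfj.imp o1.1 (Or.imp o2.1 (Or.imp o1.2 o2.2))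
      · have e : j + 1 = W.length := by omega
        rw [e] at o1 ⊢
        exact .inr (.inr (.inl (o1.2 hwest)))
    · rw [if_neg hp] at hfj ⊢
      have o1 := old (j + 1 + 1) (by omega) (by omega)
      exact hfj.imp o1.1 o1.2
  · obtain ⟨t, rfl⟩ := Nat.exists_eq_add_of_le hj
    rw [List.getElem?_append_right (by omega)] at hu
    have ht : t < 4 := by
      by_contra h
      rw [List.getElem?_eq_none (by simp; omega)] at hu
      simp at hu
    unfold Free
    rw [d0, dn]
    have g : ∀ t, newEnd W.length c T (W.length + 1 + t) = T t := newEnd_gt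
    have hWl : W.length % 2 = 0 := hev
    interval_cases t
    · simp at hu
    · rw [if_pos (by omega), show W.length + 1 + 1 + 2 = W.length + 1 + 3 by omega, g, g]
      simp [hT]; omega
    · rw [if_neg (by omega), show W.length + 2 + 1 + 1 = W.length + 1 + 3 by omega, g]
      simp [hT]; omega
    · rw [if_pos (by omega), show W.length + 3 + 1 = W.length + 1 + 3 by omega, g]
      simp [hT]; omega

/-! ### Symmetries of drawn chains -/

theorem net_parity (w : List Turn) : net w % 2 = (w.length : ℤ) % 2 := by
  induction w with
  | nil => simp
  | cons t w ih => rcases turnVal_cases t with ⟨-, e⟩ | ⟨-, e⟩ <;> simp [e] <;> omega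

theorem net_take_parity {σ : List Turn} {j : ℕ} (h : j ≤ σ.length) :
    net (σ.take j) % 2 = (j : ℤ) % 2 := by
  rw [net_parity, List.length_take, min_eq_left h]

theorem sgn_neg_even {k : ℤ} (h : k % 2 = 0) : sgn (-k) = sgn k := by
  unfold sgn; congr 1; simp; omega

theorem sgn_neg_odd {k : ℤ} (h : k % 2 = 1) : sgn (-k) = -sgn k := by
  unfold sgn; split_ifs <;> omega

theorem Btw.neg {z a b : ℤ} (h : Btw (-z) a b) : Btw z (-a) (-b) := by
  unfold Btw at *; omega

theorem Btw.symm {z a b : ℤ} (h : Btw z a b) : Btw z b a := by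
  unfold Btw at *; omega

theorem ReachLe.mirror {σ : List Turn} {b : ℤ} (h : ReachLe σ b) :
    ReachLe (σ.map flipTurn) b := by
  obtain ⟨c, a, hc, hab⟩ := h
  have hev := hc.even
  refine ⟨fun j => if j % 2 = 0 then c j else -c j, a,
    ⟨by simpa using hev, ?_, ?_, ?_, ?_, hc.pos⟩, hab⟩
  · intro j hj
    simp only [List.length_map] at hj
    have h1 := hc.dir j hj
    have hp := net_take_parity hj
    rw [← List.map_take, net_map_flipTurn]
    by_cases hj2 : j % 2 = 0
    · simp only [show (j + 2) % 2 = 0 by omega, hj2, if_true]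
      rwa [sgn_neg_even (by omega)]
    · simp only [show ¬ (j + 2) % 2 = 0 by omega, hj2, if_false]
      rw [sgn_neg_odd (by omega)]
      linarith
  · have key : ∀ j q, On (fun j => if j % 2 = 0 then c j else -c j) j q →
        On c j (fun p => if p % 2 = 0 then q p else -q p) := by
      rintro j q ⟨h1, h2⟩
      by_cases hj2 : j % 2 = 0
      · simp only [show ¬ (j + 1) % 2 = 0 by omega, show (j + 2) % 2 = 0 by omega, hj2, if_true,
          if_false] at h1 h2
        refine ⟨?_, ?_⟩
        · simp only [show ¬ ((j + 1) % 2 % 2 = 0) by omega, if_false, h1, neg_neg]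
        · simp only [show j % 2 % 2 = 0 by omega, if_true]
          rwa [hj2]
      · simp only [show (j + 1) % 2 = 0 by omega, show ¬ (j + 2) % 2 = 0 by omega, hj2, if_true,
          if_false] at h1 h2
        refine ⟨?_, ?_⟩
        · simp only [show (j + 1) % 2 % 2 = 0 by omega, if_true]
          rw [show (j + 1) % 2 = 0 by omega, h1]
        · simp only [show ¬ (j % 2 % 2 = 0) by omega, if_false]
          have := Btw.neg (z := -q (j % 2)) (a := -c j) (b := -c (j + 2)) (by simpa using h2)
          simpa using this
    intro j k hjk hk q hj hk'
    exact hc.simple j k hjk (by simpa using hk) _ (key j q hj) (key k q hk')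
  · have := hc.level
    simp only [List.length_map]
    rw [if_neg (by omega), if_neg (by omega), this]
  · have := hc.dist
    simp only [List.length_map]
    rw [if_pos (by omega), this, if_pos trivial]

theorem net_take_reverse {σ : List Turn} {j : ℕ} :
    net (σ.reverse.take j) = net σ - net (σ.take (σ.length - j)) := by
  have e : σ.reverse.take j = (σ.drop (σ.length - j)).reverse := by rw [List.take_reverse]
  have e2 : net σ = net (σ.take (σ.length - j)) + net (σ.drop (σ.length - j)) := by
    rw [← net_append, List.take_append_drop]
  rw [e, net_reverse]; omega

theorem ReachLe.reverse {σ : List Turn} {b : ℤ} (h : ReachLe σ b) (h0 : net σ % 4 = 0) :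
    ReachLe σ.reverse b := by
  obtain ⟨c, a, hc, hab⟩ := h
  have hev := hc.even
  obtain ⟨n, hn⟩ : ∃ n, n = σ.length := ⟨_, rfl⟩
  rw [← hn] at hev
  -- Reading the coordinates backwards reverses the chain, and negating the abscissae reflects it in
  -- a vertical line; the endpoint is again `a` to the right of the start.
  set c' : ℕ → ℤ := fun j => if j % 2 = 0 then -c (n + 2 - j) else c (n + 2 - j) with hc'
  have hc0 : ∀ j, j % 2 = 0 → c' j = -c (n + 2 - j) := fun j hj => if_pos hj
  have hc1 : ∀ j, j % 2 = 1 → c' j = c (n + 2 - j) := fun j hj => if_neg (by omega)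
  refine ⟨c', a, ⟨by simp; omega, ?_, ?_, ?_, ?_, hc.pos⟩, hab⟩
  · intro j hj
    simp only [List.length_reverse, ← hn] at hj
    have h1 := hc.dir (n - j) (by omega)
    have hp := net_take_parity (σ := σ) (j := n - j) (by omega)
    have e : sgn (net (σ.reverse.take j)) = sgn (-net (σ.take (n - j))) := by
      rw [net_take_reverse, ← hn]; unfold sgn; congr 1; simp; omega
    rw [e]
    have a1 : n + 2 - (j + 2) = n - j := by omega
    have a2 : n - j + 2 = n + 2 - j := by omega
    rw [a2] at h1
    by_cases hj2 : j % 2 = 0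
    · rw [hc0 j hj2, hc0 (j + 2) (by omega), sgn_neg_even (by omega), a1]
      linarith
    · rw [hc1 j (by omega), hc1 (j + 2) (by omega), sgn_neg_odd (by omega), a1]
      linarith
  · have key : ∀ j q, j ≤ n → On c' j q → On c (n - j) (fun p => if p % 2 = 0 then -q p else q p) := by
      rintro j q hj ⟨h1, h2⟩
      have a1 : n - j + 1 = n + 2 - (j + 1) := by omega
      have a2 : n - j + 2 = n + 2 - j := by omega
      have a3 : n - j = n + 2 - (j + 2) := by omega
      by_cases hj2 : j % 2 = 0
      · rw [hc1 (j + 1) (by omega)] at h1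
        rw [hc0 j hj2, hc0 (j + 2) (by omega)] at h2
        refine ⟨?_, ?_⟩
        · simp only [show ¬ ((n - j + 1) % 2 % 2 = 0) by omega, if_false]
          rw [show (n - j + 1) % 2 = (j + 1) % 2 by omega, h1, a1]
        · simp only [show ((n - j) % 2 % 2 = 0) by omega, if_true]
          rw [show (n - j) % 2 = j % 2 by omega, a2, a3]
          unfold Btw at h2 ⊢
          omega
      · rw [hc0 (j + 1) (by omega)] at h1
        rw [hc1 j (by omega), hc1 (j + 2) (by omega)] at h2
        refine ⟨?_, ?_⟩
        · simp only [show ((n - j + 1) % 2 % 2 = 0) by omega, if_true]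
          rw [show (n - j + 1) % 2 = (j + 1) % 2 by omega, h1, a1, neg_neg]
        · simp only [show ¬ ((n - j) % 2 % 2 = 0) by omega, if_false]
          rw [show (n - j) % 2 = j % 2 by omega, a2, a3]
          exact h2.symm
    intro j k hjk hk q hj hk'
    simp only [List.length_reverse, ← hn] at hk
    exact hc.simple (n - k) (n - j) (by omega) (by omega) _ (key k q hk hk')
      (key j q (by omega) hj)
  · have := hc.level
    rw [← hn] at this
    rw [List.length_reverse, ← hn, hc1 _ (by omega), hc1 1 rfl,
      show n + 2 - (n + 1) = 1 by omega, show n + 2 - 1 = n + 1 by omega, this]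
  · have := hc.dist
    rw [← hn] at this
    rw [List.length_reverse, ← hn, hc0 _ (by omega), hc0 0 rfl, Nat.sub_self, Nat.sub_zero, this]
    ring

/-! ### From coordinate sequences to the reachable set -/

theorem dirOf_even {k : ℤ} (h : k % 2 = 0) : dirOf k = (sgn k, 0) := by
  rcases dirOf_cases k with ⟨h', e⟩ | ⟨h', e⟩ | ⟨h', e⟩ | ⟨h', e⟩ <;> rw [e] <;>
    rcases sgn_cases k with ⟨h2, e2⟩ | ⟨h2, e2⟩ <;> rw [e2] <;> first | rfl | (exfalso; omega)

theorem dirOf_odd {k : ℤ} (h : k % 2 = 1) : dirOf k = (0, sgn k) := by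
  rcases dirOf_cases k with ⟨h', e⟩ | ⟨h', e⟩ | ⟨h', e⟩ | ⟨h', e⟩ <;> rw [e] <;>
    rcases sgn_cases k with ⟨h2, e2⟩ | ⟨h2, e2⟩ <;> rw [e2] <;> first | rfl | (exfalso; omega)

/-- The vertex number `i` of the chain with coordinates `c`. -/
def corner (c : ℕ → ℤ) (i : ℕ) : ℤ × ℤ := if i % 2 = 0 then (c i, c (i + 1)) else (c (i + 1), c i)

theorem vertex_eq_corner {σ : List Turn} {c : ℕ → ℤ} (hd : Dir σ c) {i : ℕ}
    (hi : i ≤ σ.length + 1) :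
    vertex σ (fun j => (c (j + 2) - c j).natAbs) i = corner c i - corner c 0 := by
  induction i with
  | zero => simp [vertex]
  | succ i ih =>
    have h1 := hd i (by omega)
    have hp := net_take_parity (σ := σ) (j := i) (by omega)
    rw [vertex, ih (by omega), heading_eq]
    rw [sgn_mul_pos_iff] at h1
    have e : (((c (i + 2) - c i).natAbs : ℕ) : ℤ) * sgn (net (σ.take i)) = c (i + 2) - c i := by
      rcases h1 with ⟨e, h⟩ | ⟨e, h⟩ <;> rw [e] <;> omega
    unfold corner
    by_cases hi2 : i % 2 = 0
    · rw [dirOf_even (by omega), if_pos hi2, if_neg (by omega : ¬ (i + 1) % 2 = 0)]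
      ext
      · simp only [Prod.fst_add, Prod.fst_sub, Prod.smul_fst, smul_eq_mul, e]; ring
      · simp
    · rw [dirOf_odd (by omega), if_neg hi2, if_pos (by omega : (i + 1) % 2 = 0)]
      ext
      · simp
      · simp only [Prod.snd_add, Prod.snd_sub, Prod.smul_snd, smul_eq_mul, e]; ring

theorem mem_uIcc_prod {p q z : ℤ × ℤ} :
    z ∈ Set.uIcc p q ↔ Btw z.1 p.1 q.1 ∧ Btw z.2 p.2 q.2 := by
  unfold Btw
  simp only [Set.uIcc, Set.mem_Icc, Prod.le_def, Prod.fst_inf, Prod.snd_inf, Prod.fst_sup,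
    Prod.snd_sup]
  omega

theorem corner_mem_reachableSet {σ : List Turn} {c : ℕ → ℤ} (hd : Dir σ c)
    (hs : Simple σ.length c) :
    corner c (σ.length + 1) - corner c 0 ∈ reachableSet σ := by
  refine ⟨fun j => (c (j + 2) - c j).natAbs, ?_, ?_, vertex_eq_corner hd le_rfl⟩
  · intro i hi
    have := hd i hi
    rw [sgn_mul_pos_iff] at this
    show 0 < (c (i + 2) - c i).natAbs
    omega
  · have key : ∀ i ≤ σ.length, ∀ q,
        q ∈ segmentPts σ (fun j => (c (j + 2) - c j).natAbs) i →
        On c i (fun p => if p % 2 = 0 then q.1 + c 0 else q.2 + c 1) := by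
      intro i hi q hq
      rw [segmentPts, vertex_eq_corner hd (by omega), vertex_eq_corner hd (by omega),
        mem_uIcc_prod] at hq
      unfold corner at hq
      unfold On
      simp only [Nat.mod_mod]
      unfold Btw at *
      by_cases hi2 : i % 2 = 0
      · rw [if_pos hi2, if_neg (by omega : ¬ (i + 1) % 2 = 0)] at hq
        simp at hq
        rw [show i + 1 + 1 = i + 2 from rfl] at hq
        rw [if_neg (by omega : ¬ (i + 1) % 2 = 0), if_pos hi2]
        omega
      · rw [if_neg hi2, if_pos (by omega : (i + 1) % 2 = 0)] at hq
        simp at hq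
        rw [show i + 1 + 1 = i + 2 from rfl] at hq
        rw [if_pos (by omega : (i + 1) % 2 = 0), if_neg hi2]
        omega
    intro i j hij hj q hqi hqj
    have k1 := key i (by omega) q hqi
    have k2 := key j hj q hqj
    by_cases h : j = i + 1
    · refine ⟨h, ?_⟩
      subst h
      rw [vertex_eq_corner hd (by omega)]
      have e1 := k1.1
      have e2 := k2.1
      unfold corner
      by_cases hi2 : i % 2 = 0
      · rw [if_neg (by omega : ¬ (i + 1) % 2 = 0)]
        simp only [show (i + 1) % 2 = 1 by omega,
          show (i + 1 + 1) % 2 = 0 by omega, if_true] at e1 e2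
        ext <;> simp <;> omega
      · rw [if_pos (by omega : (i + 1) % 2 = 0)]
        simp only [show (i + 1) % 2 = 0 by omega,
          show (i + 1 + 1) % 2 = 1 by omega, if_true] at e1 e2
        ext <;> simp <;> omega
    · exact absurd k2 (hs i j (by omega) hj _ k1)

theorem ReachLe.exists_mem {σ : List Turn} {b : ℤ} (h : ReachLe σ b) :
    ∃ x ∈ plusXDistances σ, (x : ℤ) ≤ b := by
  obtain ⟨c, a, hc, hab⟩ := h
  have hpos := hc.pos
  refine ⟨a.toNat, ⟨by omega, ?_⟩, by omega⟩
  have := corner_mem_reachableSet hc.dir hc.simple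
  have hev := hc.even
  have e : corner c (σ.length + 1) - corner c 0 = (((a.toNat : ℕ) : ℤ), (0 : ℤ)) := by
    unfold corner
    rw [if_neg (by omega), if_pos rfl, hc.level, show σ.length + 1 + 1 = σ.length + 2 from rfl,
      hc.dist]
    ext <;> simp
    omega
  rwa [e] at this

/-- If the last segment heads east, it can be cut off. -/
theorem ReachLe.exists_mem_dropLast {σ : List Turn} {t : Turn} {b : ℤ} (h : ReachLe (σ ++ [t]) b)
    (h0 : net (σ ++ [t]) % 4 = 0) :
    ∃ x ∈ plusXDistances σ, (x : ℤ) ≤ b - 1 := by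
  obtain ⟨c, a, hc, hab⟩ := h
  have hev := hc.even
  have hlv := hc.level
  have hds := hc.dist
  have hpos := hc.pos
  simp only [List.length_append, List.length_cons, List.length_nil, zero_add] at hev hlv hds
  have hlast := hc.dir (σ.length + 1) (by simp)
  have hfirst := hc.dir 0 (by simp)
  rw [show σ.length + 1 = (σ ++ [t]).length by simp, List.take_length] at hlast
  rw [sgn_mul_pos_iff] at hlast hfirst
  have e1 := sgn_cases (net (σ ++ [t]))
  have e2 := sgn_cases (net ((σ ++ [t]).take 0))
  simp only [List.take_zero, net_nil] at e2 hfirst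
  simp only [List.length_append, List.length_cons, List.length_nil, zero_add] at hlast
  rw [show σ.length + 1 + 2 = σ.length + 3 from rfl] at *
  -- If the last segment began at or left of the start, it would run through the start on its way
  -- east, and would meet segment 0 there.
  have hlt : c 0 < c (σ.length + 1) := by
    by_contra hle
    refine hc.simple 0 (σ.length + 1) (by omega) (by simp)
      (fun p => if p = 0 then c 0 else c 1) ⟨rfl, ?_⟩ ⟨?_, ?_⟩
    · simp [Btw]; omega
    · simp only [show (σ.length + 1 + 1) % 2 = 1 by omega, one_ne_zero, if_false]
      exact hlv.symm
    · simp only [show (σ.length + 1) % 2 = 0 by omega, if_true]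
      unfold Btw
      rw [show σ.length + 1 + 2 = σ.length + 3 from rfl]
      omega
  have hd : Dir σ c := by
    intro j hj
    have := hc.dir j (by simp; omega)
    rwa [net_take_append_le _ _ hj] at this
  have hs : Simple σ.length c := fun j k hjk hk => hc.simple j k hjk (by simp; omega)
  refine ⟨(c (σ.length + 1) - c 0).toNat, ⟨by omega, ?_⟩, by omega⟩
  have := corner_mem_reachableSet hd hs
  have e : corner c (σ.length + 1) - corner c 0 =
      ((((c (σ.length + 1) - c 0).toNat : ℕ) : ℤ), (0 : ℤ)) := by
    unfold corner
    rw [if_pos (by omega), if_pos rfl, hlv]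
    ext <;> simp
    omega
  rwa [e] at this

/-! ### Explicit drawings and their spirals -/

/-- Two segments of a chain have no common point. -/
def Sep (c : ℕ → ℤ) (j k : ℕ) : Prop :=
  if j % 2 = k % 2 then c (j + 1) ≠ c (k + 1) ∨ max (c j) (c (j + 2)) < min (c k) (c (k + 2)) ∨
    max (c k) (c (k + 2)) < min (c j) (c (j + 2))
  else max (c k) (c (k + 2)) < c (j + 1) ∨ c (j + 1) < min (c k) (c (k + 2)) ∨
    max (c j) (c (j + 2)) < c (k + 1) ∨ c (k + 1) < min (c j) (c (j + 2))

instance (c : ℕ → ℤ) (j k : ℕ) : Decidable (Sep c j k) := by unfold Sep; infer_instance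

instance (n : ℕ) (c : ℕ → ℤ) (j : ℕ) : Decidable (Free n c j) := by unfold Free; infer_instance

theorem Sep.not_on {c : ℕ → ℤ} {j k : ℕ} (h : Sep c j k) (q : ℕ → ℤ) (hj : On c j q) :
    ¬ On c k q := by
  rintro ⟨k1, k2⟩
  obtain ⟨j1, j2⟩ := hj
  unfold Sep at h
  unfold Btw at j2 k2
  by_cases hp : j % 2 = k % 2
  · rw [if_pos hp] at h
    rw [show (j + 1) % 2 = (k + 1) % 2 by omega] at j1
    rw [hp] at j2
    omega
  · rw [if_neg hp] at h
    rw [show (j + 1) % 2 = k % 2 by omega] at j1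
    rw [show j % 2 = (k + 1) % 2 by omega] at j2
    omega

/-- A turn sequence is realized by a list of coordinates that passes a finite check. -/
theorem real_of_list (W : List (Turn × Bool)) (l : List ℤ) (a : ℤ)
    (h : W.length % 2 = 0 ∧
      (∀ j < W.length + 1,
        0 < sgn (net ((W.map Prod.fst).take j)) * (l.getD (j + 2) 0 - l.getD j 0)) ∧
      (∀ k < W.length + 1, ∀ j < k, j + 1 < k → Sep (fun i => l.getD i 0) j k) ∧
      l.getD (W.length + 1) 0 = l.getD 1 0 ∧ l.getD (W.length + 2) 0 = l.getD 0 0 + a ∧ 0 < a ∧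
      ∀ j < W.length, (W.getD j (Turn.L, false)).2 = true →
        Free W.length (fun i => l.getD i 0) (j + 1)) : Real W a := by
  obtain ⟨h1, h2, h3, h4, h5, h6, h7⟩ := h
  refine ⟨fun i => l.getD i 0, ⟨by simpa using h1, ?_, ?_, by simpa using h4, by simpa using h5, h6⟩,
    ?_⟩
  · intro j hj
    exact h2 j (by simp at hj; omega)
  · intro j k hjk hk q
    exact (h3 k (by simp at hk; omega) j (by omega) hjk).not_on q
  · intro j t ht
    have hj : j < W.length := by
      by_contra hc
      rw [List.getElem?_eq_none (by omega)] at ht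
      simp at ht
    exact h7 j hj (by simp [List.getD, ht])

/-- The turns that continue an inward spiral by one more winding. -/
def winding : List (Turn × Bool) := [(Turn.L, false), (Turn.L, true), (Turn.L, true), (Turn.L, true)]

@[simp] theorem net_windings (q : ℕ) :
    net (((List.replicate q winding).flatten).map Prod.fst) = 4 * q := by
  induction q with
  | zero => simp
  | succ q ih =>
    simp only [List.replicate_succ, List.flatten_cons, List.map_append, net_append, ih]
    simp [winding]
    ring

theorem Real.windings {W : List (Turn × Bool)} {a : ℤ} (h : Real W a)
    (hw : net (W.map Prod.fst) % 4 = 2) (q : ℕ) :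
    Real (W ++ (List.replicate q winding).flatten) (a + q) := by
  induction q with
  | zero => simpa using h
  | succ q ih =>
    have := ih.curl (by rw [List.map_append, net_append, net_windings]; omega)
    rw [List.replicate_succ', List.flatten_append, ← List.append_assoc]
    simp only [winding, List.flatten_cons, List.flatten_nil, List.append_nil] at this ⊢
    push_cast
    rwa [← add_assoc]

/-- A winding consists of a pair `LL` with nothing in between, followed by two free left turns. -/
theorem cov_windings (q : ℕ) : Cov ((List.replicate q winding).flatten) (4 * q) := by
  induction q with
  | zero => exact cov_nil
  | succ q ih =>
    have := ((ih.L (by omega)).L (by omega)).LL (by omega)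
    rw [show (4 * (q : ℤ) + 1 + 1 + 2) = 4 * ((q + 1 : ℕ) : ℤ) by push_cast; ring] at this
    exact this

theorem cov_replicate_L_windings (k q : ℕ) :
    Cov (List.replicate k (Turn.L, true) ++ (List.replicate q winding).flatten) (k + 4 * q) := by
  induction k with
  | zero => simpa using cov_windings q
  | succ k ih =>
    have := ih.L (by omega)
    rw [show (k : ℤ) + 4 * q + 1 = ((k + 1 : ℕ) : ℤ) + 4 * q by push_cast; ring] at this
    simpa [List.replicate_succ] using this

/-- The first two turns are kept as they are. The condition `hm` says that the drawing ends heading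
west, where windings can be attached; the excess beyond `k` is absorbed by `q` of them at one unit
each. -/
theorem ReachLe.of_spiral {s t : Turn} {k : ℕ} {a : ℤ}
    (h : Real ((s, false) :: (t, true) :: List.replicate k (Turn.L, true)) a)
    (hm : (turnVal s + turnVal t + k) % 4 = 2) (q : ℕ) {w : List Turn} (hw : net w = k + 4 * q) :
    ReachLe (s :: t :: w) (a + q) := by
  refine (h.windings ?_ q).reachLe ?_
  · simp [net_replicate]; omega
  · have := cov_replicate_L_windings k q w hw t [] [] Exp.nil
    simp only [List.append_nil] at this
    simpa using Exp.rigid s _ _ this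

theorem exp_end {t : Turn} {k : ℕ} {w : List Turn} (hw : net w = k) {W w'} (h : Exp W w') :
    Exp ((t, true) :: (List.replicate k (Turn.L, true) ++ W)) (t :: (w ++ w')) :=
  cov_replicate_L k w hw t W w' h

theorem exp_end_nil {t : Turn} {k : ℕ} {w : List Turn} (hw : net w = k) :
    Exp ((t, true) :: List.replicate k (Turn.L, true)) (t :: w) := by
  simpa using exp_end (t := t) hw Exp.nil

/-- In this and the following drawings the name spells the turns and the list gives the coordinates,
abscissae and ordinates alternating. A turn whose segment remains within the strip is unmarked. -/
theorem draw_LLLLLL : Real [(.L, false), (.L, true), (.L, true), (.L, true), (.L, true),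
      (.L, true)] 2 :=
  real_of_list _ [0, 0, 1, 2, -1, -2, 4, 0, 2] _ (by decide +kernel)

theorem draw_LRLLLLLL : Real [(.L, false), (.R, true), (.L, true), (.L, true), (.L, true),
      (.L, true), (.L, true), (.L, true)] 2 :=
  real_of_list _ [0, 0, 1, 1, 4, 3, -1, -2, 5, 0, 2] _ (by decide +kernel)

theorem draw_RLLL : Real [(.R, false), (.L, true), (.L, true), (.L, true)] 2 :=
  real_of_list _ [0, 0, 1, -1, 4, 0, 2] _ (by decide +kernel)

theorem draw_RRLLLL : Real [(.R, false), (.R, true), (.L, true), (.L, true), (.L, true),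
      (.L, true)] 2 :=
  real_of_list _ [0, 0, 1, -1, -1, -2, 4, 0, 2] _ (by decide +kernel)

theorem draw_LRRLLL : Real [(.L, false), (.R, false), (.R, false), (.L, true), (.L, true),
      (.L, true)] 3 :=
  real_of_list _ [0, 0, 1, 1, 2, -1, 5, 0, 3] _ (by decide +kernel)

theorem draw_LRRRLLLL : Real [(.L, false), (.R, false), (.R, false), (.R, true), (.L, true),
      (.L, true), (.L, true), (.L, true)] 3 :=
  real_of_list _ [0, 0, 1, 1, 2, -1, -1, -2, 5, 0, 3] _ (by decide +kernel)

/-- The segment of excess -1 descends at abscissa 2 and crosses the axis between the start and the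
endpoint, so its turn is unmarked. -/
theorem draw_LLRRRLLL : Real [(.L, false), (.L, true), (.R, true), (.R, true), (.R, false),
      (.L, true), (.L, true), (.L, true)] 3 :=
  real_of_list _ [0, 0, 1, 2, -1, 4, 2, -1, 5, 0, 3] _ (by decide +kernel)

theorem draw_LLRRRRLLLL : Real [(.L, false), (.L, true), (.R, true), (.R, true), (.R, false),
      (.R, true), (.L, true), (.L, true), (.L, true), (.L, true)] 3 :=
  real_of_list _ [0, 0, 1, 2, -1, 4, 2, -1, -2, -3, 5, 0, 3] _ (by decide +kernel)

/-- Here the axis is crossed between start and endpoint by the segment of excess 5, which ascends at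
abscissa 2. -/
theorem draw_LLLLLRRR : Real [(.L, false), (.L, true), (.L, true), (.L, true), (.L, false),
      (.R, true), (.R, true), (.R, true)] 3 :=
  real_of_list _ [0, 0, 1, 3, -1, -2, 2, 1, 5, 0, 3] _ (by decide +kernel)

theorem draw_LLLLLLRRRR : Real [(.L, false), (.L, true), (.L, true), (.L, true), (.L, false),
      (.L, true), (.R, true), (.R, true), (.R, true), (.R, true)] 3 :=
  real_of_list _ [0, 0, 1, 3, -1, -2, 2, 4, -2, 6, 5, 0, 3] _ (by decide +kernel)

theorem draw_LLRRRL : Real [(.L, false), (.L, true), (.R, false), (.R, false), (.R, false),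
      (.L, false)] 3 :=
  real_of_list _ [0, 0, 1, 1, -1, 2, 2, 0, 3] _ (by decide +kernel)

theorem draw_LRRL : Real [(.L, false), (.R, false), (.R, false), (.L, false)] 3 :=
  real_of_list _ [0, 0, 1, 1, 2, 0, 3] _ (by decide +kernel)

theorem draw_LRRLLLLLRL : Real [(.L, false), (.R, false), (.R, false), (.L, true), (.L, true),
      (.L, true), (.L, true), (.L, true), (.R, false), (.L, false)] 4 :=
  real_of_list _ [0, 0, 1, 1, 2, -1, 6, 4, -1, 3, 3, 0, 4] _ (by decide +kernel)

theorem draw_LRRRLLLLLLRL : Real [(.L, false), (.R, false), (.R, false), (.R, true), (.L, true),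
      (.L, true), (.L, true), (.L, true), (.L, true), (.L, true), (.R, false), (.L, false)] 4 :=
  real_of_list _ [0, 0, 1, 1, 2, -1, -1, -2, 6, 4, -2, 3, 3, 0, 4] _ (by decide +kernel)

theorem draw_LLRRRLLLLLRL : Real [(.L, false), (.L, true), (.R, true), (.R, true), (.R, false),
      (.L, true), (.L, true), (.L, true), (.L, true), (.L, true), (.R, false), (.L, false)] 4 :=
  real_of_list _ [0, 0, 1, 2, -1, 4, 2, -1, 6, 6, -2, 5, 3, 0, 4] _ (by decide +kernel)

theorem draw_LLRRRRLLLLLLRL : Real [(.L, false), (.L, true), (.R, true), (.R, true), (.R, false),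
      (.R, true), (.L, true), (.L, true), (.L, true), (.L, true), (.L, true), (.L, true),
      (.R, false), (.L, false)] 4 :=
  real_of_list _ [0, 0, 1, 2, -1, 4, 2, -1, -2, -2, 6, 6, -3, 5, 3, 0, 4] _ (by decide +kernel)

theorem draw_LLLLLR : Real [(.L, false), (.L, true), (.L, true), (.L, true), (.L, false),
      (.R, false)] 3 :=
  real_of_list _ [0, 0, 1, 1, -1, -1, 2, 0, 3] _ (by decide +kernel)

theorem draw_LRLLLLLR : Real [(.L, false), (.R, true), (.L, true), (.L, true), (.L, true),
      (.L, true), (.L, false), (.R, false)] 3 :=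
  real_of_list _ [0, 0, 1, 1, 4, 2, -1, -1, 2, 0, 3] _ (by decide +kernel)

theorem draw_RLLLLLLR : Real [(.R, false), (.L, false), (.L, false), (.L, true), (.L, true),
      (.L, true), (.L, false), (.R, false)] 4 :=
  real_of_list _ [0, 0, 1, -1, 2, 1, -1, -2, 3, 0, 4] _ (by decide +kernel)

theorem draw_RLLRLLLLLR : Real [(.R, false), (.L, false), (.L, false), (.R, true), (.L, true),
      (.L, true), (.L, true), (.L, true), (.L, false), (.R, false)] 4 :=
  real_of_list _ [0, 0, 1, -1, 2, 1, 5, 2, -1, -2, 3, 0, 4] _ (by decide +kernel)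

theorem draw_RRLLLLLLLR : Real [(.R, false), (.R, true), (.L, true), (.L, true), (.L, false),
      (.L, true), (.L, true), (.L, true), (.L, false), (.R, false)] 4 :=
  real_of_list _ [0, 0, 1, -1, -1, -2, 2, 1, -2, -3, 3, 0, 4] _ (by decide +kernel)

theorem draw_RRLLLRLLLLLR : Real [(.R, false), (.R, true), (.L, true), (.L, true), (.L, false),
      (.R, true), (.L, true), (.L, true), (.L, true), (.L, true), (.L, false), (.R, false)] 4 :=
  real_of_list _ [0, 0, 1, -1, -1, -2, 2, 1, 5, 2, -2, -3, 3, 0, 4] _ (by decide +kernel)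

/-! ### Bounds for spirals and for chains that begin with a staircase -/

open Turn

/-- A drawing of excess 6 ends at distance 2, and each of the remaining `j - 1` windings costs one
unit. -/
theorem reachLe_of_net_L {w : List Turn} {j : ℕ} (hj : 1 ≤ j) (h : net (L :: w) = 4 * j + 2) :
    ReachLe (L :: w) (j + 1) := by
  obtain ⟨j, rfl⟩ : ∃ i, j = i + 1 := ⟨j - 1, by omega⟩
  match w with
  | [] => simp at h; omega
  | L :: w =>
    refine (ReachLe.of_spiral (k := 4) draw_LLLLLL (by simp) j ?_).mono (by push_cast; omega)
    simp at h ⊢; omega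
  | R :: w =>
    refine (ReachLe.of_spiral (k := 6) draw_LRLLLLLL (by simp) j ?_).mono (by push_cast; omega)
    simp at h ⊢; omega

/-- After a first right turn the chain can pass below the axis and come back from the right with
excess 2 already, so windings start from there and no lower bound on `j` is needed. -/
theorem reachLe_of_net_R {w : List Turn} (j : ℕ) (h : net (R :: w) = 4 * j + 2) :
    ReachLe (R :: w) (j + 2) := by
  match w with
  | [] => simp at h; omega
  | L :: w =>
    refine (ReachLe.of_spiral (k := 2) draw_RLLL (by simp) j ?_).mono (by omega)
    simp at h ⊢; omega
  | R :: w =>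
    refine (ReachLe.of_spiral (k := 4) draw_RRLLLL (by simp) j ?_).mono (by omega)
    simp at h ⊢; omega

theorem stairO_eq (z₁ z₂ : ℤ × ℤ) (σ : List Turn) (h : east ≠ z₂) (h₁ : east ≠ -z₁)
    (h₂ : east ≠ -z₂) :
    stairO z₁ z₂ σ = ((hs 0 σ).takeWhile (fun h => h ≠ -z₁ ∧ h ≠ -z₂)).count z₂ := by
  rw [stairO, headings_eq, List.takeWhile_cons_of_pos (by simp [h₁, h₂]),
    List.count_cons_of_ne h]

theorem stairO_north_LR (w : List Turn) :
    stairO east north (L :: R :: w) = stairO east north w + 1 := by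
  rw [stairO_eq _ _ _ (by decide) (by decide) (by decide),
    stairO_eq _ _ _ (by decide) (by decide) (by decide)]
  simp [dirOf, east, north]

theorem stairO_south_RL (w : List Turn) :
    stairO east south (R :: L :: w) = stairO east south w + 1 := by
  rw [stairO_eq _ _ _ (by decide) (by decide) (by decide),
    stairO_eq _ _ _ (by decide) (by decide) (by decide)]
  simp [dirOf, east, south]

theorem stairO_north_L (w : List Turn) : 1 ≤ stairO east north (L :: w) := by
  rw [stairO_eq _ _ _ (by decide) (by decide) (by decide)]
  simp [dirOf, east, north]

theorem stairO_south_R (w : List Turn) : 1 ≤ stairO east south (R :: w) := by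
  rw [stairO_eq _ _ _ (by decide) (by decide) (by decide)]
  simp [dirOf, east, south]

theorem stairO_le_append (z₁ z₂ : ℤ × ℤ) (w x : List Turn) :
    stairO z₁ z₂ w ≤ stairO z₁ z₂ (w ++ x) := by
  rw [stairO, stairO, headings_eq, headings_eq, hs_append, ← List.cons_append]
  apply List.Sublist.count_le
  generalize east :: hs 0 w = l
  induction l with
  | nil => simp
  | cons a l ih =>
    by_cases h : a ≠ -z₁ ∧ a ≠ -z₂
    · rw [List.cons_append, List.takeWhile_cons_of_pos (by simpa using h),
        List.takeWhile_cons_of_pos (by simpa using h)]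
      exact ih.cons_cons a
    · rw [List.cons_append, List.takeWhile_cons_of_neg (by simpa using h)]
      simp

/-- Prefixes of the form `LR` can be removed at the cost of one unit. -/
theorem stairO_north_induction {P : List Turn → ℤ → Prop}
    (mono : ∀ w b b', P w b → b ≤ b' → P w b')
    (step : ∀ w b, P (L :: w) b → P (L :: R :: L :: w) (b + 1)) (a : ℤ) (Q : List Turn → Prop)
    (hQ : ∀ w, Q (L :: R :: L :: w) → Q (L :: w))
    (base₀ : ¬ Q [L]) (base₁ : ¬ Q [L, R]) (base_LL : ∀ w, Q (L :: L :: w) → P (L :: L :: w) (a + 1))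
    (base_RR : ∀ w, Q (L :: R :: R :: w) → P (L :: R :: R :: w) (a + 1)) :
    ∀ w, Q (L :: w) → P (L :: w) (stairO east north (L :: w) + a)
  | [], h => absurd h base₀
  | [R], h => absurd h base₁
  | L :: w, h => mono _ _ _ (base_LL w h) (by have := stairO_north_L (L :: w); omega)
  | R :: R :: w, h => mono _ _ _ (base_RR w h) (by have := stairO_north_L (R :: R :: w); omega)
  | R :: L :: w, h => by
    have := step w _ (stairO_north_induction mono step a Q hQ base₀ base₁ base_LL base_RR w (hQ w h))
    rw [stairO_north_LR]
    push_cast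
    convert this using 1
    ring

theorem stairO_south_induction {P : List Turn → ℤ → Prop}
    (mono : ∀ w b b', P w b → b ≤ b' → P w b')
    (step : ∀ w b, P (R :: w) b → P (R :: L :: R :: w) (b + 1)) (a : ℤ) (Q : List Turn → Prop)
    (hQ : ∀ w, Q (R :: L :: R :: w) → Q (R :: w))
    (base₀ : ¬ Q [R]) (base₁ : ¬ Q [R, L]) (base_RR : ∀ w, Q (R :: R :: w) → P (R :: R :: w) (a + 1))
    (base_LL : ∀ w, Q (R :: L :: L :: w) → P (R :: L :: L :: w) (a + 1)) :
    ∀ w, Q (R :: w) → P (R :: w) (stairO east south (R :: w) + a)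
  | [], h => absurd h base₀
  | [L], h => absurd h base₁
  | R :: w, h => mono _ _ _ (base_RR w h) (by have := stairO_south_R (R :: w); omega)
  | L :: L :: w, h => mono _ _ _ (base_LL w h) (by have := stairO_south_R (L :: L :: w); omega)
  | L :: R :: w, h => by
    have := step w _ (stairO_south_induction mono step a Q hQ base₀ base₁ base_RR base_LL w (hQ w h))
    rw [stairO_south_RL]
    push_cast
    convert this using 1
    ring

/-- The removed prefix meets only the excess numbers 0 and 1. -/
theorem HasNet.of_LRL {w : List Turn} {t : ℤ} (h0 : t ≠ 0) (h1 : t ≠ 1)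
    (h : HasNet (L :: R :: L :: w) t) : HasNet (L :: w) t := by
  simp only [hasNet_cons, turnVal_L, turnVal_R] at h ⊢
  rcases h with h | h | h | h
  · exact absurd h h0
  · omega
  · omega
  · right; convert h using 1; ring

theorem exists_split_of_hasNet_down {w : List Turn} {t s : ℤ} (h : HasNet w s) (ht : t ≤ 0)
    (hs : s ≤ t - 1) : ∃ u v, w = u ++ R :: v ∧ net u = t := by
  obtain ⟨x, y, rfl, hx⟩ := h
  obtain ⟨u, v, rfl, hu⟩ := exists_split_down x t ht (by omega)
  exact ⟨u, v ++ y, by simp, hu⟩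

theorem exists_split_of_hasNet_up {w : List Turn} {t s : ℤ} (h : HasNet w s) (ht : 0 ≤ t)
    (hs : t + 1 ≤ s) : ∃ u v, w = u ++ L :: v ∧ net u = t := by
  obtain ⟨x, y, rfl, hx⟩ := h
  obtain ⟨u, v, rfl, hu, -⟩ := exists_split_up x t ht (by omega)
  exact ⟨u, v ++ y, by simp, hu⟩

theorem ReachLe.insert_front {w : List Turn} {b : ℤ} (h : ReachLe w b) (hw : w ≠ []) {x y : Turn}
    (hxy : x ≠ y) : ReachLe (x :: y :: w) (b + 1) :=
  ReachLe.insert (A := []) (by simpa using h) (by simpa using hw) hxy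

/-- The chain leaves the axis upwards and comes back to it from the right. To get around its own
start it crosses the axis between both ends, downwards with excess -1 or upwards with excess 5.
After the initial `LR` pairs are removed, each case is one of the drawings. -/
theorem reachLe_of_net_two {w : List Turn} (h : net (L :: w) = 2)
    (hs : HasNet (L :: w) (-1) ∨ HasNet (L :: w) 5) :
    ReachLe (L :: w) (stairO east north (L :: w) + 2) := by
  refine stairO_north_induction (P := ReachLe) (fun _ _ _ h => h.mono)
    (fun w b hb => hb.insert_front (by simp) (by simp)) 2
    (fun w => net w = 2 ∧ (HasNet w (-1) ∨ HasNet w 5)) ?_ (by simp) (by simp) ?_ ?_ w ⟨h, hs⟩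
  · rintro w ⟨h1, h2⟩
    exact ⟨by simpa using h1, h2.imp (HasNet.of_LRL (by simp) (by simp))
      (HasNet.of_LRL (by simp) (by simp))⟩
  · rintro w ⟨h1, h2⟩
    simp at h1
    rcases h2 with h2 | h2
    · simp only [hasNet_cons, turnVal_L] at h2
      -- The initial `LL` gives excess 2, so -2 in the rest is total excess 0; the next `R` begins
      -- the crossing segment and must stay unmarked.
      obtain ⟨u, v, rfl, hu⟩ := exists_split_of_hasNet_down (t := -2)
        ((h2.resolve_left (by simp)).resolve_left (by simp)) (by simp) (by simp)
      simp [hu] at h1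
      match v with
      | [] => simp at h1
      | L :: v =>
        simp at h1
        exact draw_LLRRRLLL.reachLe (Exp.rigid L _ _ (cov_replicate_R 2 u hu L _ _
          (Exp.rigid R _ _ (exp_end_nil (k := 2) (by push_cast; omega)))))
      | R :: v =>
        simp at h1
        exact draw_LLRRRRLLLL.reachLe (Exp.rigid L _ _ (cov_replicate_R 2 u hu L _ _
          (Exp.rigid R _ _ (exp_end_nil (k := 4) (by push_cast; omega)))))
    · simp only [hasNet_cons, turnVal_L] at h2
      -- Total excess 4 is reached here, and the next `L` begins the upward crossing.
      obtain ⟨u, v, rfl, hu⟩ := exists_split_of_hasNet_up (t := 2)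
        ((h2.resolve_left (by simp)).resolve_left (by simp)) (by simp) (by simp)
      simp [hu] at h1
      match v with
      | [] => simp at h1
      | R :: v =>
        simp at h1
        have := cov_replicate_R 2 v (by push_cast; omega) R [] [] Exp.nil
        simp only [List.append_nil] at this
        exact draw_LLLLLRRR.reachLe (Exp.rigid L _ _ (exp_end (k := 2) hu (Exp.rigid L _ _ this)))
      | L :: v =>
        simp at h1
        have := cov_replicate_R 4 v (by push_cast; omega) L [] [] Exp.nil
        simp only [List.append_nil] at this
        exact draw_LLLLLLRRRR.reachLe (Exp.rigid L _ _ (exp_end (k := 2) hu (Exp.rigid L _ _ this)))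
  · rintro w ⟨h1, -⟩
    match w with
    | [] => simp at h1
    | L :: w =>
      simp at h1
      exact draw_LRRLLL.reachLe (Exp.rigid L _ _ (Exp.rigid R _ _ (Exp.rigid R _ _
        (exp_end_nil (k := 2) (by push_cast; omega)))))
    | R :: w =>
      simp at h1
      exact draw_LRRRLLLL.reachLe (Exp.rigid L _ _ (Exp.rigid R _ _ (Exp.rigid R _ _
        (exp_end_nil (k := 4) (by push_cast; omega)))))

theorem exp_map_false (w : List Turn) : Exp (w.map (·, false)) w := by
  induction w with
  | nil => exact Exp.nil
  | cons t w ih => exact Exp.rigid t _ _ ih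

/-- This serves excess zero when the part up to the last west segment has no segment of excess -1;
the appended turns then provide one. -/
theorem reachLe_append_RRRL {w : List Turn} (h : net (L :: w) = 2) (hs : ¬ HasNet (L :: w) (-1)) :
    ReachLe (L :: w ++ [R, R, R, L]) (stairO east north (L :: w) + 2) := by
  refine stairO_north_induction (P := fun w b => ReachLe (w ++ [R, R, R, L]) b)
    (fun _ _ _ h => h.mono)
    (fun w b hb => ReachLe.insert_front hb (by simp) (by simp)) 2
    (fun w => net w = 2 ∧ ¬ HasNet w (-1)) ?_ (by simp) (by simp) ?_ ?_ w ⟨h, hs⟩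
  · rintro w ⟨h1, h2⟩
    refine ⟨by simpa using h1, fun h => h2 ?_⟩
    simp only [hasNet_cons, turnVal_L, turnVal_R] at h ⊢
    right; right; simpa using h
  · rintro w ⟨h1, -⟩
    simp at h1
    have := draw_LLRRRL.reachLe (Exp.rigid L _ _ (Exp.free L w _ _ (balanced_of_net w (by omega))
      (exp_map_false [R, R, R, L])))
    simpa using this
  · rintro w ⟨-, h2⟩
    exact absurd ⟨[L, R, R], w, rfl, by simp⟩ h2

/-- Before its last two turns the chain heads east, so `ReachLe.append_LL` and `ReachLe.append_RR`
do not apply; the final step is part of the drawings. The same holds for the two lemmas with the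
ending `LR`. -/
theorem reachLe_append_RL {w : List Turn} (h : net (L :: w) = 4) (hs : HasNet (L :: w) (-1)) :
    ReachLe (L :: w ++ [R, L]) (stairO east north (L :: w) + 3) := by
  refine stairO_north_induction (P := fun w b => ReachLe (w ++ [R, L]) b)
    (fun _ _ _ h => h.mono)
    (fun w b hb => ReachLe.insert_front hb (by simp) (by simp)) 3
    (fun w => net w = 4 ∧ HasNet w (-1)) ?_ (by simp) (by simp) ?_ ?_ w ⟨h, hs⟩
  · rintro w ⟨h1, h2⟩
    exact ⟨by simpa using h1, HasNet.of_LRL (by simp) (by simp) h2⟩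
  · rintro w ⟨h1, h2⟩
    simp at h1
    simp only [hasNet_cons, turnVal_L] at h2
    obtain ⟨u, v, rfl, hu⟩ := exists_split_of_hasNet_down (t := -2)
      ((h2.resolve_left (by simp)).resolve_left (by simp)) (by simp) (by simp)
    simp [hu] at h1
    match v with
    | [] => simp at h1
    | L :: v =>
      simp at h1
      have := draw_LLRRRLLLLLRL.reachLe (Exp.rigid L _ _ (cov_replicate_R 2 u hu L _ _
        (Exp.rigid R _ _ (exp_end (k := 4) (w := v) (by push_cast; omega) (exp_map_false [R, L])))))
      simpa using this
    | R :: v =>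
      simp at h1
      have := draw_LLRRRRLLLLLLRL.reachLe (Exp.rigid L _ _ (cov_replicate_R 2 u hu L _ _
        (Exp.rigid R _ _ (exp_end (k := 6) (w := v) (by push_cast; omega) (exp_map_false [R, L])))))
      simpa using this
  · rintro w ⟨h1, -⟩
    match w with
    | [] => simp at h1
    | L :: w =>
      simp at h1
      have := draw_LRRLLLLLRL.reachLe (Exp.rigid L _ _ (Exp.rigid R _ _ (Exp.rigid R _ _
        (exp_end (k := 4) (w := w) (by push_cast; omega) (exp_map_false [R, L])))))
      simpa using this
    | R :: w =>
      simp at h1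
      have := draw_LRRRLLLLLLRL.reachLe (Exp.rigid L _ _ (Exp.rigid R _ _ (Exp.rigid R _ _
        (exp_end (k := 6) (w := w) (by push_cast; omega) (exp_map_false [R, L])))))
      simpa using this

theorem reachLe_L_append_LR {w : List Turn} (h : net (L :: w) = 4) :
    ReachLe (L :: w ++ [L, R]) 3 := by
  match w with
  | [] => simp at h
  | L :: w =>
    simp at h
    have := draw_LLLLLR.reachLe (Exp.rigid L _ _
      (exp_end (k := 2) (w := w) (by push_cast; omega) (exp_map_false [L, R])))
    simpa using this
  | R :: w =>
    simp at h
    have := draw_LRLLLLLR.reachLe (Exp.rigid L _ _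
      (exp_end (k := 4) (w := w) (by push_cast; omega) (exp_map_false [L, R])))
    simpa using this

theorem reachLe_R_append_LR {w : List Turn} (h : net (R :: w) = 4) :
    ReachLe (R :: w ++ [L, R]) (stairO east south (R :: w) + 3) := by
  refine stairO_south_induction (P := fun w b => ReachLe (w ++ [L, R]) b)
    (fun _ _ _ h => h.mono)
    (fun w b hb => ReachLe.insert_front hb (by simp) (by simp)) 3
    (fun w => net w = 4) ?_ (by simp) (by simp) ?_ ?_ w h
  · intro w h1
    simpa using h1
  · intro w h1
    simp at h1
    obtain ⟨u, v, rfl, hu, -⟩ := exists_split_up w 2 (by omega) (by omega)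
    simp [hu] at h1
    match v with
    | [] => simp at h1
    | L :: v =>
      simp at h1
      have := draw_RRLLLLLLLR.reachLe (Exp.rigid R _ _ (exp_end (k := 2) hu
        (Exp.rigid L _ _ (exp_end (k := 2) (w := v) (by push_cast; omega) (exp_map_false [L, R])))))
      simpa using this
    | R :: v =>
      simp at h1
      have := draw_RRLLLRLLLLLR.reachLe (Exp.rigid R _ _ (exp_end (k := 2) hu
        (Exp.rigid L _ _ (exp_end (k := 4) (w := v) (by push_cast; omega) (exp_map_false [L, R])))))
      simpa using this
  · intro w h1
    match w with
    | [] => simp at h1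
    | L :: w =>
      simp at h1
      have := draw_RLLLLLLR.reachLe (Exp.rigid R _ _ (Exp.rigid L _ _ (Exp.rigid L _ _
        (exp_end (k := 2) (w := w) (by push_cast; omega) (exp_map_false [L, R])))))
      simpa using this
    | R :: w =>
      simp at h1
      have := draw_RLLRLLLLLR.reachLe (Exp.rigid R _ _ (Exp.rigid L _ _ (Exp.rigid L _ _
        (exp_end (k := 4) (w := w) (by push_cast; omega) (exp_map_false [L, R])))))
      simpa using this

/-! ### Tails without west segments, and how the counts behave under symmetry -/

theorem ReachLe.of_straight {A B : List Turn} {k : ℤ} {v : List Turn} {b : ℤ} (h : west ∉ hs k v)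
    (hne : A ++ B ≠ []) (hb : ReachLe (A ++ straightWord (net v) ++ B) b) :
    ReachLe (A ++ v ++ B)
      (b + (hs k v).count east - (hs k (straightWord (net v))).count east) := by
  induction hn : v.length using Nat.strong_induction_on generalizing v with
  | _ n ih =>
    rcases replicate_or_exists_adjacent v with ⟨t, m, rfl⟩ | ⟨u, x, y, w, rfl, hxy⟩
    · rw [straightWord_replicate] at hb ⊢
      exact hb.mono (by omega)
    · have e := turnVal_add_of_ne hxy
      have e1 : k + net u + turnVal x + turnVal y = k + net u := by omega
      have e2 : net (u ++ x :: y :: w) = net (u ++ w) := by simp; omega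
      simp only [hs_append, hs_cons, e1, List.mem_append, List.mem_cons, not_or] at h
      have hc := count_pair_east (k := k + net u) (x := x) (Ne.symm h.2.2.1) (Ne.symm h.2.1)
      rw [e2] at hb ⊢
      have := ih _ (by simp at hn ⊢; omega) (v := u ++ w) (by simp [h]) hb rfl
      have h3 := ReachLe.insert (A := A ++ u) (B := w ++ B)
        (by rw [show A ++ u ++ (w ++ B) = A ++ (u ++ w) ++ B by simp]; exact this)
        (by simp at hne ⊢; tauto) hxy
      rw [show A ++ (u ++ x :: y :: w) ++ B = A ++ u ++ x :: y :: (w ++ B) by simp]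
      refine h3.mono ?_
      -- The pair costs one unit and adds one east segment, so the difference between bound and
      -- number of east segments is kept.
      have hc2 : (hs k (u ++ x :: y :: w)).count east = (hs k (u ++ w)).count east + 1 := by
        rw [← hc]
        simp only [hs_append, hs_cons, e1, List.count_append, List.count_cons, List.count_nil]
        ring
      omega

/-- The tail runs from heading west to heading east without heading west again, so its excess is 2
or -2. Its straightened form `LL` or `RR` has one east segment and costs one unit; by
`ReachLe.of_straight` the equality of cost and count persists. -/
theorem ReachLe.append_of_no_west {π v : List Turn} {b : ℤ} (h : ReachLe π b)
    (hπ : net π % 4 = 2) (hv : west ∉ hs (net π) v) (hd : (net π + net v) % 4 = 0) :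
    ReachLe (π ++ v) (b + (hs (net π) v).count east) := by
  have hne : π ≠ [] := by rintro rfl; simp at hπ
  have hvv : v = [] ∨ net v = 2 ∨ net v = -2 := by
    rcases net_bounds_of_no_west _ hπ v hv with h | h | h
    · exact .inl h
    · right; left; omega
    · right; right; omega
  rcases hvv with rfl | h2 | h2
  · simp at hd; omega
  · have e : straightWord (net v) = [L, L] := by rw [h2]; rfl
    have := ReachLe.of_straight (A := π) (B := []) (b := b + 1) hv (by simpa using hne)
      (by rw [e]; simpa using h.append_LL hπ)
    have h4 : (hs (net π) [L, L]).count east = 1 := by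
      simp only [hs_cons, hs_nil, List.count_cons, List.count_nil, beq_iff_eq, dirOf_eq_east,
        turnVal_L]
      rw [if_pos (by omega), if_neg (by omega)]
    rw [e, h4] at this
    exact ReachLe.mono (by simpa using this) (by omega)
  · have e : straightWord (net v) = [R, R] := by rw [h2]; rfl
    have := ReachLe.of_straight (A := π) (B := []) (b := b + 1) hv (by simpa using hne)
      (by rw [e]; simpa using h.append_RR hπ)
    have h4 : (hs (net π) [R, R]).count east = 1 := by
      simp only [hs_cons, hs_nil, List.count_cons, List.count_nil, beq_iff_eq, dirOf_eq_east,
        turnVal_R]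
      rw [if_pos (by omega), if_neg (by omega)]
    rw [e, h4] at this
    exact ReachLe.mono (by simpa using this) (by omega)

theorem monoP_east_append {π v : List Turn} (hne : π ≠ []) (hπ : net π % 4 = 2)
    (hv : west ∉ hs (net π) v) : monoP east (π ++ v) = (hs (net π) v).count east := by
  obtain ⟨π', t, rfl⟩ := List.eq_nil_or_concat π |>.resolve_left hne
  simp only [List.concat_eq_append] at *
  have e : dirOf (0 + net π' + turnVal t) = west := by
    rw [dirOf_eq_west]; simpa using hπ
  rw [monoP, headings_eq, List.reverse_cons, hs_append, List.reverse_append, hs_append,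
    List.reverse_append, List.append_assoc, zero_add,
    List.takeWhile_append_of_pos, List.count_append, List.count_reverse]
  · simp only [hs_cons, hs_nil, e, List.reverse_cons, List.reverse_nil, List.nil_append,
      List.cons_append]
    rw [List.takeWhile_cons_of_neg (by decide)]
    simp
  · intro a ha
    have : a ≠ west := by rintro rfl; exact hv (List.mem_reverse.1 ha)
    simpa [east, west] using this

theorem monoO_of_no_west {σ : List Turn} (h : west ∉ headings σ) :
    monoO east σ = (headings σ).count east := by
  rw [monoO, List.takeWhile_eq_self_iff.2]
  intro a ha
  have : a ≠ west := by rintro rfl; exact h ha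
  simpa [east, west] using this

theorem count_takeWhile_map_flipY (z₁ z₂ : ℤ × ℤ) (l : List (ℤ × ℤ)) :
    ((l.map flipY).takeWhile (fun h => h ≠ -flipY z₁ ∧ h ≠ -flipY z₂)).count (flipY z₂) =
      (l.takeWhile (fun h => h ≠ -z₁ ∧ h ≠ -z₂)).count z₂ := by
  have hinj : Function.Injective flipY := by
    rintro ⟨a, b⟩ ⟨c, d⟩ h
    simpa [flipY] using h
  have hneg : ∀ a z : ℤ × ℤ, flipY a = -flipY z ↔ a = -z := by
    rintro ⟨a, b⟩ ⟨c, d⟩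
    simp [flipY]
    omega
  rw [List.takeWhile_map, List.count_map_of_injective _ _ hinj]
  simp only [Function.comp_def, ne_eq, hneg]

theorem count_takeWhile_map_flipY_east (l : List (ℤ × ℤ)) :
    ((l.map flipY).takeWhile (fun h => h ≠ -east)).count east =
      (l.takeWhile (fun h => h ≠ -east)).count east := by
  have := count_takeWhile_map_flipY east east l
  simpa [flipY, east] using this

theorem monoP_reverse {σ : List Turn} (h : net σ % 4 = 0) :
    monoP east σ.reverse = monoO east σ := by
  rw [monoP, monoO, headings_reverse σ h, List.reverse_reverse, count_takeWhile_map_flipY_east]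

theorem monoP_map_flipTurn (σ : List Turn) : monoP east (σ.map flipTurn) = monoP east σ := by
  rw [monoP, monoP, headings_map_flipTurn, ← List.map_reverse, count_takeWhile_map_flipY_east]

theorem monoO_map_flipTurn (σ : List Turn) : monoO east (σ.map flipTurn) = monoO east σ := by
  rw [monoO, monoO, headings_map_flipTurn, count_takeWhile_map_flipY_east]

theorem stairO_map_flipTurn (σ : List Turn) :
    stairO east north (σ.map flipTurn) = stairO east south σ := by
  rw [stairO, stairO, headings_map_flipTurn]
  exact count_takeWhile_map_flipY east south (headings σ)

theorem stairO_north_reverse {σ : List Turn} (h : net σ % 4 = 0) :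
    stairO east north σ.reverse = stairP east south σ := by
  rw [stairP, stairO, headings_reverse σ h, ← List.map_reverse]
  exact count_takeWhile_map_flipY east south (headings σ).reverse

theorem stairO_south_reverse {σ : List Turn} (h : net σ % 4 = 0) :
    stairO east south σ.reverse = stairP east north σ := by
  rw [stairP, stairO, headings_reverse σ h, ← List.map_reverse]
  exact count_takeWhile_map_flipY east north (headings σ).reverse

theorem west_mem_headings (σ : List Turn) : west ∈ headings σ ↔ west ∈ hs 0 σ := by
  rw [headings_eq, List.mem_cons, or_iff_right (by decide)]

theorem west_mem_headings_map_flipTurn (σ : List Turn) :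
    west ∈ headings (σ.map flipTurn) ↔ west ∈ headings σ := by
  rw [headings_map_flipTurn, List.mem_map]
  constructor
  · rintro ⟨⟨a, b⟩, h1, h2⟩
    simp only [flipY, west, Prod.mk.injEq, neg_eq_zero] at h2
    rw [h2.1, h2.2] at h1
    exact h1
  · intro h
    exact ⟨west, h, rfl⟩

theorem west_mem_headings_reverse {σ : List Turn} (h : net σ % 4 = 0) :
    west ∈ headings σ.reverse ↔ west ∈ headings σ := by
  rw [headings_reverse σ h, List.mem_reverse, ← headings_map_flipTurn,
    west_mem_headings_map_flipTurn]

theorem hasNet_map_flipTurn {σ : List Turn} {t : ℤ} (h : HasNet σ t) :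
    HasNet (σ.map flipTurn) (-t) := by
  obtain ⟨u, v, rfl, h⟩ := h
  exact ⟨u.map flipTurn, v.map flipTurn, by simp, by simp [h]⟩

theorem HasNet.reverse {σ : List Turn} {t : ℤ} (h : HasNet σ t) :
    HasNet σ.reverse (net σ - t) := by
  obtain ⟨u, v, rfl, h⟩ := h
  exact ⟨v.reverse, u.reverse, by simp, by simp [h]⟩

/-! ### Excess zero -/

/-- The decomposition at the last segment of direction `-x`. -/
theorem exists_split_last_west {σ : List Turn} (hw : west ∈ headings σ) :
    ∃ π v, σ = π ++ v ∧ π ≠ [] ∧ net π % 4 = 2 ∧ west ∉ hs (net π) v := by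
  obtain ⟨π, v, h1, h2, h3, h4⟩ := exists_last_west 0 σ ((west_mem_headings σ).1 hw)
  exact ⟨π, v, h1, h2, by simpa using h3, by simpa using h4⟩

/-- The part up to the last west segment has excess 2 or -2 and is bounded alone; the tail adds its
east segments. If the part has excess 2 but neither -1 nor 5 occurs in it, one of them occurs in the
tail. -/
theorem reachLe_of_net_zero_L {w : List Turn} (h0 : net (L :: w) = 0)
    (hh : HasNet (L :: w) (-1) ∨ HasNet (L :: w) 5) (hw : west ∈ headings (L :: w)) :
    ReachLe (L :: w) (monoP east (L :: w) + stairO east north (L :: w) + 2) := by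
  obtain ⟨π, v, e, hne, hπ, hv⟩ := exists_split_last_west hw
  rw [e] at hh h0 ⊢
  simp only [net_append] at h0
  obtain ⟨x, rfl⟩ : ∃ x, π = L :: x := by
    cases π with
    | nil => simp at hne
    | cons a x => simp at e; exact ⟨x, by rw [e.1]⟩
  rw [monoP_east_append hne hπ hv]
  have hso := stairO_le_append east north (L :: x) v
  have hvb : net v = 2 ∨ net v = -2 := by
    rcases net_bounds_of_no_west _ hπ v hv with rfl | h | h
    · simp at h0; simp [h0] at hπ
    · left; omega
    · right; omega
  rcases hvb with h2 | h2
  · have h3 : net ((L :: x).map flipTurn) = 2 := by rw [net_map_flipTurn]; omega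
    have := (reachLe_of_net_R (w := x.map flipTurn) 0 (by simpa using h3)).mirror
    simp only [List.map_cons, flipTurn_R, map_flipTurn_flipTurn] at this
    exact (this.append_of_no_west hπ hv (by omega)).mono (by push_cast; omega)
  · have hx : net (L :: x) = 2 := by omega
    by_cases hl : HasNet (L :: x) (-1) ∨ HasNet (L :: x) 5
    · exact ((reachLe_of_net_two hx hl).append_of_no_west hπ hv (by omega)).mono (by omega)
    · rw [hasNet_append, hasNet_append, hx] at hh
      rw [not_or] at hl
      rw [hx] at hv ⊢
      -- The tail starts at excess 2, so -3 in it is total excess -1. Excess 5 is impossible there: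
      -- descending from it to the final 0, the tail would pass level 2 and head west again.
      have h3 : HasNet v (-3) := by
        rcases hh with (hh | hh) | (hh | hh)
        · exact absurd hh hl.1
        · simpa using hh
        · exact absurd hh hl.2
        · exfalso
          obtain ⟨u, z, rfl, hu⟩ := hh
          simp [hu] at h2
          obtain ⟨z₁, z₂, rfl, hz⟩ := exists_split_down z (-3) (by omega) (by omega)
          rw [← List.append_assoc, hs_append] at hv
          simp only [List.mem_append, not_or] at hv
          have := net_bounds_of_no_west 2 (by norm_num) (u ++ z₁) (by simpa using hv.1)
          have h8 : net (u ++ z₁) = 0 := by rw [net_append, hu, hz]; norm_num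
          rcases this with h | h | h
          · simp only [List.append_eq_nil_iff] at h; rw [h.1] at hu; simp at hu
          · omega
          · omega
      obtain ⟨u, z, rfl, hu⟩ := h3
      have hz : net z = 1 := by simp at h2; omega
      rw [hs_append] at hv ⊢
      simp only [List.mem_append, not_or] at hv
      have base := reachLe_append_RRRL hx hl.1
      have s1 := ReachLe.of_straight (A := L :: x) (B := [L]) hv.1 (by simp)
        (by rw [hu]; simpa [straightWord] using base)
      have e1 : (hs 2 (straightWord (net u))).count east = 1 := by rw [hu]; decide
      rw [e1] at s1
      have s2 := ReachLe.of_straight (A := L :: x ++ u) (B := []) hv.2 (by simp)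
        (by rw [hz]; simpa [straightWord] using s1)
      have e2 : (hs (2 + net u) (straightWord (net z))).count east = 1 := by rw [hu, hz]; decide
      rw [e2] at s2
      refine ReachLe.mono (by simpa using s2) ?_
      rw [List.count_append]
      push_cast
      omega

theorem draw_nil : Real [] 1 := real_of_list _ [0, 0, 1] _ (by decide)

/-- The skeleton `LRRL` is a staircase up and one down, with three east segments and distance 3. The
stretches before and after the turn to excess -1 are straightened to `R` and `L`, at one unit per
east segment. -/
theorem reachLe_monotone_L {w : List Turn} (h0 : net (L :: w) = 0)
    (hh : HasNet (L :: w) (-1)) (hw : west ∉ headings (L :: w)) :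
    ReachLe (L :: w) (monoO east (L :: w)) := by
  rw [monoO_of_no_west hw]
  rw [west_mem_headings] at hw
  simp only [hasNet_cons, turnVal_L] at hh
  obtain ⟨u, v, rfl, hu⟩ := exists_split_of_hasNet_down (t := -1)
    (hh.resolve_left (by simp)) (by simp) (by simp)
  have hv : net v = 1 := by simp [hu] at h0; omega
  simp only [hs_cons, hs_append, List.mem_cons, List.mem_append, not_or, hu, turnVal_L,
    turnVal_R] at hw
  norm_num at hw
  have base : ReachLe [L, R, R, L] 3 := draw_LRRL.reachLe (exp_map_false [L, R, R, L])
  have s1 := ReachLe.of_straight (A := [L, R, R]) (B := []) hw.2.2.2 (by simp)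
    (by rw [hv]; simpa [straightWord] using base)
  have e1 : (hs (-1) (straightWord (net v))).count east = 1 := by rw [hv]; decide
  rw [e1] at s1
  have s2 := ReachLe.of_straight (A := [L]) (B := R :: v) hw.2.1 (by simp)
    (by rw [hu]; simpa [straightWord] using s1)
  have e2 : (hs 1 (straightWord (net u))).count east = 1 := by rw [hu]; decide
  rw [e2] at s2
  refine ReachLe.mono (by simpa using s2) ?_
  rw [headings_eq]
  simp only [hs_cons, hs_append, List.count_cons, List.count_append, hu, turnVal_L, turnVal_R]
  norm_num
  rw [if_neg (by decide), if_neg (by decide)]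
  omega

/-- The topological condition on the turn sequence of a chain that returns to the positive
`x`-axis from the side opposite to the one it first turns to, for equally many turns of both
kinds. -/
def Unlocked (σ : List Turn) : Prop :=
  (∀ w, σ = L :: w → HasNet σ (-1) ∨ HasNet σ 5) ∧ (∀ w, σ = R :: w → HasNet σ 1 ∨ HasNet σ (-5))

theorem Unlocked.mirror {σ : List Turn} (h : Unlocked σ) : Unlocked (σ.map flipTurn) := by
  constructor
  · intro w hw
    rcases h.2 (w.map flipTurn) (by rw [← map_flipTurn_flipTurn σ, hw]; rfl) with h | h
    · exact .inl (hasNet_map_flipTurn h)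
    · exact .inr (by simpa using hasNet_map_flipTurn h)
  · intro w hw
    rcases h.1 (w.map flipTurn) (by rw [← map_flipTurn_flipTurn σ, hw]; rfl) with h | h
    · exact .inl (by simpa using hasNet_map_flipTurn h)
    · exact .inr (hasNet_map_flipTurn h)

/-- For total excess 0 an excess `-t` of `σ` becomes an excess `t` of the reversed word. If the
reversed word starts with the other turn than the one required by the given condition, the first
turn of `σ` itself is the witness. -/
theorem Unlocked.reverse {σ : List Turn} (h : Unlocked σ) (h0 : net σ = 0) :
    Unlocked σ.reverse := by
  have key : ∀ t, HasNet σ (-t) → HasNet σ.reverse t := by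
    intro t ht
    have := ht.reverse
    rwa [h0, zero_sub, neg_neg] at this
  match σ with
  | [] => exact h
  | L :: w =>
    have h1 := key (-1) ⟨[L], w, rfl, by simp⟩
    exact ⟨fun _ _ => .inl h1, fun _ _ => (h.1 w rfl).imp (key 1) (key (-5))⟩
  | R :: w =>
    have h1 := key 1 ⟨[R], w, rfl, by simp⟩
    exact ⟨fun _ _ => (h.2 w rfl).imp (key (-1)) (key 5), fun _ _ => .inl h1⟩

theorem reachLe_monotone {σ : List Turn} (h0 : net σ = 0) (hs : Unlocked σ)
    (hw : west ∉ headings σ) : ReachLe σ (monoO east σ) := by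
  have five : ∀ w, net (L :: w) = 0 → Unlocked (L :: w) → west ∉ headings (L :: w) →
      ReachLe (L :: w) (monoO east (L :: w)) := by
    intro w h0 hs hw
    refine reachLe_monotone_L h0 ((hs.1 w rfl).resolve_right ?_) hw
    rintro ⟨u, v, e, hu⟩
    rw [west_mem_headings, e, hs_append, List.mem_append, not_or] at hw
    have := net_bounds_of_no_west_zero u hw.1
    omega
  match σ with
  | [] =>
    have : monoO east [] = 1 := by decide
    rw [this]
    exact draw_nil.reachLe Exp.nil
  | L :: w => exact five w h0 hs hw
  | R :: w =>
    have := five (w.map flipTurn) (by simp at h0 ⊢; omega) hs.mirror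
      (by have := (west_mem_headings_map_flipTurn (R :: w)).not.2 hw; simpa using this)
    have h2 := this.mirror
    have h3 := monoO_map_flipTurn (R :: w)
    simp only [List.map_cons, flipTurn_R, flipTurn_L, map_flipTurn_flipTurn] at h2 h3
    rwa [h3] at h2

theorem reachLe_of_net_zero_R {w : List Turn} (h0 : net (R :: w) = 0)
    (hs : HasNet (R :: w) 1 ∨ HasNet (R :: w) (-5)) (hw : west ∈ headings (R :: w)) :
    ReachLe (R :: w) (monoP east (R :: w) + stairO east south (R :: w) + 2) := by
  have := reachLe_of_net_zero_L (w := w.map flipTurn) (by simp at h0 ⊢; omega)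
    (hs.imp hasNet_map_flipTurn (fun h => by simpa using hasNet_map_flipTurn h))
    (by have := (west_mem_headings_map_flipTurn (R :: w)).2 hw; simpa using this)
  have h2 := this.mirror
  have h3 := monoP_map_flipTurn (R :: w)
  have h4 := stairO_map_flipTurn (R :: w)
  simp only [List.map_cons, flipTurn_R, flipTurn_L, map_flipTurn_flipTurn] at h2 h3 h4
  rwa [h3, h4] at h2

/-- The first turn of the reversed chain is the last turn of `σ`; as it is not known, the maximum of
both staircases at the endpoint appears. -/
theorem reachLe_reverse_of_net_zero {σ : List Turn} (h0 : net σ = 0) (hs : Unlocked σ)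
    (hw : west ∈ headings σ) :
    ReachLe σ (monoO east σ + max (stairP east north σ) (stairP east south σ) + 2) := by
  have hm : net σ % 4 = 0 := by rw [h0]; rfl
  have h1 : net σ.reverse = 0 := by rw [net_reverse, h0]
  have h2 := hs.reverse h0
  have h3 := (west_mem_headings_reverse hm).2 hw
  have h4 := monoP_reverse hm
  have h5 := stairO_north_reverse hm
  have h6 := stairO_south_reverse hm
  rw [← List.reverse_reverse σ]
  apply ReachLe.reverse _ (by rw [net_reverse]; exact hm)
  rw [List.reverse_reverse]
  generalize hτ : σ.reverse = τ at *
  match τ with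
  | [] => simp [headings, heading, east, west] at h3
  | L :: w => exact (reachLe_of_net_zero_L h1 (h2.1 w rfl) h3).mono (by omega)
  | R :: w => exact (reachLe_of_net_zero_R h1 (h2.2 w rfl) h3).mono (by omega)

theorem reachLe_reverse_of_net_zero_R {σ : List Turn} (h0 : net (σ ++ [R]) = 0)
    (hs : Unlocked (σ ++ [R])) (hw : west ∈ headings (σ ++ [R])) :
    ReachLe (σ ++ [R]) (monoO east (σ ++ [R]) + stairP east north (σ ++ [R]) + 2) := by
  have hm : net (σ ++ [R]) % 4 = 0 := by rw [h0]; rfl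
  have h1 : net (σ ++ [R]).reverse = 0 := by rw [net_reverse, h0]
  have h2 := hs.reverse h0
  have h3 := (west_mem_headings_reverse hm).2 hw
  have h4 := monoP_reverse hm
  have h6 := stairO_south_reverse hm
  rw [List.reverse_append] at h1 h2 h3 h4 h6
  have := (reachLe_of_net_zero_R h1 (h2.2 _ rfl) h3).reverse (by exact (congrArg (· % 4) h1))
  refine (ReachLe.mono (by simpa using this) ?_)
  simp only [List.reverse_cons, List.reverse_nil, List.nil_append, List.cons_append] at h4 h6 ⊢
  omega

/-! ### Positive excess divisible by four -/

theorem net_ge_west_mem {σ : List Turn} (h : 2 ≤ net σ) : west ∈ headings σ := by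
  by_contra hw
  rw [west_mem_headings] at hw
  have := net_bounds_of_no_west_zero σ hw
  omega

/-- The part up to the last west segment has excess `4 * m + 2` or `4 * m + 6` and is drawn as a
spiral; the larger value determines the constant. -/
theorem reachLe_monoP {σ : List Turn} {m : ℕ} (hm : 1 ≤ m) (h : net σ = 4 * m + 4) :
    ReachLe σ (monoP east σ + m + 3) ∧ ∀ w, σ = L :: w → ReachLe σ (monoP east σ + m + 2) := by
  obtain ⟨π, v, rfl, hne, hπ, hv⟩ := exists_split_last_west (net_ge_west_mem (σ := σ) (by omega))
  rw [monoP_east_append hne hπ hv]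
  simp only [net_append] at h
  obtain ⟨j, hj, hj1, hj2⟩ : ∃ j : ℕ, net π = 4 * j + 2 ∧ 1 ≤ j ∧ j ≤ m + 1 := by
    rcases net_bounds_of_no_west _ hπ v hv with rfl | h | h
    · simp at h; omega
    · exact ⟨m, by omega, hm, by omega⟩
    · exact ⟨m + 1, by push_cast; omega, by omega, le_rfl⟩
  match π with
  | [] => simp at hne
  | L :: x =>
    have := (reachLe_of_net_L hj1 hj).append_of_no_west hπ hv (by omega)
    exact ⟨this.mono (by omega), fun _ _ => this.mono (by omega)⟩
  | R :: x =>
    have := (reachLe_of_net_R j hj).append_of_no_west hπ hv (by omega)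
    refine ⟨this.mono (by omega), fun w hw => by simp at hw⟩

theorem reachLe_monoO {σ : List Turn} {m : ℕ} (hm : 1 ≤ m) (h : net σ = 4 * m + 4) :
    ReachLe σ (monoO east σ + m + 3) := by
  have h0 : net σ % 4 = 0 := by omega
  have := (reachLe_monoP hm (σ := σ.reverse) (by simpa using h)).1.reverse (by simpa using h0)
  rwa [List.reverse_reverse, monoP_reverse h0] at this

theorem exists_eq_append_pair {w : List Turn} (h : 2 ≤ w.length) : ∃ π s t, w = π ++ [s, t] := by
  rcases List.eq_nil_or_concat w with rfl | ⟨w', t, rfl⟩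
  · simp at h
  · rcases List.eq_nil_or_concat w' with rfl | ⟨π, s, rfl⟩
    · simp at h
    · exact ⟨π, s, t, by simp⟩

theorem net_le_length (w : List Turn) : net w ≤ w.length := by
  induction w with
  | nil => simp
  | cons t w ih => rcases turnVal_cases t with ⟨-, e⟩ | ⟨-, e⟩ <;> simp [e] <;> omega

/-- For excess 4 the bounds depend on the last two turns: equal ones are attached to a west end by
`append_LL` or `append_RR`, a pair of opposite ones needs its own drawings. -/
theorem exists_split_of_net_four {a z : Turn} {w : List Turn} (h : net (a :: w) = 4)
    (hz : (a :: w).getLast? = some z) : ∃ x s, a :: w = a :: x ++ [s, z] := by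
  have hl := net_le_length (a :: w)
  obtain ⟨π, s, t, e⟩ := exists_eq_append_pair (w := a :: w) (by omega)
  cases π with
  | nil =>
    have := net_le_length [s, t]
    rw [e] at h
    simp only [List.nil_append] at h
    simp at this
    simp at h
    omega
  | cons b x =>
    rw [e] at hz
    have : t = z := by
      rw [show b :: x ++ [s, t] = (b :: x ++ [s]) ++ [t] by simp, List.getLast?_concat] at hz
      simpa using hz
    subst this
    simp only [List.cons_append, List.cons.injEq] at e
    exact ⟨x, s, by simp [e.2]⟩

theorem reachLe_of_net_four_L_R {w : List Turn} (h : net (L :: w) = 4)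
    (hz : (L :: w).getLast? = some R) : ReachLe (L :: w) 3 := by
  obtain ⟨x, s, e⟩ := exists_split_of_net_four h hz
  rw [e] at h ⊢
  simp only [net_append] at h
  cases s with
  | L => exact reachLe_L_append_LR (by simp at h ⊢; omega)
  | R =>
    have h6 : net (L :: x) = 4 * (1 : ℕ) + 2 := by simp at h ⊢; omega
    exact ((reachLe_of_net_L le_rfl h6).append_RR (by omega)).mono (by norm_num)

theorem reachLe_of_net_four_R_R {w : List Turn} (h : net (R :: w) = 4)
    (hz : (R :: w).getLast? = some R) : ReachLe (R :: w) (stairO east south (R :: w) + 3) := by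
  obtain ⟨x, s, e⟩ := exists_split_of_net_four h hz
  rw [e] at h ⊢
  simp only [net_append] at h
  have hso := stairO_le_append east south (R :: x) [s, R]
  cases s with
  | L => exact (reachLe_R_append_LR (by simp at h ⊢; omega)).mono (by omega)
  | R =>
    have h6 : net (R :: x) = 4 * (1 : ℕ) + 2 := by simp at h ⊢; omega
    have := stairO_south_R x
    exact ((reachLe_of_net_R 1 h6).append_RR (by omega)).mono (by push_cast; omega)

theorem reachLe_of_net_four_L_L {w : List Turn} (h : net (L :: w) = 4)
    (hz : (L :: w).getLast? = some L) (hh : HasNet (L :: w) (-1)) :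
    ReachLe (L :: w) (stairO east north (L :: w) + 3) := by
  obtain ⟨x, s, e⟩ := exists_split_of_net_four h hz
  rw [e] at h hh ⊢
  rw [net_append] at h
  rw [hasNet_append] at hh
  have hso := stairO_le_append east north (L :: x) [s, L]
  cases s with
  | L =>
    have h2 : net (L :: x) = 2 := by simp only [net_cons, turnVal_L, net_nil] at h ⊢; omega
    have h1 : HasNet (L :: x) (-1) := by
      refine hh.resolve_right ?_
      rw [h2]
      simp only [hasNet_cons, hasNet_nil, turnVal_L]
      omega
    exact ((reachLe_of_net_two h2 (.inl h1)).append_LL (by omega)).mono (by omega)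
  | R =>
    have h4 : net (L :: x) = 4 := by
      simp only [net_cons, turnVal_L, turnVal_R, net_nil] at h ⊢; omega
    have h1 : HasNet (L :: x) (-1) := by
      refine hh.resolve_right ?_
      rw [h4]
      simp only [hasNet_cons, hasNet_nil, turnVal_L, turnVal_R]
      omega
    exact (reachLe_append_RL h4 h1).mono (by omega)

theorem ReachLe.of_reverse {σ : List Turn} {b : ℤ} (h : ReachLe σ.reverse b) (h0 : net σ % 4 = 0) :
    ReachLe σ b := by
  rw [← List.reverse_reverse σ]
  exact h.reverse (by simpa using h0)

theorem exists_reverse_eq_cons {σ : List Turn} {z : Turn} (h : σ.getLast? = some z) :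
    ∃ x, σ.reverse = z :: x := by
  rw [← List.head?_reverse] at h
  exact List.head?_eq_some_iff.1 h

/-- Reversal exchanges first and last turn and turns the staircases at the endpoint into staircases
at the start, so the remaining bounds for excess 4 follow from the previous ones. -/
theorem reachLe_of_net_four_R_L {w : List Turn} (h : net (R :: w) = 4)
    (hz : (R :: w).getLast? = some L) : ReachLe (R :: w) 3 := by
  obtain ⟨x, e⟩ := exists_reverse_eq_cons hz
  refine ReachLe.of_reverse ?_ (by rw [h]; rfl)
  rw [e]
  refine reachLe_of_net_four_L_R (by rw [← e, net_reverse, h])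
    (by rw [← e, List.getLast?_reverse]; rfl)

theorem reachLe_of_net_four_R_R_stairP {w : List Turn} (h : net (R :: w) = 4)
    (hz : (R :: w).getLast? = some R) : ReachLe (R :: w) (stairP east north (R :: w) + 3) := by
  obtain ⟨x, e⟩ := exists_reverse_eq_cons hz
  have h0 : net (R :: w) % 4 = 0 := by rw [h]; rfl
  refine ReachLe.of_reverse ?_ h0
  rw [← stairO_south_reverse h0, e]
  exact reachLe_of_net_four_R_R (by rw [← e, net_reverse, h])
    (by rw [← e, List.getLast?_reverse]; rfl)

theorem reachLe_of_net_four_L_L_stairP {w : List Turn} (h : net (L :: w) = 4)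
    (hz : (L :: w).getLast? = some L) (hh : HasNet (L :: w) 5) :
    ReachLe (L :: w) (stairP east south (L :: w) + 3) := by
  obtain ⟨x, e⟩ := exists_reverse_eq_cons hz
  have h0 : net (L :: w) % 4 = 0 := by rw [h]; rfl
  refine ReachLe.of_reverse ?_ h0
  have h1 := hh.reverse
  rw [h, e] at h1
  rw [← stairO_north_reverse h0, e]
  exact reachLe_of_net_four_L_L (by rw [← e, net_reverse, h])
    (by rw [← e, List.getLast?_reverse]; rfl) (by simpa using h1)

theorem reachLe_of_net_four_R {w : List Turn} (h : net (R :: w) = 4) :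
    ReachLe (R :: w) (stairO east south (R :: w) + 3) ∧
      ReachLe (R :: w) (stairP east north (R :: w) + 3) := by
  rcases hz : (R :: w).getLast? with _ | (_ | _)
  · simp at hz
  · have := reachLe_of_net_four_R_L h hz
    exact ⟨this.mono (by omega), this.mono (by omega)⟩
  · exact ⟨reachLe_of_net_four_R_R h hz, reachLe_of_net_four_R_R_stairP h hz⟩

theorem reachLe_of_net_four_L {w : List Turn} (h : net (L :: w) = 4) :
    (HasNet (L :: w) (-1) → ReachLe (L :: w) (stairO east north (L :: w) + 3)) ∧
      (HasNet (L :: w) 5 → ReachLe (L :: w) (stairP east south (L :: w) + 3)) := by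
  rcases hz : (L :: w).getLast? with _ | (_ | _)
  · simp at hz
  · exact ⟨reachLe_of_net_four_L_L h hz, reachLe_of_net_four_L_L_stairP h hz⟩
  · have := reachLe_of_net_four_L_R h hz
    exact ⟨fun _ => this.mono (by omega), fun _ => this.mono (by omega)⟩

/-! ### The topological condition: turning of secants of lattice paths -/

/-- The number of the half-open quadrant that contains a point different from the origin. -/
def quad (x y : ℤ) : ℤ :=
  if 0 < x ∧ 0 ≤ y then 0 else if x ≤ 0 ∧ 0 < y then 1 else if x < 0 ∧ y ≤ 0 then 2 else 3

theorem quad_cases (x y : ℤ) (h : x ≠ 0 ∨ y ≠ 0) :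
    (quad x y = 0 ∧ 0 < x ∧ 0 ≤ y) ∨ (quad x y = 1 ∧ x ≤ 0 ∧ 0 < y) ∨
      (quad x y = 2 ∧ x < 0 ∧ y ≤ 0) ∨ (quad x y = 3 ∧ 0 ≤ x ∧ y < 0) := by
  unfold quad
  split_ifs <;> simp <;> omega

theorem quad_range (x y : ℤ) : 0 ≤ quad x y ∧ quad x y ≤ 3 := by
  unfold quad
  split_ifs <;> simp

/-- The signed change of the quadrant number. -/
def turn (q q' : ℤ) : ℤ := (q' - q + 1) % 4 - 1

/-- Two points at distance one. -/
def Adj (x y x' y' : ℤ) : Prop :=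
  ((x' = x + 1 ∨ x' = x - 1) ∧ y' = y) ∨ (x' = x ∧ (y' = y + 1 ∨ y' = y - 1))

theorem Adj.not_opposite {x y x' y' : ℤ} (h : Adj x y x' y') (h1 : x ≠ 0 ∨ y ≠ 0)
    (h2 : x' ≠ 0 ∨ y' ≠ 0) : (quad x' y' - quad x y) % 4 ≠ 2 := by
  unfold Adj at h
  rcases quad_cases x y h1 with ⟨e, _, _⟩ | ⟨e, _, _⟩ | ⟨e, _, _⟩ | ⟨e, _, _⟩ <;> rw [e] <;>
  rcases quad_cases x' y' h2 with ⟨e', _, _⟩ | ⟨e', _, _⟩ | ⟨e', _, _⟩ | ⟨e', _, _⟩ <;> rw [e'] <;>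
  first | (norm_num; done) | omega

/-- Points of opposite quadrants that are two steps apart lie symmetrically to the origin on an
axis, and then the point between them would be the origin. -/
theorem not_opposite_of_adj_adj {x y x' y' x'' y'' : ℤ} (h : Adj x y x' y')
    (h' : Adj x' y' x'' y'') (h1 : x ≠ 0 ∨ y ≠ 0) (h2 : x' ≠ 0 ∨ y' ≠ 0) (h3 : x'' ≠ 0 ∨ y'' ≠ 0) :
    (quad x'' y'' - quad x y) % 4 ≠ 2 := by
  unfold Adj at h h'
  rcases quad_cases x y h1 with ⟨e, _, _⟩ | ⟨e, _, _⟩ | ⟨e, _, _⟩ | ⟨e, _, _⟩ <;> rw [e] <;>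
  rcases quad_cases x'' y'' h3 with ⟨e', _, _⟩ | ⟨e', _, _⟩ | ⟨e', _, _⟩ | ⟨e', _, _⟩ <;> rw [e'] <;>
  first | (norm_num; done) | omega

/-- `turn` takes the values -1, 0, 1 and 2; once opposite quadrants are excluded it is a true signed
angle, which adds up. -/
theorem turn_add_turn {a b c : ℤ} (hab : (b - a) % 4 ≠ 2) (hbc : (c - b) % 4 ≠ 2)
    (hac : (c - a) % 4 ≠ 2) :
    turn a b + turn b c = turn a c := by
  unfold turn
  omega

section Path

variable (X Y θ : ℕ → ℤ)

/-- The accumulated change of the quadrant numbers of the secants from the `i`-th point. -/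
def secantTurn (i : ℕ) : ℕ → ℤ
  | 0 => 0
  | m + 1 => secantTurn i m + turn (quad (X (i + 1 + m) - X i) (Y (i + 1 + m) - Y i))
      (quad (X (i + 2 + m) - X i) (Y (i + 2 + m) - Y i))

/-- A lattice path with unit steps whose `k`-th step has direction `θ k`. -/
def IsLatticePath (K : ℕ) : Prop :=
  (∀ k < K, (θ k % 4 = 0 ∧ X (k + 1) = X k + 1 ∧ Y (k + 1) = Y k) ∨
    (θ k % 4 = 1 ∧ X (k + 1) = X k ∧ Y (k + 1) = Y k + 1) ∨
    (θ k % 4 = 2 ∧ X (k + 1) = X k - 1 ∧ Y (k + 1) = Y k) ∨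
    (θ k % 4 = 3 ∧ X (k + 1) = X k ∧ Y (k + 1) = Y k - 1)) ∧
  (∀ k, k + 1 < K → -1 ≤ θ (k + 1) - θ k ∧ θ (k + 1) - θ k ≤ 1) ∧
  ∀ j k, j < k → k ≤ K → X k - X j ≠ 0 ∨ Y k - Y j ≠ 0

variable {X Y θ} {K : ℕ}

theorem IsLatticePath.quad_step (h : IsLatticePath X Y θ K) {k : ℕ} (hk : k < K) :
    quad (X (k + 1) - X k) (Y (k + 1) - Y k) = θ k % 4 := by
  have := quad_cases _ _ (h.2.2 k (k + 1) (by omega) (by omega))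
  rcases h.1 k hk with h1 | h1 | h1 | h1 <;> omega

theorem IsLatticePath.adj_right (h : IsLatticePath X Y θ K) {j k : ℕ} (hk : k < K) :
    Adj (X k - X j) (Y k - Y j) (X (k + 1) - X j) (Y (k + 1) - Y j) := by
  unfold Adj
  rcases h.1 k hk with h1 | h1 | h1 | h1 <;> omega

theorem IsLatticePath.adj_left (h : IsLatticePath X Y θ K) {j k : ℕ} (hk : k < K) :
    Adj (X j - X k) (Y j - Y k) (X j - X (k + 1)) (Y j - Y (k + 1)) := by
  unfold Adj
  rcases h.1 k hk with h1 | h1 | h1 | h1 <;> omega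

/-- This is the discrete homotopy of Hopf. The lift obtained by turning at the point `i` and
sweeping to the far end changes continuously when the base point moves to `i + 1`: around each
elementary square of secants the total turn vanishes, because no two of its corners lie in opposite
quadrants. -/
theorem IsLatticePath.secantTurn_succ (h : IsLatticePath X Y θ K) (i m : ℕ) (hm : i + 2 + m ≤ K) :
    θ (i + 1) + secantTurn X Y (i + 1) m = θ i + secantTurn X Y i (m + 1) +
      turn (quad (X (i + 2 + m) - X i) (Y (i + 2 + m) - Y i))
        (quad (X (i + 2 + m) - X (i + 1)) (Y (i + 2 + m) - Y (i + 1))) := by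
  induction m with
  | zero =>
    have n1 := h.2.2 i (i + 1) (by omega) (by omega)
    have n2 := h.2.2 i (i + 2) (by omega) (by omega)
    have n3 := h.2.2 (i + 1) (i + 2) (by omega) (by omega)
    have a1 := (h.adj_right (j := i) (k := i + 1) (by omega)).not_opposite n1 n2
    have a2 := (h.adj_left (j := i + 2) (k := i) (by omega)).not_opposite n2 n3
    have q1 := h.quad_step (k := i) (by omega)
    have q2 := h.quad_step (k := i + 1) (by omega)
    have d := h.2.1 i (by omega)
    simp only [secantTurn, add_zero, zero_add, show i + 1 + 1 = i + 2 by omega] at *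
    rw [add_assoc, turn_add_turn a1 a2
      (by rw [q1, q2]; omega), q1, q2]
    unfold turn
    omega
  | succ m ih =>
    have ih := ih (by omega)
    rw [secantTurn, ← add_assoc, ih, secantTurn.eq_2 X Y i (m + 1)]
    have e1 : i + 1 + 1 + m = i + 2 + m := by omega
    have e2 : i + 1 + 2 + m = i + 2 + (m + 1) := by omega
    have e3 : i + 1 + (m + 1) = i + 2 + m := by omega
    have e4 : i + 2 + m + 1 = i + 2 + (m + 1) := by omega
    have n1 := h.2.2 i (i + 2 + m) (by omega) (by omega)
    have n2 := h.2.2 i (i + 2 + (m + 1)) (by omega) (by omega)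
    have n3 := h.2.2 (i + 1) (i + 2 + m) (by omega) (by omega)
    have n4 := h.2.2 (i + 1) (i + 2 + (m + 1)) (by omega) (by omega)
    have a1 := h.adj_right (j := i) (k := i + 2 + m) (by omega)
    have a2 := h.adj_right (j := i + 1) (k := i + 2 + m) (by omega)
    have a3 := h.adj_left (j := i + 2 + m) (k := i) (by omega)
    have a4 := h.adj_left (j := i + 2 + (m + 1)) (k := i) (by omega)
    rw [e4] at a1 a2
    -- Two ways around the square: move the far end and then the base point, or the other way round.
    -- Both have the turn of the diagonal.
    have t1 := turn_add_turn
      (a1.not_opposite n1 n2) (a4.not_opposite n2 n4) (not_opposite_of_adj_adj a1 a4 n1 n2 n4)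
    have t2 := turn_add_turn
      (a3.not_opposite n1 n3) (a2.not_opposite n3 n4) (not_opposite_of_adj_adj a1 a4 n1 n2 n4)
    simp only [e1, e2, e3]
    omega

/-- A lattice path that starts along the positive `x`-axis, leaves it to the left, and returns to
it has a step whose excess is `-1` or `5`. -/
theorem IsLatticePath.exists_step (h : IsLatticePath X Y θ K) {s : ℕ} (hs : 0 < s) (hsK : s < K)
    (h0 : ∀ k < s, θ k = 0) (h1 : θ s = 1) (hX : X 0 = 0) (hY : Y 0 = 0) (hXK : 0 < X K)
    (hYK : Y K = 0) : ∃ k < K, θ k = -1 ∨ θ k = 5 := by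
  classical
  -- The path is followed only up to its first return to the positive axis.
  have hex : ∃ M, s < M ∧ M ≤ K ∧ 0 < X M ∧ Y M = 0 := ⟨K, hsK, le_rfl, hXK, hYK⟩
  obtain ⟨M, ⟨hM1, hM2, hM3, hM4⟩, hmin⟩ :
      ∃ M, (s < M ∧ M ≤ K ∧ 0 < X M ∧ Y M = 0) ∧
        ∀ k < M, ¬ (s < k ∧ k ≤ K ∧ 0 < X k ∧ Y k = 0) :=
    ⟨Nat.find hex, Nat.find_spec hex, fun k hk => Nat.find_min hex hk⟩
  have hinit : ∀ k ≤ s, X k = k ∧ Y k = 0 := by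
    intro k
    induction k with
    | zero => intro _; simp [hX, hY]
    | succ k ih =>
      intro hk
      obtain ⟨i1, i2⟩ := ih (by omega)
      have := h0 k (by omega)
      have := h.1 k (by omega)
      push_cast
      omega
  have hs1 : X (s + 1) = s ∧ Y (s + 1) = 1 := by
    have := hinit s le_rfl
    have := h.1 s hsK
    omega
  have hMs : (s : ℤ) < X M := by
    by_contra hc
    have e := hinit (X M).toNat (by omega)
    have := h.2.2 (X M).toNat M (by omega) hM2
    omega
  -- Seen from the start, the path does not cross the positive axis before its return, so the lifted
  -- angle is the quadrant number itself, without multiples of 4.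
  have hfrom : ∀ m, m + 1 < M → θ 0 + secantTurn X Y 0 m = quad (X (m + 1)) (Y (m + 1)) := by
    intro m
    induction m with
    | zero =>
      intro _
      have := h.quad_step (k := 0) (by omega)
      simp only [hX, hY, zero_add, sub_zero] at this
      simp [secantTurn, this, h0 0 hs]
    | succ m ih =>
      intro hm
      have ih := ih (by omega)
      have n1 := h.2.2 0 (m + 1) (by omega) (by omega)
      have n2 := h.2.2 0 (m + 1 + 1) (by omega) (by omega)
      have hopp := (h.adj_right (j := 0) (k := m + 1) (by omega)).not_opposite n1 n2
      rw [secantTurn, ← add_assoc, ih]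
      simp only [show 0 + 1 + m = m + 1 by omega, show 0 + 2 + m = m + 1 + 1 by omega, hX, hY,
        sub_zero] at *
      have c1 := quad_cases _ _ n1
      have c2 := quad_cases _ _ n2
      have st := h.1 (m + 1) (by omega)
      have m1 := hmin (m + 1) (by omega)
      have m2 := hmin (m + 1 + 1) (by omega)
      have key : ¬ (quad (X (m + 1)) (Y (m + 1)) = 0 ∧ quad (X (m + 1 + 1)) (Y (m + 1 + 1)) = 3) ∧
          ¬ (quad (X (m + 1)) (Y (m + 1)) = 3 ∧ quad (X (m + 1 + 1)) (Y (m + 1 + 1)) = 0) := by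
        rcases lt_trichotomy (m + 1) s with hlt | heq | hgt
        · have := hinit (m + 1) (by omega)
          have := hinit (m + 1 + 1) (by omega)
          omega
        · have := hinit (m + 1) (by omega)
          rw [← heq] at hs1
          omega
        · omega
      have r1 := quad_range (X (m + 1)) (Y (m + 1))
      have r2 := quad_range (X (m + 1 + 1)) (Y (m + 1 + 1))
      unfold turn
      omega
  obtain ⟨N, rfl⟩ : ∃ N, M = N + 2 := ⟨M - 2, by omega⟩
  have hlast : (θ (N + 1) % 4 = 1 ∧ X (N + 1) = X (N + 2) ∧ Y (N + 1) = -1) ∨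
      (θ (N + 1) % 4 = 3 ∧ X (N + 1) = X (N + 2) ∧ Y (N + 1) = 1) := by
    have st := h.1 (N + 1) (by omega)
    have n0 := h.2.2 0 (N + 1) (by omega) (by omega)
    by_cases hN : s = N + 1
    · rw [show s + 1 = N + 2 by omega] at hs1
      omega
    · have m1 := hmin (N + 1) (by omega)
      have e : N + 1 + 1 = N + 2 := rfl
      rw [e] at st
      omega
  -- The last step of the sweep returns to quadrant 0: from above the lift ends at 0, from below it
  -- ends at 4.
  obtain ⟨b, hb, hbase⟩ : ∃ b, ((b = 0 ∧ Y (N + 1) = 1) ∨ (b = 4 ∧ Y (N + 1) = -1)) ∧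
      θ 0 + secantTurn X Y 0 (N + 1) = b := by
    refine ⟨_, ?_, rfl⟩
    have e := hfrom N (by omega)
    have c1 := quad_cases (X (N + 1)) (Y (N + 1)) (by omega)
    have c2 := quad_cases (X (N + 2)) (Y (N + 2)) (by omega)
    rw [secantTurn, ← add_assoc, e]
    simp only [show 0 + 1 + N = N + 1 by omega, show 0 + 2 + N = N + 2 by omega, hX, hY, sub_zero]
    unfold turn
    omega
  -- Now the far end is fixed and the base point runs along the path. The secant never crosses the
  -- negative axis, so the lift is `b` plus the quadrant number normalized to the range from -2 to
  -- 1.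
  have hto : ∀ i ≤ N + 1, θ i + secantTurn X Y i (N + 1 - i) =
      b + ((quad (X (N + 2) - X i) (Y (N + 2) - Y i) + 2) % 4 - 2) := by
    intro i
    induction i with
    | zero =>
      intro _
      have c2 := quad_cases (X (N + 2)) (Y (N + 2)) (by omega)
      rw [Nat.sub_zero, hbase, hX, hY, sub_zero, sub_zero]
      omega
    | succ i ih =>
      intro hi
      have ih := ih (by omega)
      have e := h.secantTurn_succ i (N - i) (by omega)
      rw [show i + 2 + (N - i) = N + 2 by omega, show N - i + 1 = N + 1 - i by omega] at e
      rw [show N + 1 - (i + 1) = N - i by omega, e, ih]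
      have n1 := h.2.2 i (N + 2) (by omega) (by omega)
      have n2 := h.2.2 (i + 1) (N + 2) (by omega) (by omega)
      have hopp := (h.adj_left (j := N + 2) (k := i) (by omega)).not_opposite n1 n2
      have c1 := quad_cases _ _ n1
      have c2 := quad_cases _ _ n2
      have st := h.1 i (by omega)
      -- A secant along the negative axis would come from an axis point beyond the place of return.
      have key : ∀ k ≤ N + 1, Y k = 0 → X k < X (N + 2) := by
        intro k hk hy
        by_cases hks : k ≤ s
        · have := hinit k hks
          omega
        · have := hmin k (by omega)
          omega
      have k1 := key i (by omega)
      have k2 := key (i + 1) (by omega)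
      have r1 := quad_range (X (N + 2) - X i) (Y (N + 2) - Y i)
      have r2 := quad_range (X (N + 2) - X (i + 1)) (Y (N + 2) - Y (i + 1))
      unfold turn
      omega
  -- The last secant is the last step: arriving from above it heads south and has excess -1,
  -- arriving from below it heads north and has excess 4 + 1.
  have hend := hto (N + 1) le_rfl
  have hq := h.quad_step (k := N + 1) (by omega)
  rw [show N + 1 + 1 = N + 2 from rfl] at hq
  rw [Nat.sub_self, secantTurn, add_zero, hq] at hend
  exact ⟨N + 1, by omega, by omega⟩

end Path

/-! ### From chains to lattice paths with unit steps -/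

theorem smul_dirOf_injective {k a b : ℤ} (h : a • dirOf k = b • dirOf k) : a = b := by
  rcases dirOf_cases k with ⟨-, e⟩ | ⟨-, e⟩ | ⟨-, e⟩ | ⟨-, e⟩ <;>
    rw [e] at h <;> simp at h <;> exact h

theorem add_smul_heading_mem (σ : TurnSeq) (len : ℕ → ℕ) (i r : ℕ) (h : r ≤ len i) :
    vertex σ len i + (r : ℤ) • heading σ i ∈ segmentPts σ len i := by
  have e : vertex σ len (i + 1) = vertex σ len i + (len i : ℤ) • heading σ i := rfl
  rw [segmentPts, e, heading_eq, Set.uIcc, Set.mem_Icc]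
  generalize vertex σ len i = v
  rcases dirOf_cases (net (σ.take i)) with ⟨-, e⟩ | ⟨-, e⟩ | ⟨-, e⟩ | ⟨-, e⟩ <;> rw [e] <;>
    simp [Prod.le_def] <;> omega

/-- The segment and the position on it after `k` unit steps along a chain. -/
def unitStep (len : ℕ → ℕ) : ℕ → ℕ × ℕ
  | 0 => (0, 0)
  | k + 1 => if (unitStep len k).2 + 1 < len (unitStep len k).1 then
      ((unitStep len k).1, (unitStep len k).2 + 1) else ((unitStep len k).1 + 1, 0)

/-- The point after `k` unit steps along a chain. -/
def unitPoint (σ : TurnSeq) (len : ℕ → ℕ) (k : ℕ) : ℤ × ℤ :=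
  vertex σ len (unitStep len k).1 + ((unitStep len k).2 : ℤ) • heading σ (unitStep len k).1

section

variable {len : ℕ → ℕ} {n : ℕ}

theorem unitStep_spec (hpos : ∀ i ≤ n, 0 < len i) (k : ℕ)
    (hk : k ≤ ∑ j ∈ Finset.range (n + 1), len j) :
    ∑ j ∈ Finset.range (unitStep len k).1, len j + (unitStep len k).2 = k ∧
      (((unitStep len k).1 ≤ n ∧ (unitStep len k).2 < len (unitStep len k).1) ∨
        unitStep len k = (n + 1, 0)) := by
  induction k with
  | zero => simp [unitStep, hpos 0]
  | succ k ih =>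
    obtain ⟨h1, h2⟩ := ih (by omega)
    rcases h2 with ⟨h2, h3⟩ | h2
    · rw [unitStep]
      split_ifs with hc
      · exact ⟨by simp only; omega, .inl ⟨h2, hc⟩⟩
      · refine ⟨by simp only [Finset.sum_range_succ]; omega, ?_⟩
        by_cases hn : (unitStep len k).1 = n
        · right; simp [hn]
        · left; exact ⟨by simp only; omega, hpos _ (by omega)⟩
    · rw [h2] at h1
      simp only [add_zero] at h1
      omega

theorem sum_len_mono {a b : ℕ} (h : a ≤ b) :
    ∑ j ∈ Finset.range a, len j ≤ ∑ j ∈ Finset.range b, len j :=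
  Finset.sum_le_sum_of_subset (Finset.range_mono h)

theorem unitStep_lt (hpos : ∀ i ≤ n, 0 < len i) {k : ℕ}
    (hk : k < ∑ j ∈ Finset.range (n + 1), len j) :
    ∑ j ∈ Finset.range (unitStep len k).1, len j + (unitStep len k).2 = k ∧
      (unitStep len k).1 ≤ n ∧ (unitStep len k).2 < len (unitStep len k).1 := by
  obtain ⟨h1, h2⟩ := unitStep_spec hpos k hk.le
  refine ⟨h1, h2.resolve_right fun h => ?_⟩
  rw [h] at h1
  simp only [add_zero] at h1
  omega

theorem unitStep_end (hpos : ∀ i ≤ n, 0 < len i) :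
    unitStep len (∑ j ∈ Finset.range (n + 1), len j) = (n + 1, 0) := by
  obtain ⟨h1, h2⟩ := unitStep_spec hpos _ le_rfl
  refine h2.resolve_left fun ⟨h3, h4⟩ => ?_
  have := sum_len_mono (len := len) (show (unitStep len (∑ j ∈ Finset.range (n + 1), len j)).1 + 1 ≤ n + 1
    by omega)
  rw [Finset.sum_range_succ _ (unitStep len _).1] at this
  omega

end

theorem unitPoint_succ {σ : TurnSeq} {len : ℕ → ℕ} {k : ℕ}
    (h : (unitStep len k).2 < len (unitStep len k).1) :
    unitPoint σ len (k + 1) = unitPoint σ len k + heading σ (unitStep len k).1 := by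
  rw [unitPoint, unitPoint, unitStep]
  split_ifs with hc
  · push_cast
    rw [add_smul, one_smul, add_assoc]
  · have : len (unitStep len k).1 = (unitStep len k).2 + 1 := by omega
    rw [vertex, this]
    push_cast
    rw [add_smul, one_smul, zero_smul, add_zero, add_assoc]

theorem unitPoint_ne {σ : TurnSeq} {len : ℕ → ℕ} (hpos : ∀ i ≤ σ.length, 0 < len i)
    (hs : IsSimple σ len) {j k : ℕ} (hjk : j < k)
    (hk : k ≤ ∑ j ∈ Finset.range (σ.length + 1), len j) : unitPoint σ len j ≠ unitPoint σ len k := by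
  intro e
  obtain ⟨j1, j2, j3⟩ := unitStep_lt hpos (hjk.trans_le hk)
  have hmem := add_smul_heading_mem σ len _ _ j3.le
  obtain ⟨k1, k2⟩ := unitStep_spec hpos k hk
  unfold unitPoint at e
  generalize unitStep len j = p at *
  generalize unitStep len k = q at *
  obtain ⟨i, r⟩ := p
  obtain ⟨i', r'⟩ := q
  simp only [Prod.mk.injEq] at *
  have hv : ∀ i, vertex σ len (i + 1) = vertex σ len i + (len i : ℤ) • heading σ i := fun _ => rfl
  have hne : ∀ a b : ℕ, a < b → ∀ i, (a : ℤ) • heading σ i ≠ (b : ℤ) • heading σ i := by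
    intro a b hab i h
    rw [heading_eq] at h
    have := smul_dirOf_injective h
    omega
  rcases lt_trichotomy i i' with hlt | rfl | hgt
  · rcases k2 with ⟨k2, k3⟩ | ⟨rfl, rfl⟩
    · have hmem' := add_smul_heading_mem σ len i' r' k3.le
      obtain ⟨rfl, h2⟩ := hs i i' hlt k2 _ hmem (e ▸ hmem')
      rw [hv] at h2
      exact hne _ _ j3 i (add_left_cancel h2)
    -- The final point has segment number `n + 1`, which is no segment; it is treated as the far end
    -- of segment `n`.
    · simp only [Nat.cast_zero, zero_smul, add_zero] at e
      rcases Nat.lt_or_ge i σ.length with hi | hi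
      · have hmem' := add_smul_heading_mem σ len σ.length (len σ.length) le_rfl
        rw [← hv, ← e] at hmem'
        obtain ⟨h1, h2⟩ := hs i σ.length hi le_rfl _ hmem hmem'
        rw [e, hv] at h2
        have := hne 0 (len σ.length) (hpos _ le_rfl) σ.length
        simp only [Nat.cast_zero, zero_smul] at this
        exact this (add_eq_left.1 h2).symm
      · obtain rfl : i = σ.length := by omega
        rw [hv] at e
        exact hne _ _ j3 _ (add_left_cancel e)
  · exact hne r r' (by omega) i (add_left_cancel e)
  · have := sum_len_mono (len := len) (show i' + 1 ≤ i by omega)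
    rw [Finset.sum_range_succ] at this
    omega

theorem prefixNumber_succ_bounds (σ : TurnSeq) (i : ℕ) :
    -1 ≤ prefixNumber σ (i + 1) - prefixNumber σ i ∧
      prefixNumber σ (i + 1) - prefixNumber σ i ≤ 1 := by
  rw [prefixNumber_eq_net, prefixNumber_eq_net, List.take_add_one, net_append]
  cases σ[i]? with
  | none => simp
  | some t => rcases turnVal_cases t with ⟨-, e⟩ | ⟨-, e⟩ <;> simp [e]

/-- The number `s` is the length of the first segment, and `θ` gives each unit step the excess of
its segment, so an excess found on the path is an excess of the word. -/
theorem exists_latticePath {t : Turn} {w : List Turn} {len : ℕ → ℕ}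
    (hpos : ∀ i ≤ (t :: w).length, 0 < len i) (hs : IsSimple (t :: w) len) :
    ∃ (X Y θ : ℕ → ℤ) (K s : ℕ), IsLatticePath X Y θ K ∧ 0 < s ∧ s < K ∧ (∀ k < s, θ k = 0) ∧
      θ s = turnVal t ∧ X 0 = 0 ∧ Y 0 = 0 ∧
      (X K, Y K) = vertex (t :: w) len ((t :: w).length + 1) ∧
      ∀ k < K, HasNet (t :: w) (θ k) := by
  generalize hσ : t :: w = σ at *
  have hn : 1 ≤ σ.length := by rw [← hσ]; simp
  have hpos0 := hpos 0 (by omega)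
  have hpos1 := hpos 1 (by omega)
  have hS1 : ∑ j ∈ Finset.range 1, len j = len 0 := by simp
  have hS2 : ∑ j ∈ Finset.range 2, len j = len 0 + len 1 := by simp [Finset.sum_range_succ]
  have hK : len 0 < ∑ j ∈ Finset.range (σ.length + 1), len j := by
    have := sum_len_mono (len := len) (show 2 ≤ σ.length + 1 by omega)
    omega
  refine ⟨fun k => (unitPoint σ len k).1, fun k => (unitPoint σ len k).2,
    fun k => prefixNumber σ (unitStep len k).1, ∑ j ∈ Finset.range (σ.length + 1), len j, len 0,
    ⟨?_, ?_, ?_⟩, hpos0, hK, ?_, ?_, rfl, rfl, ?_, ?_⟩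
  · intro k hk
    obtain ⟨-, -, h3⟩ := unitStep_lt hpos hk
    simp only [unitPoint_succ h3, heading_eq, prefixNumber_eq_net]
    rcases dirOf_cases (net (σ.take (unitStep len k).1)) with ⟨h, e⟩ | ⟨h, e⟩ | ⟨h, e⟩ | ⟨h, e⟩ <;>
      rw [e] <;> simp [h] <;> rfl
  · intro k _
    simp only [unitStep]
    split_ifs
    · simp
    · exact prefixNumber_succ_bounds σ _
  · intro j k hjk hk
    have := unitPoint_ne hpos hs hjk hk
    simp only [ne_eq, Prod.ext_iff] at this ⊢
    omega
  · intro k hk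
    obtain ⟨h1, -, -⟩ := unitStep_lt hpos (hk.trans hK)
    have : (unitStep len k).1 = 0 := by
      by_contra hc
      have := sum_len_mono (len := len) (show 1 ≤ (unitStep len k).1 by omega)
      omega
    simp [this, prefixNumber_eq_net]
  · obtain ⟨h1, -, h3⟩ := unitStep_lt hpos hK
    have : (unitStep len (len 0)).1 = 1 := by
      by_contra hc
      rcases Nat.lt_or_gt_of_ne hc with hc | hc
      · have h0 : (unitStep len (len 0)).1 = 0 := by omega
        rw [h0] at h1 h3
        simp at h1
        omega
      · have := sum_len_mono (len := len) (show 2 ≤ (unitStep len (len 0)).1 by omega)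
        omega
    simp [this, prefixNumber_eq_net, ← hσ]
  · simp [unitPoint, unitStep_end hpos]
  · intro k hk
    obtain ⟨-, h2, -⟩ := unitStep_lt hpos hk
    exact (hasSegment_iff σ _).1 ⟨_, h2, rfl⟩

theorem IsLatticePath.mirror {X Y θ : ℕ → ℤ} {K : ℕ} (h : IsLatticePath X Y θ K) :
    IsLatticePath X (fun k => -Y k) (fun k => -θ k) K := by
  refine ⟨fun k hk => ?_, fun k hk => ?_, fun j k hjk hk => ?_⟩
  · have := h.1 k hk
    simp only
    omega
  · have := h.2.1 k hk
    simp only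
    omega
  · have := h.2.2 j k hjk hk
    simp only
    omega

theorem ReachesPlusX.hasNet_L {w : List Turn} (h : ReachesPlusX (L :: w)) :
    HasNet (L :: w) (-1) ∨ HasNet (L :: w) 5 := by
  obtain ⟨x, hx, len, hpos, hs, he⟩ := h
  obtain ⟨X, Y, θ, K, s, h1, h2, h3, h4, h5, h6, h7, h8, h9⟩ := exists_latticePath hpos hs
  rw [he, Prod.mk.injEq] at h8
  obtain ⟨k, hk, h⟩ := h1.exists_step h2 h3 h4 h5 h6 h7 (by omega) h8.2
  have h10 := h9 k hk
  exact h.imp (fun e => by rwa [e] at h10) (fun e => by rwa [e] at h10)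

theorem ReachesPlusX.hasNet_R {w : List Turn} (h : ReachesPlusX (R :: w)) :
    HasNet (R :: w) 1 ∨ HasNet (R :: w) (-5) := by
  obtain ⟨x, hx, len, hpos, hs, he⟩ := h
  obtain ⟨X, Y, θ, K, s, h1, h2, h3, h4, h5, h6, h7, h8, h9⟩ := exists_latticePath hpos hs
  rw [he, Prod.mk.injEq] at h8
  obtain ⟨k, hk, h⟩ := h1.mirror.exists_step h2 h3 (fun k hk => by simp [h4 k hk]) (by simp [h5]) h6
    (by simp [h7]) (by omega) (by simp [h8.2])
  have h10 := h9 k hk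
  exact h.imp (fun e => by rwa [show θ k = 1 by omega] at h10)
    (fun e => by rwa [show θ k = -5 by omega] at h10)

/-! ### Bounds for the closest point, including odd excess -/

theorem xPlus_le {σ : TurnSeq} {x : ℕ} {b : ℤ} (h : x ∈ plusXDistances σ ∧ (x : ℤ) ≤ b) :
    (xPlus σ : ℤ) ≤ b := by
  have : xPlus σ ≤ x := Nat.sInf_le h.1
  omega

theorem ReachLe.xPlus_le {σ : List Turn} {b : ℤ} (h : ReachLe σ b) : (xPlus σ : ℤ) ≤ b :=
  h.exists_mem.elim fun _ h => TurnSeq.xPlus_le h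

theorem ReachLe.reachesPlusX {σ : List Turn} {b : ℤ} (h : ReachLe σ b) : ReachesPlusX σ :=
  h.exists_mem.elim fun x h => ⟨x, h.1⟩

theorem ReachLe.xPlus_dropLast_le {σ : List Turn} {t : Turn} {b : ℤ} (h : ReachLe (σ ++ [t]) b)
    (h0 : (net σ + turnVal t) % 4 = 0) : (xPlus σ : ℤ) ≤ b - 1 :=
  (h.exists_mem_dropLast (by simpa using h0)).elim fun _ h => TurnSeq.xPlus_le h

theorem ReachLe.reachesPlusX_dropLast {σ : List Turn} {t : Turn} {b : ℤ} (h : ReachLe (σ ++ [t]) b)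
    (h0 : (net σ + turnVal t) % 4 = 0) : ReachesPlusX σ :=
  (h.exists_mem_dropLast (by simpa using h0)).elim fun x h => ⟨x, h.1⟩

theorem headings_append_of_east {σ : List Turn} {t : Turn} (h : (net σ + turnVal t) % 4 = 0) :
    headings (σ ++ [t]) = headings σ ++ [east] := by
  rw [headings_eq, headings_eq, hs_append]
  simp [dirOf_eq_east.2 h]

theorem monoP_append_of_east {σ : List Turn} {t : Turn} (h : (net σ + turnVal t) % 4 = 0) :
    monoP east (σ ++ [t]) = monoP east σ + 1 := by
  rw [monoP, headings_append_of_east h, List.reverse_append, List.reverse_singleton,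
    List.singleton_append, List.takeWhile_cons_of_pos (by decide), List.count_cons_self, monoP]

theorem stairP_append_of_east {σ : List Turn} {t : Turn} (h : (net σ + turnVal t) % 4 = 0)
    {z : ℤ × ℤ} (hz : z = north ∨ z = south) : stairP east z (σ ++ [t]) = stairP east z σ := by
  rw [stairP, headings_append_of_east h, List.reverse_append, List.reverse_singleton,
    List.singleton_append, List.takeWhile_cons_of_pos (by rcases hz with rfl | rfl <;> decide),
    List.count_cons_of_ne (by rcases hz with rfl | rfl <;> decide), stairP]

theorem count_takeWhile_append_singleton_le {α : Type*} [BEq α] (p : α → Bool) (l : List α)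
    (a z : α) : ((l ++ [a]).takeWhile p).count z ≤ (l.takeWhile p).count z + [a].count z := by
  induction l with
  | nil => simpa using (List.takeWhile_sublist p).count_le z
  | cons b l ih =>
    cases hb : p b with
    | true =>
      rw [List.cons_append, List.takeWhile_cons_of_pos hb, List.takeWhile_cons_of_pos hb,
        List.count_cons, List.count_cons]
      omega
    | false => simp [hb]

theorem monoO_append_of_east {σ : List Turn} {t : Turn} (h : (net σ + turnVal t) % 4 = 0) :
    monoO east (σ ++ [t]) ≤ monoO east σ + 1 := by
  rw [monoO, headings_append_of_east h]
  exact count_takeWhile_append_singleton_le _ _ _ _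

theorem stairO_append_of_east {σ : List Turn} {t : Turn} (h : (net σ + turnVal t) % 4 = 0)
    {z : ℤ × ℤ} (hz : z = north ∨ z = south) : stairO east z (σ ++ [t]) ≤ stairO east z σ := by
  rw [stairO, headings_append_of_east h]
  refine (count_takeWhile_append_singleton_le _ _ _ _).trans_eq ?_
  rw [List.count_cons_of_ne (by rcases hz with rfl | rfl <;> decide), List.count_nil, add_zero,
    stairO]

/-- The initial monotone part ends before the appended segment. Without this equality the unit saved
by cutting that segment off would be lost again. -/
theorem monoO_append_of_west {σ : List Turn} {t : Turn} (h : (net σ + turnVal t) % 4 = 0)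
    (hw : west ∈ headings σ) : monoO east (σ ++ [t]) = monoO east σ := by
  rw [monoO, headings_append_of_east h, monoO]
  congr 1
  generalize headings σ = l at hw
  induction l with
  | nil => simp at hw
  | cons a l ih =>
    by_cases ha : a = -east
    · simp [ha]
    · have : a ≠ west := by simpa [east, west] using ha
      rw [List.cons_append, List.takeWhile_cons_of_pos (by simpa using ha),
        List.takeWhile_cons_of_pos (by simpa using ha),
        ih ((List.mem_cons.1 hw).resolve_left this.symm)]

theorem ReachesPlusX.unlocked {σ : List Turn} (h : ReachesPlusX σ) : Unlocked σ :=
  ⟨fun _ e => by subst e; exact h.hasNet_L, fun _ e => by subst e; exact h.hasNet_R⟩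

theorem Unlocked.append_R {σ : List Turn} (h : Unlocked σ) (h1 : net σ = 1) :
    Unlocked (σ ++ [R]) := by
  match σ with
  | [] => simp at h1
  | L :: w =>
    exact ⟨fun _ _ => (h.1 w rfl).imp (·.append_right _) (·.append_right _), fun _ e => by simp at e⟩
  | R :: w =>
    have := hasNet_net (R :: w)
    rw [h1] at this
    exact ⟨fun _ e => by simp at e, fun _ _ => .inl (this.append_right _)⟩

theorem xPlus_of_net_zero {σ : List Turn} (h : ReachesPlusX σ) (h0 : net σ = 0) :
    (west ∉ headings σ → (xPlus σ : ℤ) ≤ monoO east σ) ∧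
      (west ∈ headings σ →
        (xPlus σ : ℤ) ≤ monoO east σ + max (stairP east north σ) (stairP east south σ) + 2 ∧
        (∀ w, σ = L :: w → (xPlus σ : ℤ) ≤ monoP east σ + stairO east north σ + 2) ∧
        ∀ w, σ = R :: w → (xPlus σ : ℤ) ≤ monoP east σ + stairO east south σ + 2) := by
  have hu := h.unlocked
  refine ⟨fun hw => (reachLe_monotone h0 hu hw).xPlus_le, fun hw =>
    ⟨(reachLe_reverse_of_net_zero h0 hu hw).xPlus_le, fun w e => ?_, fun w e => ?_⟩⟩
  · subst e
    exact (reachLe_of_net_zero_L h0 (hu.1 w rfl) hw).xPlus_le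
  · subst e
    exact (reachLe_of_net_zero_R h0 (hu.2 w rfl) hw).xPlus_le

/-- Appending `R` gives excess 0 with a known last turn, so only the north staircase at the endpoint
occurs in place of the maximum. The added east segment raises `monoP` by one, which offsets the unit
saved. -/
theorem xPlus_of_net_one {σ : List Turn} (h : ReachesPlusX σ) (h1 : net σ = 1) :
    (west ∉ headings σ → (xPlus σ : ℤ) ≤ monoO east σ) ∧
      (west ∈ headings σ →
        (xPlus σ : ℤ) ≤ monoO east σ + stairP east north σ + 1 ∧
        (∀ w, σ = L :: w → (xPlus σ : ℤ) ≤ monoP east σ + stairO east north σ + 2) ∧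
        ∀ w, σ = R :: w → (xPlus σ : ℤ) ≤ monoP east σ + stairO east south σ + 2) := by
  have hu := h.unlocked.append_R h1
  have h0 : net (σ ++ [R]) = 0 := by simp [h1]
  have hm : (net σ + turnVal R) % 4 = 0 := by simp [h1]
  have hwe : west ∈ headings (σ ++ [R]) ↔ west ∈ headings σ := by
    rw [headings_append_of_east hm, List.mem_append, or_iff_left (by decide)]
  have m1 := monoO_append_of_east hm
  have m2 := monoP_append_of_east hm
  have m3 := stairP_append_of_east hm (z := north) (.inl rfl)
  have m4 := stairO_append_of_east hm (z := north) (.inl rfl)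
  have m5 := stairO_append_of_east hm (z := south) (.inr rfl)
  refine ⟨fun hw => ?_, fun hw => ⟨?_, fun w e => ?_, fun w e => ?_⟩⟩
  · have := (reachLe_monotone h0 hu (hwe.not.2 hw)).xPlus_dropLast_le hm
    omega
  · have m6 := monoO_append_of_west hm hw
    have := (reachLe_reverse_of_net_zero_R h0 hu (hwe.2 hw)).xPlus_dropLast_le hm
    omega
  · subst e
    have := (reachLe_of_net_zero_L (w := w ++ [R]) h0 (hu.1 _ rfl) (hwe.2 hw)).xPlus_dropLast_le hm
    simp only [List.cons_append] at *
    omega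
  · subst e
    have := (reachLe_of_net_zero_R (w := w ++ [R]) h0 (hu.2 _ rfl) (hwe.2 hw)).xPlus_dropLast_le hm
    simp only [List.cons_append] at *
    omega

theorem xPlus_of_net_three_L {w : List Turn} (h : net (L :: w) = 3) :
    (HasNet (L :: w) (-1) → (xPlus (L :: w) : ℤ) ≤ stairO east north (L :: w) + 2) ∧
      (HasNet (L :: w) 5 → (xPlus (L :: w) : ℤ) ≤ stairP east south (L :: w) + 2) := by
  have hm : (net (L :: w) + turnVal L) % 4 = 0 := by rw [h]; rfl
  have h4 : net (L :: (w ++ [L])) = 4 := by simp at h ⊢; omega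
  have m1 := stairP_append_of_east hm (z := south) (.inr rfl)
  have m2 := stairO_append_of_east hm (z := north) (.inl rfl)
  obtain ⟨r1, r2⟩ := reachLe_of_net_four_L h4
  simp only [List.cons_append] at m1 m2
  constructor
  · intro hh
    have := ReachLe.xPlus_dropLast_le (σ := L :: w) (r1 (hh.append_right [L])) hm
    omega
  · intro hh
    have := ReachLe.xPlus_dropLast_le (σ := L :: w) (r2 (hh.append_right [L])) hm
    omega

theorem xPlus_of_net_three_R {w : List Turn} (h : net (R :: w) = 3) : xPlus (R :: w) ≤ 2 := by
  have hm : (net (R :: w) + turnVal L) % 4 = 0 := by rw [h]; rfl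
  have h4 : net (R :: (w ++ [L])) = 4 := by simp at h ⊢; omega
  have := ReachLe.xPlus_dropLast_le (σ := R :: w) (t := L)
    (reachLe_of_net_four_R_L (w := w ++ [L]) h4 (by rw [← List.cons_append, List.getLast?_concat])) hm
  omega

theorem reachLe_of_net_five_L {w : List Turn} (h : net (L :: w) = 5) :
    ReachLe (L :: w ++ [R]) 3 :=
  reachLe_of_net_four_L_R (w := w ++ [R]) (by simp at h ⊢; omega)
    (by rw [← List.cons_append, List.getLast?_concat])

theorem reachLe_of_net_five_R {w : List Turn} (h : net (R :: w) = 5) :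
    ReachLe (R :: w ++ [R]) (stairO east south (R :: w) + 3) ∧
      ReachLe (R :: w ++ [R]) (stairP east north (R :: w) + 3) := by
  have hm : (net (R :: w) + turnVal R) % 4 = 0 := by rw [h]; rfl
  have m1 := stairP_append_of_east hm (z := north) (.inl rfl)
  have m2 := stairO_append_of_east hm (z := south) (.inr rfl)
  obtain ⟨r1, r2⟩ := reachLe_of_net_four_R (w := w ++ [R]) (by simp at h ⊢; omega)
  simp only [List.cons_append] at m1 m2
  exact ⟨r1.mono (by omega), r2.mono (by omega)⟩

/-- The turn that makes the last direction east, for excess congruent to `1` or `3`. -/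
theorem exists_append_of_odd {σ : List Turn} {m : ℕ} (h : net σ = 4 * m + 3 ∨ net σ = 4 * m + 5) :
    ∃ t, net (σ ++ [t]) = 4 * m + 4 ∧ (net σ + turnVal t) % 4 = 0 := by
  rcases h with h | h
  · exact ⟨L, by simp; omega, by simp; omega⟩
  · exact ⟨R, by simp; omega, by simp; omega⟩

theorem xPlus_of_large_net {σ : List Turn} {m : ℕ} (hm : 1 ≤ m)
    (h : net σ = 4 * m + 3 ∨ net σ = 4 * m + 4 ∨ net σ = 4 * m + 5) :
    ReachesPlusX σ ∧ (xPlus σ : ℤ) ≤ monoO east σ + m + 3 ∧ (xPlus σ : ℤ) ≤ monoP east σ + m + 3 ∧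
      ∀ w, σ = L :: w → (xPlus σ : ℤ) ≤ monoP east σ + m + 2 := by
  by_cases h4 : net σ = 4 * m + 4
  · have r1 := reachLe_monoO hm h4
    obtain ⟨r2, r3⟩ := reachLe_monoP hm h4
    exact ⟨r1.reachesPlusX, r1.xPlus_le, r2.xPlus_le, fun w e => (r3 w e).xPlus_le⟩
  · obtain ⟨t, ht, ht0⟩ := exists_append_of_odd (σ := σ) (m := m) (by tauto)
    have r1 := reachLe_monoO hm ht
    obtain ⟨r2, r3⟩ := reachLe_monoP hm ht
    have m1 := monoO_append_of_east ht0
    have m2 := monoP_append_of_east ht0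
    have b1 := r1.xPlus_dropLast_le ht0
    have b2 := r2.xPlus_dropLast_le ht0
    refine ⟨r1.reachesPlusX_dropLast ht0, by omega, by omega, fun w e => ?_⟩
    have b3 := (r3 (w ++ [t]) (by rw [e]; rfl)).xPlus_dropLast_le ht0
    omega

theorem reachesPlusX_of_five_le {σ : List Turn} (h : 5 ≤ net σ) : ReachesPlusX σ := by
  obtain ⟨m, hm⟩ : ∃ m : ℕ, net σ = 4 * m + 2 ∨ net σ = 4 * m + 3 ∨ net σ = 4 * m + 4 ∨
      net σ = 4 * m + 5 := ⟨((net σ - 2) / 4).toNat, by omega⟩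
  match σ with
  | [] => simp at h
  | L :: w =>
    by_cases h5 : net (L :: w) = 5
    · exact (reachLe_of_net_five_L h5).reachesPlusX_dropLast (by rw [h5]; rfl)
    · rcases hm with hm | hm
      · exact (reachLe_of_net_L (by omega) hm).reachesPlusX
      · exact (xPlus_of_large_net (by omega) hm).1
  | R :: w =>
    by_cases h5 : net (R :: w) = 5
    · exact (reachLe_of_net_five_R h5).1.reachesPlusX_dropLast (by rw [h5]; rfl)
    · rcases hm with hm | hm
      · exact (reachLe_of_net_R _ hm).reachesPlusX
      · exact (xPlus_of_large_net (by omega) hm).1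

end TurnSeq

theorem theorem4 (σ : TurnSeq) (l r d : ℕ) (hl : σ.count Turn.L = l) (hr : σ.count Turn.R = r)
    (hd : l = r + d) :
    (5 ≤ d → σ.ReachesPlusX) ∧
    (σ.ReachesPlusX →
      -- the case l - r = 0
      (d = 0 →
        (σ.IsPlusXMonotone → σ.xPlus ≤ TurnSeq.monoO TurnSeq.east σ) ∧
        (¬ σ.IsPlusXMonotone →
          (σ.head? = some Turn.L →
            σ.xPlus ≤ min
              (TurnSeq.monoO TurnSeq.east σ +
                max (TurnSeq.stairP TurnSeq.east TurnSeq.north σ)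
                  (TurnSeq.stairP TurnSeq.east TurnSeq.south σ))
              (TurnSeq.monoP TurnSeq.east σ +
                TurnSeq.stairO TurnSeq.east TurnSeq.north σ) + 2) ∧
          (σ.head? = some Turn.R →
            σ.xPlus ≤ min
              (TurnSeq.monoO TurnSeq.east σ +
                max (TurnSeq.stairP TurnSeq.east TurnSeq.north σ)
                  (TurnSeq.stairP TurnSeq.east TurnSeq.south σ))
              (TurnSeq.monoP TurnSeq.east σ +
                TurnSeq.stairO TurnSeq.east TurnSeq.south σ) + 2))) ∧
      -- the case l - r = 1
      (d = 1 →
        (σ.IsPlusXMonotone → σ.xPlus ≤ TurnSeq.monoO TurnSeq.east σ) ∧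
        (¬ σ.IsPlusXMonotone →
          (σ.head? = some Turn.L →
            σ.xPlus ≤ min
              (TurnSeq.monoO TurnSeq.east σ +
                TurnSeq.stairP TurnSeq.east TurnSeq.north σ + 1)
              (TurnSeq.monoP TurnSeq.east σ +
                TurnSeq.stairO TurnSeq.east TurnSeq.north σ + 2)) ∧
          (σ.head? = some Turn.R →
            σ.xPlus ≤ min
              (TurnSeq.monoO TurnSeq.east σ +
                TurnSeq.stairP TurnSeq.east TurnSeq.north σ + 1)
              (TurnSeq.monoP TurnSeq.east σ +
                TurnSeq.stairO TurnSeq.east TurnSeq.south σ + 2)))) ∧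
      -- the case l - r = 2
      (d = 2 →
        (σ.head? = some Turn.L →
          σ.xPlus ≤ TurnSeq.stairO TurnSeq.east TurnSeq.north σ + 2) ∧
        (σ.head? = some Turn.R → σ.xPlus ≤ 2)) ∧
      -- the case l - r = 3
      (d = 3 →
        (σ.head? = some Turn.L →
          (σ.HasSegment (-1) ∨ σ.HasSegment 5) ∧
          (σ.HasSegment (-1) → ¬ σ.HasSegment 5 →
            σ.xPlus ≤ TurnSeq.stairO TurnSeq.east TurnSeq.north σ + 2) ∧
          (¬ σ.HasSegment (-1) → σ.HasSegment 5 →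
            σ.xPlus ≤ TurnSeq.stairP TurnSeq.east TurnSeq.south σ + 2) ∧
          (σ.HasSegment (-1) → σ.HasSegment 5 →
            σ.xPlus ≤ min (TurnSeq.stairO TurnSeq.east TurnSeq.north σ)
              (TurnSeq.stairP TurnSeq.east TurnSeq.south σ) + 2)) ∧
        (σ.head? = some Turn.R → σ.xPlus ≤ 2)) ∧
      -- the case l - r = 4
      (d = 4 →
        (σ.head? = some Turn.L →
          (σ.HasSegment (-1) ∨ σ.HasSegment 5) ∧
          (σ.HasSegment (-1) → ¬ σ.HasSegment 5 →
            σ.xPlus ≤ TurnSeq.stairO TurnSeq.east TurnSeq.north σ + 3) ∧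
          (¬ σ.HasSegment (-1) → σ.HasSegment 5 →
            σ.xPlus ≤ TurnSeq.stairP TurnSeq.east TurnSeq.south σ + 3) ∧
          (σ.HasSegment (-1) → σ.HasSegment 5 →
            σ.xPlus ≤ min (TurnSeq.stairO TurnSeq.east TurnSeq.north σ)
              (TurnSeq.stairP TurnSeq.east TurnSeq.south σ) + 3)) ∧
        (σ.head? = some Turn.R →
          σ.xPlus ≤ min (TurnSeq.stairO TurnSeq.east TurnSeq.south σ)
            (TurnSeq.stairP TurnSeq.east TurnSeq.north σ) + 3)) ∧
      -- the case l - r = 5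
      (d = 5 →
        (σ.head? = some Turn.L → σ.xPlus ≤ 2) ∧
        (σ.head? = some Turn.R →
          σ.xPlus ≤ min (TurnSeq.stairO TurnSeq.east TurnSeq.south σ)
            (TurnSeq.stairP TurnSeq.east TurnSeq.north σ) + 2)) ∧
      -- the case l - r ≥ 6 and l - r ≡ 2 (mod 4)
      (6 ≤ d → d % 4 = 2 →
        (σ.head? = some Turn.L → σ.xPlus ≤ (d + 2) / 4) ∧
        (σ.head? = some Turn.R → σ.xPlus ≤ (d + 2) / 4 + 1)) ∧
      -- the case l - r ≥ 6 and l - r ≢ 2 (mod 4)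
      (6 ≤ d → d % 4 ≠ 2 →
        (σ.head? = some Turn.L →
          σ.xPlus ≤ min (TurnSeq.monoO TurnSeq.east σ + 2)
            (TurnSeq.monoP TurnSeq.east σ + 1) + (d + 2) / 4) ∧
        (σ.head? = some Turn.R →
          σ.xPlus ≤ min (TurnSeq.monoO TurnSeq.east σ + 2)
            (TurnSeq.monoP TurnSeq.east σ + 2) + (d + 2) / 4))) := by
  have h0 : TurnSeq.net σ = d := by rw [TurnSeq.net_eq_count]; omega
  refine ⟨fun hd => TurnSeq.reachesPlusX_of_five_le (by omega), fun h => ?_⟩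
  have hu := h.unlocked
  simp only [TurnSeq.IsPlusXMonotone, TurnSeq.hasSegment_iff, not_not, List.head?_eq_some_iff]
  refine ⟨fun e => ?_, fun e => ?_, fun e => ?_, fun e => ?_, fun e => ?_, fun e => ?_,
    fun h6 e => ?_, fun h6 e => ?_⟩
  · obtain ⟨h1, h2⟩ := TurnSeq.xPlus_of_net_zero h (by omega)
    refine ⟨fun hw => by have := h1 hw; omega, fun hw => ?_⟩
    obtain ⟨h3, h4, h5⟩ := h2 hw
    exact ⟨fun ⟨w, hσ⟩ => by have := h4 w hσ; omega, fun ⟨w, hσ⟩ => by have := h5 w hσ; omega⟩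
  · obtain ⟨h1, h2⟩ := TurnSeq.xPlus_of_net_one h (by omega)
    refine ⟨fun hw => by have := h1 hw; omega, fun hw => ?_⟩
    obtain ⟨h3, h4, h5⟩ := h2 hw
    exact ⟨fun ⟨w, hσ⟩ => by have := h4 w hσ; omega, fun ⟨w, hσ⟩ => by have := h5 w hσ; omega⟩
  · refine ⟨fun ⟨w, hσ⟩ => ?_, fun ⟨w, hσ⟩ => ?_⟩ <;> subst hσ
    · have := (TurnSeq.reachLe_of_net_two (by omega) (hu.1 w rfl)).xPlus_le
      omega
    · have := (TurnSeq.reachLe_of_net_R (w := w) 0 (by push_cast; omega)).xPlus_le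
      omega
  · refine ⟨fun ⟨w, hσ⟩ => ?_, fun ⟨w, hσ⟩ => ?_⟩ <;> subst hσ
    · obtain ⟨h1, h2⟩ := TurnSeq.xPlus_of_net_three_L (w := w) (by omega)
      refine ⟨hu.1 w rfl, fun a _ => ?_, fun _ b => ?_, fun a b => ?_⟩
      · have := h1 a; omega
      · have := h2 b; omega
      · have := h1 a; have := h2 b; omega
    · exact TurnSeq.xPlus_of_net_three_R (by omega)
  · refine ⟨fun ⟨w, hσ⟩ => ?_, fun ⟨w, hσ⟩ => ?_⟩ <;> subst hσ
    · obtain ⟨h1, h2⟩ := TurnSeq.reachLe_of_net_four_L (w := w) (by omega)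
      refine ⟨hu.1 w rfl, fun a _ => ?_, fun _ b => ?_, fun a b => ?_⟩
      · have := (h1 a).xPlus_le; omega
      · have := (h2 b).xPlus_le; omega
      · have := (h1 a).xPlus_le; have := (h2 b).xPlus_le; omega
    · obtain ⟨h1, h2⟩ := TurnSeq.reachLe_of_net_four_R (w := w) (by omega)
      have := h1.xPlus_le
      have := h2.xPlus_le
      omega
  · refine ⟨fun ⟨w, hσ⟩ => ?_, fun ⟨w, hσ⟩ => ?_⟩ <;> subst hσ
    · have := (TurnSeq.reachLe_of_net_five_L (w := w) (by omega)).xPlus_dropLast_le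
        (by rw [h0, e]; rfl)
      omega
    · obtain ⟨h1, h2⟩ := TurnSeq.reachLe_of_net_five_R (w := w) (by omega)
      have := h1.xPlus_dropLast_le (by rw [h0, e]; rfl)
      have := h2.xPlus_dropLast_le (by rw [h0, e]; rfl)
      omega
  · refine ⟨fun ⟨w, hσ⟩ => ?_, fun ⟨w, hσ⟩ => ?_⟩ <;> subst hσ
    · have := (TurnSeq.reachLe_of_net_L (j := d / 4) (w := w) (by omega) (by omega)).xPlus_le
      omega
    · have := (TurnSeq.reachLe_of_net_R (w := w) (d / 4) (by omega)).xPlus_le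
      omega
  -- With `m = (d + 2) / 4 - 1`, the values of `d` not congruent to 2 modulo 4 are exactly `4 * m +
  -- 3`, `4 * m + 4` and `4 * m + 5`.
  · obtain ⟨-, h1, h2, h3⟩ := TurnSeq.xPlus_of_large_net (σ := σ) (m := (d + 2) / 4 - 1) (by omega)
      (by omega)
    exact ⟨fun ⟨w, hσ⟩ => by have := h3 w hσ; omega, fun _ => by omega⟩
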